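/- Let $d\ge 1$ and $R\in\mathbb R$. Functions are complex valued, $\hat v(\xi)=\int_{\mathbb R^d}e^{-ix\cdot\xi}v(x)\,dx$, $\mathcal F_{\mathbb R}$ is the analogous transform in one variable, $d\omega$ is the surface measure of $\mathbb S^{d-1}$, and $\mathbb R\times\mathbb S^{d-1}$ carries the product measure. Put $\tau=\frac{d-1}{4}\pi$, $c_0=\frac{1}{\sqrt{2(2\pi)^{d-1}}}$ and, for $\omega\in\mathbb S^{d-1}$, define $f_\omega^{\pm}$ and $\mathcal T v$ on the Fourier side by \[\mathcal F_{\mathbb R}(f_\omega^\pm)(\nu)=\mathbf 1_{\pm\nu\ge0}|\nu|^{\frac{d-1}2}\hat f(\nu\omega),\qquad \mathcal F_{s\to\nu}(\mathcal Tv)(\nu,\omega)=c_0|\nu|^{\frac{d-1}2}\left(e^{i\tau}\mathbf 1_{\nu<0}+e^{-i\tau}\mathbf 1_{\nu\ge0}\right)\hat v(\nu\omega),\] while $\partial_s$ acts as multiplication by $i\nu$. Let $u$ be a solution, in the sense of distributions, of $\partial_{tt}u-\Delta u=0$ on $\mathbb R\times\mathbb R^d$ with $(u,\partial_tu)_{|t=0}=(u_0,u_1)$,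 and let $f=\frac12\left[u_0+\frac1{i|D|}u_1\right]$, $g=\frac12\left[u_0-\frac1{i|D|}u_1\right]$, where $|D|$ is the Fourier multiplier by $|\xi|$ (so that $u=e^{it|D|}f+e^{-it|D|}g$). 1) If $(u_0,u_1)\in L^2\times\dot H^{-1}(\mathbb R^d)$ (equivalently, $f,g\in L^2$) and $u\in C(\mathbb R;L^2)$, then $f^-_\omega(s)$ and $g^+_\omega(s)$ are in $L^2(\mathbb R\times\mathbb S^{d-1})$ and \[\lim_{t\to+\infty}\|u(t)\|_{L^2(|x|\ge t+R)}^2=\frac1{(2\pi)^{d-1}}\int_{\mathbb S^{d-1}}\left\|f_\omega^-+e^{-i\frac\pi2(d-1)}g_\omega^+\right\|_{L^2([R,+\infty))}^2d\omega .\] 2) If $(u_0,u_1)\in\dot H^1\times L^2(\mathbb R^d)$ (where $\dot H^1$ is the space of tempered distributions with gradient in $L^2$) and $\nabla u,\partial_tu\in C(\mathbb R;L^2)$, then $\partial_sf^-_\omega$, $\partial_sg^+_\omega$, $\partial_s\mathcal Tu_0$, $\mathcal Tu_1$ are in $L^2(\mathbb R\times\mathbb S^{d-1})$, the following limits exist,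 and \[\lim_{t\to+\infty}\|\nabla u(t)\|_{L^2(|x|\ge t+R)}^2=\lim_{t\to+\infty}\|\partial_tu(t)\|_{L^2(|x|\ge t+R)}^2\] (equipartition of the exterior energy), the common value being \[\frac1{(2\pi)^{d-1}}\int_{\mathbb S^{d-1}}\left\|e^{i\tau}\partial_sf_\omega^-+e^{-i\tau}\partial_sg_\omega^+\right\|_{L^2([R,+\infty))}^2d\omega=\frac12\left\|\partial_s\mathcal Tu_0-\mathcal Tu_1\right\|_{L^2([R,+\infty)\times\mathbb S^{d-1})}^2 .\] Moreover the limits in \[E_{ext,R}(u):=\frac12\left(\lim_{t\to+\infty}\left(\|\nabla u\|_{L^2(|x|\ge t+R)}^2+\|\partial_tu\|_{L^2(|x|\ge t+R)}^2\right)+\lim_{t\to-\infty}\left(\|\nabla u\|_{L^2(|x|\ge|t|+R)}^2+\|\partial_tu\|_{L^2(|x|\ge|t|+R)}^2\right)\right)\] exist, and \[E_{ext,R}(u)=\|\partial_s\mathcal Tu_0\|_{L^2([R,+\infty)\times\mathbb S^{d-1})}^2+\|\mathcal Tu_1\|_{L^2([R,+\infty)\times\mathbb S^{d-1})}^2 .\]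 -/

import Mathlib

open MeasureTheory Filter Topology
open scoped SchwartzMap FourierTransform LineDeriv Laplacian

noncomputable section

namespace WaveCone

/-- Euclidean space `ℝᵈ`. -/
abbrev Space (d : ℕ) := EuclideanSpace ℝ (Fin d)

/-- The unit sphere of `ℝᵈ`. -/
abbrev Sph (d : ℕ) := Metric.sphere (0 : Space d) 1

/-- The surface measure of the unit sphere (normalised by `dx = r ^ (d - 1) dr dω`). -/
def surface (d : ℕ) : Measure (Sph d) := (volume : Measure (Space d)).toSphere

/-- Complex valued square integrable functions on `ℝᵈ`. -/
abbrev L2 (d : ℕ) := Lp ℂ 2 (volume : Measure (Space d))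

/-- Complex valued square integrable functions on the line. -/
abbrev L2R := Lp ℂ 2 (volume : Measure ℝ)

variable {d : ℕ}

/-! ### Function spaces for the data -/

/-- `u ∈ L²(ℝᵈ)`. -/
def MemL2 (u : 𝓢'(Space d, ℂ)) : Prop := ∃ F : L2 d, u = (F : 𝓢'(Space d, ℂ))

/-- The partial derivative of a tempered distribution. -/
def partialDeriv (j : Fin d) (u : 𝓢'(Space d, ℂ)) : 𝓢'(Space d, ℂ) :=
  ∂_{EuclideanSpace.single j (1 : ℝ)} u

/-- `u ∈ Ḣ¹(ℝᵈ)`: all first order distributional derivatives are square integrable. -/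
def MemH1dot (u : 𝓢'(Space d, ℂ)) : Prop := ∀ j : Fin d, MemL2 (partialDeriv j u)

/-- `u ∈ Ḣ⁻¹(ℝᵈ)`: the Fourier transform `û(ξ) = ∫ exp (-i x·ξ) u(x) dx` is a function `U` with
`|ξ|⁻¹ U ∈ L²`. Mathlib's `𝓕 u` is `ξ ↦ û(2πξ)`. -/
def MemHneg1dot (u : 𝓢'(Space d, ℂ)) : Prop :=
  ∃ U : Space d → ℂ, MemLp (fun ξ => U ξ / (‖ξ‖ : ℂ)) 2 volume ∧
    AEStronglyMeasurable U volume ∧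
    ∀ φ : 𝓢(Space d, ℂ), 𝓕 u φ = ∫ ξ, U ((2 * Real.pi) • ξ) * φ ξ

/-! ### The Fourier transform as a function -/

/-- Away from the origin, `û(ξ) = ∫ exp (-i x·ξ) u(x) dx` is the locally integrable
function `U`. Mathlib's `𝓕 u` is `ξ ↦ û(2πξ)`. -/
def IsFourierFun (u : 𝓢'(Space d, ℂ)) (U : Space d → ℂ) : Prop :=
  LocallyIntegrableOn U {0}ᶜ volume ∧
    ∀ φ : 𝓢(Space d, ℂ), HasCompactSupport φ → (0 : Space d) ∉ tsupport φ →
      𝓕 u φ = ∫ ξ, U ((2 * Real.pi) • ξ) * φ ξ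

open Classical in
/-- The Fourier transform `û`, as a function (unique almost everywhere), for those `u` whose
Fourier transform is a function away from the origin; this includes `L²`, `Ḣ¹` and `Ḣ⁻¹`. -/
def hat (u : 𝓢'(Space d, ℂ)) : Space d → ℂ :=
  if h : ∃ U, IsFourierFun u U then h.choose else 0

/-- The Fourier transform of `f = (u₀ + (i|D|)⁻¹ u₁) / 2`. -/
def fHat (u₀ u₁ : 𝓢'(Space d, ℂ)) (ξ : Space d) : ℂ :=
  (1 / 2) * (hat u₀ ξ + hat u₁ ξ / (Complex.I * ‖ξ‖))

/-- The Fourier transform of `g = (u₀ - (i|D|)⁻¹ u₁) / 2`. -/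
def gHat (u₀ u₁ : 𝓢'(Space d, ℂ)) (ξ : Space d) : ℂ :=
  (1 / 2) * (hat u₀ ξ - hat u₁ ξ / (Complex.I * ‖ξ‖))

/-! ### Functions of `(s, ω)` given by their Fourier transform in `s` -/

/-- `τ = (d - 1) π / 4`. -/
def tau (d : ℕ) : ℝ := ((d : ℝ) - 1) / 4 * Real.pi

/-- `c₀ = (2 (2π) ^ (d - 1)) ^ (-1/2)`. -/
def c0 (d : ℕ) : ℝ := 1 / Real.sqrt (2 * (2 * Real.pi) ^ ((d : ℝ) - 1))

/-- The Fourier transform in `s` of `f_ω⁻`, where `U` is the Fourier transform of `f`. -/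
def minusSymbol (U : Space d → ℂ) (ω : Sph d) (ν : ℝ) : ℂ :=
  if ν ≤ 0 then ((|ν| ^ (((d : ℝ) - 1) / 2) : ℝ) : ℂ) * U (ν • (ω : Space d)) else 0

/-- The Fourier transform in `s` of `f_ω⁺`, where `U` is the Fourier transform of `f`. -/
def plusSymbol (U : Space d → ℂ) (ω : Sph d) (ν : ℝ) : ℂ :=
  if 0 ≤ ν then ((|ν| ^ (((d : ℝ) - 1) / 2) : ℝ) : ℂ) * U (ν • (ω : Space d)) else 0

/-- The Fourier transform in `s` of `𝒯 v`, where `U` is the Fourier transform of `v`. -/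
def tSymbol (U : Space d → ℂ) (ω : Sph d) (ν : ℝ) : ℂ :=
  (c0 d : ℂ) * ((|ν| ^ (((d : ℝ) - 1) / 2) : ℝ) : ℂ) *
    (if ν < 0 then Complex.exp (Complex.I * tau d) else Complex.exp (-(Complex.I * tau d))) *
    U (ν • (ω : Space d))

/-- On the Fourier side, `∂_s` is multiplication by `i ν`. -/
def dsSymbol (H : Sph d → ℝ → ℂ) (ω : Sph d) (ν : ℝ) : ℂ := Complex.I * (ν : ℂ) * H ω ν

open Classical in
/-- The function on the line with (square integrable) Fourier transform
`ν ↦ ∫ exp (-i s ν) h(s) ds = H ν`; Mathlib's `𝓕 h` is `k ↦ H (2πk)`. -/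
def invFourier (H : ℝ → ℂ) : L2R :=
  if h : MemLp (fun k : ℝ => H (2 * Real.pi * k)) 2 volume then 𝓕⁻ (h.toLp _) else 0

/-- The function of `(s, ω)`, as a family in `ω` of functions of `s`, whose Fourier transform
in `s` is `H ω`. -/
def ofSymbol (H : Sph d → ℝ → ℂ) (ω : Sph d) : L2R := invFourier (H ω)

/-- `H` is the partial Fourier transform of an element of `L²(ℝ × 𝕊ᵈ⁻¹) = L²(𝕊ᵈ⁻¹; L²(ℝ))`. -/
def IsL2Symbol (H : Sph d → ℝ → ℂ) : Prop :=
  (∀ᵐ ω ∂(surface d), MemLp (H ω) 2 volume) ∧ MemLp (ofSymbol H) 2 (surface d)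

/-- `𝒯 v`. -/
def T (v : 𝓢'(Space d, ℂ)) : Sph d → L2R := ofSymbol (tSymbol (hat v))

/-- `∂_s 𝒯 v`. -/
def dsT (v : 𝓢'(Space d, ℂ)) : Sph d → L2R := ofSymbol (dsSymbol (tSymbol (hat v)))

/-- `‖h‖²` in `L²([R, ∞))`. -/
def sqNormHalfLine (R : ℝ) (h : L2R) : ℝ := ∫ s in Set.Ici R, ‖h s‖ ^ 2

/-- `‖h‖²` in `L²([R, ∞) × 𝕊ᵈ⁻¹)`. -/
def sqNormCylinder (R : ℝ) (h : Sph d → L2R) : ℝ :=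
  ∫ ω, sqNormHalfLine R (h ω) ∂(surface d)

/-! ### The wave equation -/

/-- `u` is a distributional solution of `∂_tt u = Δ u` with `u(0) = u₀`, `∂_t u(0) = u₁`, and
`v = ∂_t u`. -/
structure IsWaveSolution (u v : ℝ → 𝓢'(Space d, ℂ)) (u₀ u₁ : 𝓢'(Space d, ℂ)) : Prop where
  init : u 0 = u₀
  init_deriv : v 0 = u₁
  hasDerivAt : ∀ (φ : 𝓢(Space d, ℂ)) (t : ℝ), HasDerivAt (fun r => u r φ) (v t φ) t
  hasDerivAt_deriv : ∀ (φ : 𝓢(Space d, ℂ)) (t : ℝ), HasDerivAt (fun r => v r φ) ((Δ (u t)) φ) t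

/-- `F = u` as a continuous function of time with values in `L²`. -/
def IsContL2 (u : ℝ → 𝓢'(Space d, ℂ)) (F : ℝ → L2 d) : Prop :=
  Continuous F ∧ ∀ t, u t = (F t : 𝓢'(Space d, ℂ))

/-- `‖F‖²` in `L²(|x| ≥ ρ)`. -/
def sqNormOutside (ρ : ℝ) (F : L2 d) : ℝ := ∫ x in {x : Space d | ρ ≤ ‖x‖}, ‖F x‖ ^ 2

/-- `‖G‖²` in `L²(|x| ≥ ρ)` for a vector field `G`. -/
def sqNormOutsideVec (ρ : ℝ) (G : Fin d → L2 d) : ℝ := ∑ j, sqNormOutside ρ (G j)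

/-- The limits defining the exterior energy `E_{ext,R}` exist, and its value is `e`; here `G` is
the gradient and `V` the time derivative of the space-time function. -/
def HasExteriorEnergy (R : ℝ) (G : ℝ → Fin d → L2 d) (V : ℝ → L2 d) (e : ℝ) : Prop :=
  ∃ a b : ℝ,
    Tendsto (fun t => sqNormOutsideVec (t + R) (G t) + sqNormOutside (t + R) (V t))
      atTop (𝓝 a) ∧
    Tendsto (fun t => sqNormOutsideVec (|t| + R) (G t) + sqNormOutside (|t| + R) (V t))
      atBot (𝓝 b) ∧
    e = 1 / 2 * (a + b)

end WaveCone

end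

noncomputable section

namespace WaveCone

variable {d : ℕ}

/-! ### Square integrable families of functions on the line -/

/-! Polar coordinates weighted by `r^((d-1)/2)`, with `r = s + t`, turn the exterior region `|x| ≥ t
+ R` into the fixed half-cylinder `s ≥ R` (`sqNormOutside_eq`). The claim thus reduces to strong
limits in `L²(𝕊ᵈ⁻¹; L²(ℝ))`: read in these moving coordinates, `e^{±it|D|} f` converges, up to the
phase `e^{±iτ}`, to the function of `s` whose Fourier transform is `|ν|^((d-1)/2) f̂(νω)` cut to one
sign of `ν` (`tendsto_outgoing_one`, `tendsto_outgoing_neg`).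

Both the evolutions and the limit maps are isometries, so a total family suffices. Translated
Poisson kernels form one (`span_gen_dense`), and `e^{-it|D|}` merely moves their height from `1` to
the complex value `1 + it`. The kernel stays explicit there: subordination to Gaussians gives it at
real heights (`poisson_of_pos`) and analytic continuation extends it (`poisson_eq`). Along the light
cone the limit can be read off pointwise (`tendsto_poisson_cone`), and a Gamma integral identifies
the profile (`fourierInv_polarFun_genFun`). Pointwise convergence together with equal norms forces
strong convergence (`tendsto_of_tendsto_pointwise`), so no stationary phase is needed. Complex
conjugation transfers the result to `e^{it|D|}`.

A distributional solution continuous in `L²` is the sum of the two half waves (`fourier_wave_eq`):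
tested on compactly supported frequencies the Laplacian is bounded, and iterating the equation gives
bounds with factorial decay for the difference.

For finite energy data, each `∂_j u` and `∂_t u` solves the equation with data in `L² × Ḣ⁻¹`, namely
`(∂_j u₀, ∂_j u₁)` and `(u₁, Δu₀)`. Their radiation fields are `ω_j` times, respectively minus, one
common field `energyRadiation`, and `∑ ω_j² = 1` yields equipartition. That field is `(∂_s 𝒯u₀ -
𝒯u₁) / (2c₀)` (`dsT_sub_T`). Time reversal changes the sign of `u₁`, so averaging both time
directions is the parallelogram identity (`hasExteriorEnergy`). -/

instance : IsFiniteMeasure (surface d) := by unfold surface; infer_instance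

theorem eLpNorm_two_sq {α E : Type*} [MeasurableSpace α] [NormedAddCommGroup E] (μ : Measure α)
    (f : α → E) : eLpNorm f 2 μ ^ 2 = ∫⁻ x, ‖f x‖ₑ ^ 2 ∂μ := by
  rw [eLpNorm_eq_lintegral_rpow_enorm_toReal (by norm_num) (by norm_num), ← ENNReal.rpow_natCast,
    ← ENNReal.rpow_mul]
  simp

theorem memLp_two_iff_lintegral {α E : Type*} [MeasurableSpace α] [NormedAddCommGroup E]
    {μ : Measure α} {f : α → E} :
    MemLp f 2 μ ↔ AEStronglyMeasurable f μ ∧ ∫⁻ x, ‖f x‖ₑ ^ 2 ∂μ < ⊤ := by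
  rw [MemLp, ← eLpNorm_two_sq]
  simp [ENNReal.pow_lt_top_iff]

theorem secondCountable_L2R : SecondCountableTopology L2R := by
  have : Fact ((2 : ENNReal) ≠ ⊤) := ⟨by norm_num⟩
  infer_instance

open Classical in
/-- The class in `L²(ℝ)` of a square integrable function, and `0` for other functions. -/
def toL2R (h : ℝ → ℂ) : L2R := if hh : MemLp h 2 volume then hh.toLp h else 0

theorem toL2R_of_memLp {h : ℝ → ℂ} (hh : MemLp h 2 volume) : toL2R h = hh.toLp h := by
  simp [toL2R, hh]

theorem toL2R_congr {h k : ℝ → ℂ} (hk : h =ᵐ[volume] k) : toL2R h = toL2R k := by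
  by_cases hh : MemLp h 2 volume
  · have hh' : MemLp k 2 volume := (memLp_congr_ae hk).1 hh
    rw [toL2R_of_memLp hh, toL2R_of_memLp hh']
    exact (MemLp.toLp_eq_toLp_iff hh hh').2 hk
  · have hh' : ¬ MemLp k 2 volume := fun h' => hh ((memLp_congr_ae hk).2 h')
    simp [toL2R, hh, hh']

theorem toL2R_coe (h : L2R) : toL2R h = h := by
  rw [toL2R_of_memLp (Lp.memLp h)]; simp

theorem toL2R_add {h k : ℝ → ℂ} (hh : MemLp h 2 volume) (hk : MemLp k 2 volume) :
    toL2R (fun s => h s + k s) = toL2R h + toL2R k := by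
  rw [toL2R_of_memLp hh, toL2R_of_memLp hk, ← MemLp.toLp_add,
    ← toL2R_of_memLp (hh.add hk)]; rfl

theorem toL2R_const_mul (c : ℂ) {h : ℝ → ℂ} (hh : MemLp h 2 volume) :
    toL2R (fun s => c * h s) = c • toL2R h := by
  rw [toL2R_of_memLp hh, ← MemLp.toLp_const_smul, ← toL2R_of_memLp (hh.const_smul c)]; rfl

theorem enorm_toL2R_sq {h : ℝ → ℂ} (hh : MemLp h 2 volume) :
    ‖toL2R h‖ₑ ^ 2 = ∫⁻ s, ‖h s‖ₑ ^ 2 := by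
  rw [toL2R_of_memLp hh, Lp.enorm_toLp, eLpNorm_two_sq]

/-- In a second countable space every open set is a countable union of balls, and the preimage of a
ball is a sublevel set of a distance function. -/
theorem measurable_of_edist {α β : Type*} [MeasurableSpace α] [PseudoEMetricSpace β]
    [SecondCountableTopology β] [MeasurableSpace β] [BorelSpace β] {f : α → β}
    (h : ∀ y, Measurable fun x => edist (f x) y) : Measurable f := by
  refine measurable_of_isOpen fun U hU => ?_
  have hball : ∀ y : U, ∃ r > 0, Metric.eball (y : β) r ⊆ U :=
    fun y => EMetric.isOpen_iff.1 hU y y.2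
  choose r hr hrU using hball
  obtain ⟨T, hT, hTU⟩ := TopologicalSpace.isOpen_iUnion_countable
    (fun y : U => Metric.eball (y : β) (r y)) (fun y => Metric.isOpen_eball)
  have hU' : U = ⋃ y ∈ T, Metric.eball (y : β) (r y) := by
    rw [hTU]
    refine Set.Subset.antisymm (fun y hy => ?_) (Set.iUnion_subset hrU)
    exact Set.mem_iUnion.2 ⟨⟨y, hy⟩, Metric.mem_eball_self (hr _)⟩
  rw [hU', Set.preimage_iUnion₂]
  exact MeasurableSet.biUnion hT fun y _ => measurableSet_lt (h y) measurable_const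

section Family

variable {α : Type*} [MeasurableSpace α] {μ : Measure α}

/-- By Tonelli the distance from `H ω` to a fixed element of `L²(ℝ)` is measurable in `ω`; joint
measurability thus becomes measurability of an `L²(ℝ)`-valued map. -/
theorem stronglyMeasurable_toL2R {H : α → ℝ → ℂ}
    (hH : StronglyMeasurable (Function.uncurry H)) :
    StronglyMeasurable fun ω => toL2R (H ω) := by
  let : MeasurableSpace L2R := borel L2R
  have : BorelSpace L2R := ⟨rfl⟩
  have : SecondCountableTopology L2R := secondCountable_L2R
  refine Measurable.stronglyMeasurable ?_
  refine measurable_of_edist fun h => ?_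
  have hsec : ∀ ω, AEStronglyMeasurable (H ω) volume := fun ω =>
    (hH.comp_measurable measurable_prodMk_left).aestronglyMeasurable
  have hS : Measurable fun ω => ∫⁻ s, ‖H ω s‖ₑ ^ 2 :=
    Measurable.lintegral_prod_right' (f := fun q : α × ℝ => ‖H q.1 q.2‖ₑ ^ 2)
      (hH.enorm.pow_const 2)
  obtain ⟨h', hh', hhh'⟩ := Lp.aestronglyMeasurable h
  have hD : Measurable fun ω => ∫⁻ s, ‖H ω s - h' s‖ₑ ^ 2 :=
    Measurable.lintegral_prod_right' (f := fun q : α × ℝ => ‖H q.1 q.2 - h' q.2‖ₑ ^ 2)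
      ((hH.sub (hh'.comp_measurable measurable_snd)).enorm.pow_const 2)
  -- Where `H ω` is not square integrable, `toL2R` takes its default value `0`, so the distance
  -- there is the constant `edist 0 h`.
  have key : (fun ω => edist (toL2R (H ω)) h) = fun ω =>
      {ω | ∫⁻ s, ‖H ω s‖ₑ ^ 2 < ⊤}.indicator
        (fun ω => (∫⁻ s, ‖H ω s - h' s‖ₑ ^ 2) ^ (1 / 2 : ℝ)) ω +
      {ω | ∫⁻ s, ‖H ω s‖ₑ ^ 2 < ⊤}ᶜ.indicator (fun _ => edist 0 h) ω := by
    funext ω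
    by_cases hω : ∫⁻ s, ‖H ω s‖ₑ ^ 2 < ⊤
    · have hω' : ω ∈ {ω | ∫⁻ s, ‖H ω s‖ₑ ^ 2 < ⊤} := hω
      have hm : MemLp (H ω) 2 volume := memLp_two_iff_lintegral.2 ⟨hsec ω, hω⟩
      rw [Set.indicator_of_mem hω', Set.indicator_of_notMem (by simpa using hω.ne), add_zero,
        toL2R_of_memLp hm, Lp.edist_def]
      rw [eLpNorm_eq_lintegral_rpow_enorm_toReal (by norm_num) (by norm_num)]
      simp only [ENNReal.toReal_ofNat, ENNReal.rpow_ofNat]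
      congr 1
      refine lintegral_congr_ae ?_
      filter_upwards [hm.coeFn_toLp, hhh'] with s h1 h2
      simp [h1, h2]
    · have hm : ¬ MemLp (H ω) 2 volume := fun h => hω (memLp_two_iff_lintegral.1 h).2
      have hω' : ω ∉ {ω | ∫⁻ s, ‖H ω s‖ₑ ^ 2 < ⊤} := hω
      rw [Set.indicator_of_notMem hω', Set.indicator_of_mem (by simpa using hω), zero_add]
      simp [toL2R, hm]
  rw [key]
  have hSm : MeasurableSet {ω | ∫⁻ s, ‖H ω s‖ₑ ^ 2 < ⊤} := measurableSet_lt hS measurable_const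
  exact ((hD.pow_const _).indicator hSm).add (measurable_const.indicator hSm.compl)

theorem aestronglyMeasurable_toL2R {H : α → ℝ → ℂ}
    (hH : AEStronglyMeasurable (Function.uncurry H) (μ.prod volume)) :
    AEStronglyMeasurable (fun ω => toL2R (H ω)) μ := by
  obtain ⟨K, hK, hKH⟩ := hH
  have h1 := stronglyMeasurable_toL2R (H := fun a b => K (a, b)) hK
  refine ⟨_, h1, ?_⟩
  filter_upwards [Measure.ae_ae_of_ae_prod hKH] with ω hω
  exact toL2R_congr hω

theorem ae_memLp_of_lintegral {H : α → ℝ → ℂ}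
    (hH : AEStronglyMeasurable (Function.uncurry H) (μ.prod volume))
    (hfin : ∫⁻ ω, (∫⁻ s, ‖H ω s‖ₑ ^ 2) ∂μ < ⊤) : ∀ᵐ ω ∂μ, MemLp (H ω) 2 volume := by
  have hm : AEMeasurable (fun ω => ∫⁻ s, ‖H ω s‖ₑ ^ 2) μ :=
    AEMeasurable.lintegral_prod_right' (f := fun q : α × ℝ => ‖H q.1 q.2‖ₑ ^ 2)
      (hH.enorm.pow_const 2)
  filter_upwards [ae_lt_top' hm hfin.ne, hH.prodMk_left] with ω h1 h2
  exact memLp_two_iff_lintegral.2 ⟨h2, h1⟩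

theorem lintegral_enorm_toL2R {H : α → ℝ → ℂ}
    (h : ∀ᵐ ω ∂μ, MemLp (H ω) 2 volume) :
    ∫⁻ ω, ‖toL2R (H ω)‖ₑ ^ 2 ∂μ = ∫⁻ ω, (∫⁻ s, ‖H ω s‖ₑ ^ 2) ∂μ := by
  refine lintegral_congr_ae ?_
  filter_upwards [h] with ω hω
  exact enorm_toL2R_sq hω

theorem memLp_toL2R {H : α → ℝ → ℂ}
    (hH : AEStronglyMeasurable (Function.uncurry H) (μ.prod volume))
    (hfin : ∫⁻ ω, (∫⁻ s, ‖H ω s‖ₑ ^ 2) ∂μ < ⊤) : MemLp (fun ω => toL2R (H ω)) 2 μ := by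
  refine memLp_two_iff_lintegral.2 ⟨aestronglyMeasurable_toL2R hH, ?_⟩
  rwa [lintegral_enorm_toL2R (ae_memLp_of_lintegral hH hfin)]

end Family

/-! ### Polar coordinates -/

theorem lintegral_polar (hd : 1 ≤ d) {f : Space d → ENNReal} (hf : Measurable f) :
    ∫⁻ x, f x = ∫⁻ ω : Sph d, (∫⁻ s in Set.Ioi (0 : ℝ),
      ENNReal.ofReal (s ^ (d - 1)) * f (s • (ω : Space d))) ∂(surface d) := by
  have : Nonempty (Fin d) := ⟨⟨0, hd⟩⟩
  have : Nontrivial (Space d) := inferInstance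
  have hmp := Measure.measurePreserving_homeomorphUnitSphereProd (volume : Measure (Space d))
  have hm : Measurable fun q : Sph d × Set.Ioi (0 : ℝ) => f ((q.2 : ℝ) • (q.1 : Space d)) :=
    hf.comp (by fun_prop)
  calc ∫⁻ x, f x = ∫⁻ x in ({0}ᶜ : Set (Space d)), f x := by
        rw [restrict_compl_singleton]
    _ = ∫⁻ x : ({0}ᶜ : Set (Space d)), f x ∂(volume.comap Subtype.val) :=
        (lintegral_subtype_comap (measurableSet_singleton _).compl _).symm
    _ = ∫⁻ x : ({0}ᶜ : Set (Space d)), (fun q : Sph d × Set.Ioi (0 : ℝ) =>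
          f ((q.2 : ℝ) • (q.1 : Space d))) (homeomorphUnitSphereProd _ x)
          ∂(volume.comap Subtype.val) := by
        refine lintegral_congr fun x => ?_
        congr 1
        have hx : ‖(x : Space d)‖ ≠ 0 := norm_ne_zero_iff.2 x.2
        simp [smul_smul, hx]
    _ = ∫⁻ q, f ((q.2 : ℝ) • (q.1 : Space d)) ∂((surface d).prod
          (Measure.volumeIoiPow (Module.finrank ℝ (Space d) - 1))) := hmp.lintegral_comp hm
    _ = _ := by
        rw [lintegral_prod _ hm.aemeasurable]
        refine lintegral_congr fun ω => ?_
        rw [Measure.volumeIoiPow, lintegral_withDensity_eq_lintegral_mul _ (by fun_prop)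
          (g := fun y : Set.Ioi (0 : ℝ) => f ((y : ℝ) • (ω : Space d))) (hf.comp (by fun_prop))]
        rw [← lintegral_subtype_comap measurableSet_Ioi]
        simp

theorem measurable_polar : Measurable fun q : Sph d × ℝ => q.2 • (q.1 : Space d) := by fun_prop

/-- The Jacobian `s^(d-1)` is positive on `s > 0`, so a null set of `ℝᵈ` pulls back to a null set
there. At `s ≤ 0` polar coordinates carry no information, hence the guard. -/
theorem ae_polar (hd : 1 ≤ d) {p : Space d → Prop} (hp : ∀ᵐ x, p x) :
    ∀ᵐ q ∂(surface d).prod (volume : Measure ℝ), 0 < q.2 → p (q.2 • (q.1 : Space d)) := by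
  obtain ⟨N, hN, hNm, hN0⟩ := exists_measurable_superset_of_null hp
  have h0 := lintegral_polar hd (measurable_const.indicator hNm (f := fun _ => (1 : ENNReal)))
  rw [lintegral_indicator_const hNm, hN0, mul_zero] at h0
  have hsub : {q : Sph d × ℝ | ¬ (0 < q.2 → p (q.2 • (q.1 : Space d)))} ⊆
      {q : Sph d × ℝ | 0 < q.2} ∩ (fun q : Sph d × ℝ => q.2 • (q.1 : Space d)) ⁻¹' N := by
    intro q hq
    simp only [Set.mem_ofPred_eq, Classical.not_imp] at hq
    exact ⟨hq.1, hN hq.2⟩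
  refine measure_mono_null hsub ?_
  have hmeas : MeasurableSet ({q : Sph d × ℝ | 0 < q.2} ∩
      (fun q : Sph d × ℝ => q.2 • (q.1 : Space d)) ⁻¹' N) :=
    (measurableSet_lt measurable_const measurable_snd).inter (measurable_polar hNm)
  rw [Measure.measure_prod_null hmeas]
  have hmm : Measurable fun q : Sph d × ℝ => ENNReal.ofReal (q.2 ^ (d - 1)) *
      N.indicator (fun _ => (1 : ENNReal)) (q.2 • (q.1 : Space d)) :=
    (by fun_prop : Measurable fun q : Sph d × ℝ => ENNReal.ofReal (q.2 ^ (d - 1))).mul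
      ((measurable_const.indicator hNm).comp measurable_polar)
  have h1 := (lintegral_eq_zero_iff hmm.lintegral_prod_right').1 h0.symm
  filter_upwards [h1] with ω hω
  have h2 := (lintegral_eq_zero_iff (hmm.comp measurable_prodMk_left)).1 hω
  rw [EventuallyEq, ae_restrict_iff' measurableSet_Ioi] at h2
  refine measure_mono_null ?_ h2
  intro s hs hs'
  have hs0 : 0 < s := hs.1
  have := hs' hs0
  simp only [Function.comp_apply, Pi.zero_apply, mul_eq_zero, ENNReal.ofReal_eq_zero] at this
  rcases this with h | h
  · exact absurd (pow_pos hs0 (d - 1)) (not_lt.2 h)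
  · simp [show s • (ω : Space d) ∈ N from hs.2] at h

/-- `L²(𝕊ᵈ⁻¹; L²(ℝ))`. -/
abbrev Cyl (d : ℕ) := Lp L2R 2 (surface d)

theorem enorm_sq_eq_lintegral {α E : Type*} [MeasurableSpace α] [NormedAddCommGroup E]
    {μ : Measure α} (f : Lp E 2 μ) : ‖f‖ₑ ^ 2 = ∫⁻ x, ‖f x‖ₑ ^ 2 ∂μ := by
  rw [Lp.enorm_def, eLpNorm_two_sq]

theorem integral_norm_sq_eq_toReal {α E : Type*} [MeasurableSpace α] [NormedAddCommGroup E]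
    {μ : Measure α} {f : α → E} (hf : AEStronglyMeasurable f μ) :
    ∫ x, ‖f x‖ ^ 2 ∂μ = (∫⁻ x, ‖f x‖ₑ ^ 2 ∂μ).toReal := by
  have h : AEStronglyMeasurable (fun x => ‖f x‖ ^ 2) μ := hf.norm.pow 2
  rw [integral_eq_lintegral_of_nonneg_ae (ae_of_all _ fun x => by positivity) h]
  congr 1
  refine lintegral_congr fun x => ?_
  rw [ENNReal.ofReal_pow (norm_nonneg _), ofReal_norm]

theorem norm_sq_eq_integral {α E : Type*} [MeasurableSpace α] [NormedAddCommGroup E]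
    {μ : Measure α} (f : Lp E 2 μ) : ‖f‖ ^ 2 = ∫ x, ‖f x‖ ^ 2 ∂μ := by
  rw [integral_norm_sq_eq_toReal (Lp.aestronglyMeasurable f), ← enorm_sq_eq_lintegral]
  simp

/-- `F` in polar coordinates, with the square root of the Jacobian as a weight, extended by `0` to
nonpositive radii. -/
def polarFun (F : Space d → ℂ) (ω : Sph d) (s : ℝ) : ℂ :=
  if 0 < s then ((s ^ (((d : ℝ) - 1) / 2) : ℝ) : ℂ) * F (s • (ω : Space d)) else 0

theorem polarFun_congr (hd : 1 ≤ d) {F G : Space d → ℂ} (h : F =ᵐ[volume] G) :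
    ∀ᵐ q ∂(surface d).prod (volume : Measure ℝ), polarFun F q.1 q.2 = polarFun G q.1 q.2 := by
  filter_upwards [ae_polar hd h] with q hq
  unfold polarFun
  split_ifs with h0
  · rw [hq h0]
  · rfl

theorem measurable_polarFun {F : Space d → ℂ} (hF : Measurable F) :
    Measurable (Function.uncurry (polarFun F)) := by
  unfold polarFun Function.uncurry
  refine Measurable.ite (measurableSet_lt measurable_const measurable_snd) ?_ measurable_const
  exact (Complex.measurable_ofReal.comp (measurable_snd.pow_const _)).mul
    (hF.comp measurable_polar)

theorem aestronglyMeasurable_polarFun (hd : 1 ≤ d) {F : Space d → ℂ}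
    (hF : AEStronglyMeasurable F volume) :
    AEStronglyMeasurable (Function.uncurry (polarFun F)) ((surface d).prod volume) := by
  refine ⟨_, (measurable_polarFun hF.stronglyMeasurable_mk.measurable).stronglyMeasurable, ?_⟩
  exact polarFun_congr hd hF.ae_eq_mk

theorem enorm_polarFun_sq (hd : 1 ≤ d) (F : Space d → ℂ) (ω : Sph d) (s : ℝ) :
    ‖polarFun F ω s‖ₑ ^ 2 = (Set.Ioi (0 : ℝ)).indicator
      (fun s => ENNReal.ofReal (s ^ (d - 1)) * ‖F (s • (ω : Space d))‖ₑ ^ 2) s := by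
  unfold polarFun
  split_ifs with h0
  · rw [Set.indicator_of_mem (Set.mem_Ioi.2 h0), enorm_mul, mul_pow]
    congr 1
    -- Squaring the real power `(d-1)/2` of the radius must give the natural power `d - 1`; the cast
    -- of the truncated subtraction is where `1 ≤ d` enters.
    rw [← ofReal_norm, ← ENNReal.ofReal_pow (norm_nonneg _), Complex.norm_real, Real.norm_eq_abs,
      sq_abs, ← Real.rpow_natCast, ← Real.rpow_mul h0.le]
    congr 1
    rw [← Real.rpow_natCast, Nat.cast_sub hd]
    congr 1
    push_cast
    ring
  · rw [Set.indicator_of_notMem (by simpa using h0)]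
    simp

theorem setLIntegral_polarFun (hd : 1 ≤ d) {F : Space d → ℂ} (hF : Measurable F) (ρ : ℝ) :
    ∫⁻ ω : Sph d, (∫⁻ s in Set.Ici ρ, ‖polarFun F ω s‖ₑ ^ 2) ∂(surface d) =
      ∫⁻ x in {x : Space d | ρ ≤ ‖x‖}, ‖F x‖ₑ ^ 2 := by
  have hm : MeasurableSet {x : Space d | ρ ≤ ‖x‖} := measurableSet_le measurable_const measurable_norm
  rw [← lintegral_indicator hm, lintegral_polar hd ((hF.enorm.pow_const 2).indicator hm)]
  refine lintegral_congr fun ω => ?_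
  rw [← lintegral_indicator measurableSet_Ici, ← lintegral_indicator measurableSet_Ioi]
  refine lintegral_congr fun s => ?_
  have hω : ‖(ω : Space d)‖ = 1 := by simp
  by_cases h0 : 0 < s
  · have hs : ‖s • (ω : Space d)‖ = s := by rw [norm_smul, hω, Real.norm_of_nonneg h0.le, mul_one]
    by_cases h1 : ρ ≤ s
    · have h2 : s • (ω : Space d) ∈ {x : Space d | ρ ≤ ‖x‖} := by simpa [hs] using h1
      simp [Set.indicator_of_mem h2, h0, h1, enorm_polarFun_sq hd]
    · have h2 : s • (ω : Space d) ∉ {x : Space d | ρ ≤ ‖x‖} := by simpa [hs] using h1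
      have h3 : s ∉ Set.Ici ρ := h1
      rw [Set.indicator_of_notMem h3, Set.indicator_of_mem (Set.mem_Ioi.2 h0),
        Set.indicator_of_notMem h2, mul_zero]
  · rw [Set.indicator_of_notMem (s := Set.Ioi 0) (by simpa using h0)]
    have h1 : polarFun F ω s = 0 := by simp [polarFun, h0]
    simp [Set.indicator, h1]

theorem setLIntegral_polarFun' (hd : 1 ≤ d) {F : Space d → ℂ} (hF : AEStronglyMeasurable F volume)
    (ρ : ℝ) :
    ∫⁻ ω : Sph d, (∫⁻ s in Set.Ici ρ, ‖polarFun F ω s‖ₑ ^ 2) ∂(surface d) =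
      ∫⁻ x in {x : Space d | ρ ≤ ‖x‖}, ‖F x‖ₑ ^ 2 := by
  calc _ = ∫⁻ ω : Sph d, (∫⁻ s in Set.Ici ρ, ‖polarFun (hF.mk F) ω s‖ₑ ^ 2) ∂(surface d) := by
        refine lintegral_congr_ae ?_
        filter_upwards [Measure.ae_ae_of_ae_prod (polarFun_congr hd hF.ae_eq_mk)] with ω hω
        refine lintegral_congr_ae (ae_restrict_of_ae ?_)
        filter_upwards [hω] with s hs
        rw [show polarFun F ω s = polarFun (hF.mk F) ω s from hs]
    _ = _ := setLIntegral_polarFun hd hF.stronglyMeasurable_mk.measurable ρ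
    _ = _ := by
        refine lintegral_congr_ae (ae_restrict_of_ae ?_)
        filter_upwards [hF.ae_eq_mk] with x hx
        rw [hx]

theorem lintegral_polarFun (hd : 1 ≤ d) {F : Space d → ℂ} (hF : AEStronglyMeasurable F volume) :
    ∫⁻ ω : Sph d, (∫⁻ s, ‖polarFun F ω s‖ₑ ^ 2) ∂(surface d) = ∫⁻ x, ‖F x‖ₑ ^ 2 := by
  have h := setLIntegral_polarFun' hd hF 0
  have h1 : {x : Space d | 0 ≤ ‖x‖} = Set.univ := by ext; simp
  rw [h1, setLIntegral_univ] at h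
  rw [← h]
  refine lintegral_congr fun ω => ?_
  rw [← lintegral_indicator measurableSet_Ici]
  refine lintegral_congr fun s => ?_
  by_cases h0 : 0 ≤ s
  · simp [h0]
  · have : ¬ 0 < s := fun h => h0 h.le
    simp [polarFun, this, h0]

theorem memLp_polarFun (hd : 1 ≤ d) {F : Space d → ℂ} (hF : MemLp F 2 volume) :
    MemLp (fun ω => toL2R (polarFun F ω)) 2 (surface d) := by
  refine memLp_toL2R (aestronglyMeasurable_polarFun hd hF.1) ?_
  rw [lintegral_polarFun hd hF.1]
  exact (memLp_two_iff_lintegral.1 hF).2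

theorem ae_memLp_polarFun (hd : 1 ≤ d) {F : Space d → ℂ} (hF : MemLp F 2 volume) :
    ∀ᵐ ω ∂(surface d), MemLp (polarFun F ω) 2 volume := by
  refine ae_memLp_of_lintegral (aestronglyMeasurable_polarFun hd hF.1) ?_
  rw [lintegral_polarFun hd hF.1]
  exact (memLp_two_iff_lintegral.1 hF).2

theorem toL2R_polarFun_congr (hd : 1 ≤ d) {F G : Space d → ℂ} (h : F =ᵐ[volume] G) :
    ∀ᵐ ω ∂(surface d), toL2R (polarFun F ω) = toL2R (polarFun G ω) := by
  filter_upwards [Measure.ae_ae_of_ae_prod (polarFun_congr hd h)] with ω hω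
  exact toL2R_congr hω

/-- Polar coordinates, as an isometry. -/
def polar (hd : 1 ≤ d) : L2 d →ₗᵢ[ℂ] Cyl d where
  toFun F := (memLp_polarFun hd (Lp.memLp F)).toLp _
  map_add' F G := by
    refine Lp.ext ?_
    filter_upwards [Lp.coeFn_add ((memLp_polarFun hd (Lp.memLp F)).toLp _)
      ((memLp_polarFun hd (Lp.memLp G)).toLp _), MemLp.coeFn_toLp (memLp_polarFun hd (Lp.memLp F)),
      MemLp.coeFn_toLp (memLp_polarFun hd (Lp.memLp G)),
      MemLp.coeFn_toLp (memLp_polarFun hd (Lp.memLp (F + G))),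
      toL2R_polarFun_congr hd (Lp.coeFn_add F G), ae_memLp_polarFun hd (Lp.memLp F),
      ae_memLp_polarFun hd (Lp.memLp G)] with ω h1 h2 h3 h4 h5 h6 h7
    rw [h1, h4, h5, Pi.add_apply, h2, h3, ← toL2R_add h6 h7]
    congr 1
    funext s
    unfold polarFun
    split_ifs
    · simp [mul_add]
    · simp
  map_smul' c F := by
    refine Lp.ext ?_
    filter_upwards [Lp.coeFn_smul c ((memLp_polarFun hd (Lp.memLp F)).toLp _),
      MemLp.coeFn_toLp (memLp_polarFun hd (Lp.memLp F)),
      MemLp.coeFn_toLp (memLp_polarFun hd (Lp.memLp (c • F))),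
      toL2R_polarFun_congr hd (Lp.coeFn_smul c F), ae_memLp_polarFun hd (Lp.memLp F)]
      with ω h1 h2 h3 h4 h5
    rw [RingHom.id_apply, h1, h3, h4, Pi.smul_apply, h2, ← toL2R_const_mul c h5]
    congr 1
    funext s
    unfold polarFun
    split_ifs
    · simp only [Pi.smul_apply, smul_eq_mul]; ring
    · simp
  norm_map' F := by
    have h : ‖(memLp_polarFun hd (Lp.memLp F)).toLp _‖ₑ ^ 2 = ‖F‖ₑ ^ 2 := by
      rw [Lp.enorm_toLp, eLpNorm_two_sq, lintegral_enorm_toL2R (ae_memLp_polarFun hd (Lp.memLp F)),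
        lintegral_polarFun hd (Lp.memLp F).1, enorm_sq_eq_lintegral]
    have h' := (ENNReal.pow_right_strictMono (n := 2) (by norm_num)).injective h
    simpa using congrArg ENNReal.toReal h'

theorem coeFn_polar (hd : 1 ≤ d) (F : L2 d) :
    ∀ᵐ ω ∂(surface d), polar hd F ω = toL2R (polarFun F ω) :=
  MemLp.coeFn_toLp (memLp_polarFun hd (Lp.memLp F))

/-! ### Translations, half-cylinders and the exterior norm. -/

/-- Translation of functions on the line: `h ↦ h(· + t)`. -/
def shift (t : ℝ) : L2R →ₗᵢ[ℂ] L2R :=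
  Lp.compMeasurePreservingₗᵢ ℂ (fun s => s + t) (measurePreserving_add_right volume t)

theorem shift_toL2R (t : ℝ) {h : ℝ → ℂ} (hh : MemLp h 2 volume) :
    shift t (toL2R h) = toL2R (fun s => h (s + t)) := by
  have hmp := measurePreserving_add_right (volume : Measure ℝ) t
  have hk : MemLp (fun s => h (s + t)) 2 volume := hh.comp_measurePreserving hmp
  rw [toL2R_of_memLp hh, toL2R_of_memLp hk]
  exact Lp.toLp_compMeasurePreserving hh hmp

/-- Restriction to `[R, ∞)`. -/
def halfLine (R : ℝ) : L2R →L[ℂ] Lp ℂ 2 (volume.restrict (Set.Ici R)) :=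
  LpToLpRestrictCLM ℝ ℂ ℂ volume 2 (Set.Ici R)

theorem enorm_halfLine_sq (R : ℝ) (h : L2R) :
    ‖halfLine R h‖ₑ ^ 2 = ∫⁻ s in Set.Ici R, ‖h s‖ₑ ^ 2 := by
  rw [enorm_sq_eq_lintegral]
  refine lintegral_congr_ae ?_
  filter_upwards [LpToLpRestrictCLM_coeFn ℂ (Set.Ici R) h] with s hs
  rw [halfLine, hs]

theorem sqNormHalfLine_eq (R : ℝ) (h : L2R) : sqNormHalfLine R h = ‖halfLine R h‖ ^ 2 := by
  rw [sqNormHalfLine, integral_norm_sq_eq_toReal (Lp.aestronglyMeasurable h).restrict,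
    ← enorm_halfLine_sq]
  simp

/-- A bounded operator on `L²(ℝ)` acting fiberwise. -/
abbrev fiber (L : L2R →L[ℂ] L2R) : Cyl d →L[ℂ] Cyl d := L.compLpL 2 (surface d)

/-- Restriction to `[R, ∞) × 𝕊ᵈ⁻¹`. -/
def halfCyl (d : ℕ) (R : ℝ) : Cyl d →L[ℂ] Lp (Lp ℂ 2 (volume.restrict (Set.Ici R))) 2 (surface d) :=
  (halfLine R).compLpL 2 (surface d)

/-- Fiberwise translation. -/
def shiftCyl (d : ℕ) (t : ℝ) : Cyl d →L[ℂ] Cyl d := fiber (shift t).toContinuousLinearMap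

theorem norm_fiber (L : L2R →ₗᵢ[ℂ] L2R) (Φ : Cyl d) :
    ‖fiber L.toContinuousLinearMap Φ‖ = ‖Φ‖ := by
  rw [Lp.norm_def, Lp.norm_def]
  congr 1
  refine eLpNorm_congr_norm_ae ?_
  filter_upwards [L.toContinuousLinearMap.coeFn_compLpL (p := 2) (μ := surface d) Φ] with ω hω
  rw [hω]
  exact L.norm_map _

theorem coeFn_halfCyl (R : ℝ) (Φ : Cyl d) :
    ∀ᵐ ω ∂(surface d), halfCyl d R Φ ω = halfLine R (Φ ω) :=
  (halfLine R).coeFn_compLpL (p := 2) (μ := surface d) Φ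

theorem coeFn_shiftCyl (t : ℝ) (Φ : Cyl d) :
    ∀ᵐ ω ∂(surface d), shiftCyl d t Φ ω = shift t (Φ ω) :=
  (shift t).toContinuousLinearMap.coeFn_compLpL (p := 2) (μ := surface d) Φ

theorem norm_halfCyl_sq (R : ℝ) (Φ : Cyl d) :
    ‖halfCyl d R Φ‖ ^ 2 = ∫ ω, sqNormHalfLine R (Φ ω) ∂(surface d) := by
  rw [norm_sq_eq_integral]
  refine integral_congr_ae ?_
  filter_upwards [coeFn_halfCyl R Φ] with ω hω
  rw [hω, sqNormHalfLine_eq]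

theorem coeFn_shiftCyl_polar (hd : 1 ≤ d) (t : ℝ) (F : L2 d) : ∀ᵐ ω ∂(surface d),
    shiftCyl d t (polar hd F) ω =
      toL2R (fun s => polarFun F ω (s + t)) := by
  filter_upwards [coeFn_shiftCyl t (polar hd F), coeFn_polar hd F, ae_memLp_polarFun hd (Lp.memLp F)] with ω h1 h2 h3
  rw [h1, h2]
  exact shift_toL2R t h3

/-- The substitution `r = s + t` makes the domain independent of time, so that the large time limit
becomes a norm limit in a fixed space. -/
theorem sqNormOutside_eq (hd : 1 ≤ d) (t R : ℝ) (F : L2 d) :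
    sqNormOutside (t + R) F =
      ‖halfCyl d R (shiftCyl d t (polar hd F))‖ ^ 2 := by
  set Φ := shiftCyl d t (polar hd F) with hΦ
  have h : ‖halfCyl d R Φ‖ₑ ^ 2 = ∫⁻ x in {x : Space d | t + R ≤ ‖x‖}, ‖F x‖ₑ ^ 2 := by
    rw [enorm_sq_eq_lintegral, ← setLIntegral_polarFun' hd (Lp.aestronglyMeasurable F)]
    refine lintegral_congr_ae ?_
    filter_upwards [coeFn_halfCyl R Φ,
      coeFn_shiftCyl_polar hd t F, ae_memLp_polarFun hd (Lp.memLp F)] with ω h1 h2 h3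
    have hk : MemLp (fun s => polarFun F ω (s + t)) 2 volume :=
      h3.comp_measurePreserving (measurePreserving_add_right (volume : Measure ℝ) t)
    rw [h1, enorm_halfLine_sq, hΦ, h2]
    have hpre : (fun s : ℝ => s + t) ⁻¹' Set.Ici (t + R) = Set.Ici R := by
      ext s; simp only [Set.mem_preimage, Set.mem_Ici]; constructor <;> intro h <;> linarith
    rw [← (measurePreserving_add_right (volume : Measure ℝ) t).setLIntegral_comp_preimage_emb
      (measurableEmbedding_addRight t) (fun s => ‖polarFun F ω s‖ₑ ^ 2) (Set.Ici (t + R)), hpre]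
    refine lintegral_congr_ae (ae_restrict_of_ae ?_)
    rw [toL2R_of_memLp hk]
    filter_upwards [hk.coeFn_toLp] with s hs
    rw [hs]
  rw [sqNormOutside, integral_norm_sq_eq_toReal (Lp.aestronglyMeasurable F).restrict, ← h]
  simp

/-! ### The subordination formula -/

section Glasser

variable {B : ℝ}

theorem injOn_sub_div (hB : 0 < B) : Set.InjOn (fun v : ℝ => v - B / v) (Set.Ioi 0) := by
  intro v hv w hw h
  have hv : 0 < v := hv
  have hw : 0 < w := hw
  have h : v - B / v = w - B / w := h
  field_simp at h
  have : (v - w) * (v * w + B) = 0 := by nlinarith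
  rcases mul_eq_zero.1 this with h | h
  · linarith
  · nlinarith [mul_pos hv hw]

theorem image_sub_div (hB : 0 < B) : (fun v : ℝ => v - B / v) '' Set.Ioi 0 = Set.univ := by
  refine Set.eq_univ_of_forall fun w => ?_
  set r := Real.sqrt (w ^ 2 + 4 * B) with hr
  have hr2 : r ^ 2 = w ^ 2 + 4 * B := Real.sq_sqrt (by positivity)
  have hr0 : 0 ≤ r := Real.sqrt_nonneg _
  have hpos : 0 < w + r := by
    have : |w| < r := by
      rw [hr]; exact Real.lt_sqrt_of_sq_lt (by rw [sq_abs]; linarith)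
    linarith [neg_abs_le w]
  -- The positive root of `v² - w v - B = 0`.
  refine ⟨(w + r) / 2, by simpa using hpos, ?_⟩
  simp only
  field_simp
  nlinarith

theorem hasDerivWithinAt_sub_div (v : ℝ) (hv : v ∈ Set.Ioi (0 : ℝ)) :
    HasDerivWithinAt (fun v : ℝ => v - B / v) (1 + B / v ^ 2) (Set.Ioi 0) v := by
  have hv0 : v ≠ 0 := ne_of_gt hv
  have h := (hasDerivAt_id v).sub ((hasDerivAt_const v B).div (hasDerivAt_id v) hv0)
  refine (h.congr_deriv ?_).hasDerivWithinAt
  simp [neg_div]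

theorem injOn_div (hB : 0 < B) : Set.InjOn (fun v : ℝ => B / v) (Set.Ioi 0) := by
  intro v hv w hw h
  have hv : 0 < v := hv
  have hw : 0 < w := hw
  have h : B / v = B / w := h
  field_simp at h
  exact h.symm

theorem image_div (hB : 0 < B) : (fun v : ℝ => B / v) '' Set.Ioi 0 = Set.Ioi 0 := by
  ext w
  constructor
  · rintro ⟨v, hv, rfl⟩
    exact div_pos hB hv
  · intro hw
    have hw : 0 < w := hw
    exact ⟨B / w, div_pos hB hw, by simp only; field_simp⟩

theorem hasDerivWithinAt_div (v : ℝ) (hv : v ∈ Set.Ioi (0 : ℝ)) :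
    HasDerivWithinAt (fun v : ℝ => B / v) (-(B / v ^ 2)) (Set.Ioi 0) v := by
  have hv0 : v ≠ 0 := ne_of_gt hv
  have h := (hasDerivAt_const v B).div (hasDerivAt_id v) hv0
  refine (h.congr_deriv ?_).hasDerivWithinAt
  simp [neg_div]

/-- The Cauchy–Schlömilch substitution `w = v - B/v` maps `(0, ∞)` bijectively onto `ℝ`, with
Jacobian `1 + B/v²`, so the integral with that weight is `√π`. The inversion `v ↦ B/v` shows that
the two terms of the weight contribute equally. -/
theorem integral_exp_neg_sq_sub_div (hB : 0 < B) :
    ∫ v in Set.Ioi (0 : ℝ), Real.exp (-(v - B / v) ^ 2) = Real.sqrt Real.pi / 2 := by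
  have hg : Integrable (fun w : ℝ => Real.exp (-w ^ 2)) := by
    simpa using integrable_exp_neg_mul_sq (b := 1) one_pos
  have hgi : ∫ w : ℝ, Real.exp (-w ^ 2) = Real.sqrt Real.pi := by
    simpa using integral_gaussian 1
  have habs : ∀ v : ℝ, |1 + B / v ^ 2| = 1 + B / v ^ 2 := fun v => abs_of_nonneg (by positivity)
  have habs' : ∀ v : ℝ, |-(B / v ^ 2)| = B / v ^ 2 := fun v => by
    rw [abs_neg]; exact abs_of_nonneg (by positivity)
  have h1 := integral_image_eq_integral_abs_deriv_smul measurableSet_Ioi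
    (hasDerivWithinAt_sub_div (B := B)) (injOn_sub_div hB) (fun w => Real.exp (-w ^ 2))
  have h1i := (integrableOn_image_iff_integrableOn_abs_deriv_smul measurableSet_Ioi
    (hasDerivWithinAt_sub_div (B := B)) (injOn_sub_div hB) (fun w => Real.exp (-w ^ 2))).1
    (by rw [image_sub_div hB]; exact hg.integrableOn)
  rw [image_sub_div hB, setIntegral_univ, hgi] at h1
  simp only [habs, smul_eq_mul] at h1 h1i
  have hE : IntegrableOn (fun v : ℝ => Real.exp (-(v - B / v) ^ 2)) (Set.Ioi 0) := by
    refine Integrable.mono' h1i (by fun_prop) (ae_of_all _ fun v => ?_)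
    rw [Real.norm_of_nonneg (Real.exp_pos _).le]
    have : 0 ≤ B / v ^ 2 := by positivity
    nlinarith [Real.exp_pos (-(v - B / v) ^ 2)]
  have hE2 : IntegrableOn (fun v : ℝ => B / v ^ 2 * Real.exp (-(v - B / v) ^ 2)) (Set.Ioi 0) := by
    have := h1i.sub hE
    refine this.congr (ae_of_all _ fun v => ?_)
    simp only [Pi.sub_apply]
    ring
  have h2 := integral_image_eq_integral_abs_deriv_smul measurableSet_Ioi
    (hasDerivWithinAt_div (B := B)) (injOn_div hB) (fun w => Real.exp (-(w - B / w) ^ 2))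
  rw [image_div hB] at h2
  have h3 : ∫ v in Set.Ioi (0 : ℝ), |-(B / v ^ 2)| • Real.exp (-(B / v - B / (B / v)) ^ 2) =
      ∫ v in Set.Ioi (0 : ℝ), B / v ^ 2 * Real.exp (-(v - B / v) ^ 2) := by
    refine setIntegral_congr_fun measurableSet_Ioi fun v hv => ?_
    have hv0 : v ≠ 0 := ne_of_gt hv
    have : B / (B / v) = v := by field_simp
    simp only [habs', smul_eq_mul, this]
    congr 3
    ring
  rw [h3] at h2
  have h4 : ∫ v in Set.Ioi (0 : ℝ), (1 + B / v ^ 2) * Real.exp (-(v - B / v) ^ 2) =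
      (∫ v in Set.Ioi (0 : ℝ), Real.exp (-(v - B / v) ^ 2)) +
        ∫ v in Set.Ioi (0 : ℝ), B / v ^ 2 * Real.exp (-(v - B / v) ^ 2) := by
    rw [← integral_add hE hE2]
    congr 1
    funext v
    ring
  linarith

/-- Completing the square: `v² + B²/v² = (v - B/v)² + 2B`. This writes `e^{-2B}` as a superposition
of Gaussians in `B`, the case `B = 0` being a plain Gaussian integral. -/
theorem integral_exp_neg_sq_add_sq_div (hB : 0 ≤ B) :
    ∫ v in Set.Ioi (0 : ℝ), Real.exp (-(v ^ 2 + B ^ 2 / v ^ 2)) =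
      Real.sqrt Real.pi / 2 * Real.exp (-(2 * B)) := by
  rcases hB.eq_or_lt with rfl | hB
  · simpa using integral_gaussian_Ioi 1
  · rw [← integral_exp_neg_sq_sub_div hB, ← integral_mul_const]
    refine setIntegral_congr_fun measurableSet_Ioi fun v hv => ?_
    have hv0 : v ≠ 0 := ne_of_gt hv
    rw [← Real.exp_add]
    congr 1
    field_simp
    ring

end Glasser

/-! ### The Poisson kernel -/

/-- `∫ exp (2πi y·ξ - 2πz|ξ|) dξ`. -/
def poisson (z : ℂ) (y : Space d) : ℂ :=
  ∫ ξ : Space d, Complex.exp (2 * Real.pi * Complex.I * (inner ℝ y ξ : ℝ) - 2 * Real.pi * z * ‖ξ‖)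

theorem integrable_exp_neg_norm (hd : 1 ≤ d) {a : ℝ} (ha : 0 < a) (n : ℕ) :
    Integrable fun ξ : Space d => ‖ξ‖ ^ n * Real.exp (-a * ‖ξ‖) := by
  have : Nonempty (Fin d) := ⟨⟨0, hd⟩⟩
  have : Nontrivial (Space d) := inferInstance
  have h := (integrable_fun_norm_addHaar (volume : Measure (Space d))
    (f := fun r => r ^ n * Real.exp (-a * r)))
  refine h.2 ?_
  have h1 := integrableOn_rpow_mul_exp_neg_mul_rpow (p := 1) (s := ((d - 1 + n : ℕ) : ℝ)) (b := a)
    (by linarith [Nat.cast_nonneg (α := ℝ) (d - 1 + n)]) one_pos ha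
  refine h1.congr_fun (fun r hr => ?_) measurableSet_Ioi
  have hr : 0 < r := hr
  simp only [Real.rpow_natCast, Real.rpow_one, finrank_euclideanSpace, Fintype.card_fin,
    smul_eq_mul, pow_add, mul_assoc]

/-- The positive reals accumulate at `1`, so the identity theorem extends formulas from the positive
axis to the half-plane `Re z > 0`. -/
theorem frequently_one_nhdsNE_of_real {p : ℂ → Prop} (h : ∀ x : ℝ, 0 < x → p x) :
    ∃ᶠ z in 𝓝[≠] (1 : ℂ), p z := by
  have ht : Tendsto (fun x : ℝ => (x : ℂ)) (𝓝[>] 1) (𝓝[≠] 1) := by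
    refine tendsto_nhdsWithin_iff.2 ⟨?_, ?_⟩
    · exact (Complex.continuous_ofReal.tendsto' 1 1 (by simp)).mono_left nhdsWithin_le_nhds
    · filter_upwards [self_mem_nhdsWithin] with x hx
      have hx : (1 : ℝ) < x := hx
      simpa using hx.ne'
  refine ht.frequently (Eventually.frequently ?_)
  filter_upwards [self_mem_nhdsWithin] with x hx
  exact h x (lt_trans one_pos hx)

/-- Differentiation under the integral sign. On the neighbourhood `Re z > Re z₀ / 2` of `z₀` the
derivative is dominated by `|f| g e^{-(Re z₀/2) g}`. -/
theorem differentiableOn_integral_mul_exp_neg {α : Type*} [MeasurableSpace α] {μ : Measure α}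
    {f : α → ℂ} {g : α → ℝ} (hf : AEStronglyMeasurable f μ) (hg : AEStronglyMeasurable g μ)
    (hg0 : ∀ᵐ x ∂μ, 0 ≤ g x)
    (h0 : ∀ a : ℝ, 0 < a → Integrable (fun x => ‖f x‖ * Real.exp (-a * g x)) μ)
    (h1 : ∀ a : ℝ, 0 < a → Integrable (fun x => ‖f x‖ * (g x * Real.exp (-a * g x))) μ) :
    DifferentiableOn ℂ (fun z : ℂ => ∫ x, f x * Complex.exp (-z * g x) ∂μ) {z | 0 < z.re} := by
  intro z₀ hz₀
  have hz₀ : 0 < z₀.re := hz₀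
  refine DifferentiableAt.differentiableWithinAt ?_
  have hgc : AEStronglyMeasurable (fun x => (g x : ℂ)) μ :=
    Complex.continuous_ofReal.comp_aestronglyMeasurable hg
  have hm : ∀ z : ℂ, AEStronglyMeasurable (fun x => f x * Complex.exp (-z * g x)) μ := fun z =>
    hf.mul (Complex.continuous_exp.comp_aestronglyMeasurable (hgc.const_mul _))
  have hs : {z : ℂ | z₀.re / 2 < z.re} ∈ 𝓝 z₀ :=
    (isOpen_lt continuous_const Complex.continuous_re).mem_nhds
      (show z₀.re / 2 < z₀.re by linarith)
  refine (hasDerivAt_integral_of_dominated_loc_of_deriv_le (𝕜 := ℂ) (μ := μ)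
    (F := fun z x => f x * Complex.exp (-z * g x))
    (F' := fun z x => f x * Complex.exp (-z * g x) * (-(g x)))
    (bound := fun x => ‖f x‖ * (g x * Real.exp (-(z₀.re / 2) * g x))) hs
    (Eventually.of_forall hm) ?_ ((hm z₀).mul hgc.neg) ?_ (h1 _ (by positivity))
    (ae_of_all _ fun x z hz => ?_)).2.differentiableAt
  · refine (h0 _ hz₀).mono' (hm z₀) (ae_of_all _ fun x => ?_)
    simp [Complex.norm_exp]
  · filter_upwards [hg0] with x hx z hz
    have hz : z₀.re / 2 < z.re := hz
    have he : ‖Complex.exp (-z * g x)‖ ≤ Real.exp (-(z₀.re / 2) * g x) := by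
      rw [Complex.norm_exp]
      apply Real.exp_le_exp.2
      simp only [Complex.mul_re, Complex.neg_re, Complex.ofReal_re, Complex.ofReal_im, mul_zero,
        sub_zero]
      nlinarith [mul_le_mul_of_nonneg_right hz.le hx]
    rw [norm_mul, norm_mul, norm_neg, Complex.norm_real, Real.norm_of_nonneg hx, mul_assoc,
      mul_comm (g x)]
    gcongr
  · have h := (((hasDerivAt_id z).neg.mul_const (g x : ℂ)).cexp).const_mul (f x)
    refine h.congr_deriv ?_
    simp; ring

theorem differentiableOn_poisson (hd : 1 ≤ d) (y : Space d) :
    DifferentiableOn ℂ (fun z => poisson z y) {z | 0 < z.re} := by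
  have h := differentiableOn_integral_mul_exp_neg (μ := (volume : Measure (Space d)))
    (f := fun ξ => Complex.exp (2 * Real.pi * Complex.I * (inner ℝ y ξ : ℝ)))
    (g := fun ξ => 2 * Real.pi * ‖ξ‖) (by fun_prop) (by fun_prop)
    (ae_of_all _ fun ξ => by positivity) (fun a ha => ?_) (fun a ha => ?_)
  · refine h.congr fun z hz => ?_
    unfold poisson
    congr 1
    funext ξ
    rw [← Complex.exp_add]
    congr 1
    push_cast
    ring
  · refine (integrable_exp_neg_norm hd (a := a * (2 * Real.pi)) (by positivity) 0).congr
      (ae_of_all _ fun ξ => ?_)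
    simp [Complex.norm_exp, mul_assoc]
  · refine ((integrable_exp_neg_norm hd (a := a * (2 * Real.pi)) (by positivity) 1).const_mul
      (2 * Real.pi)).congr (ae_of_all _ fun ξ => ?_)
    simp [Complex.norm_exp, mul_assoc]

/-- Both sides are holomorphic in `r` on the right half-plane and agree for real `r` by Euler's
Gamma integral. -/
theorem integral_rpow_mul_cexp_neg_mul_Ioi {a : ℝ} (ha : 0 < a) {r : ℂ} (hr : 0 < r.re) :
    ∫ k in Set.Ioi (0 : ℝ), ((k ^ (a - 1) : ℝ) : ℂ) * Complex.exp (-r * k) =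
      Real.Gamma a * r ^ (-a : ℂ) := by
  have hint : ∀ (s b : ℝ), -1 < s → 0 < b → IntegrableOn
      (fun k : ℝ => k ^ s * Real.exp (-b * k)) (Set.Ioi 0) := fun s b hs hb => by
    simpa using integrableOn_rpow_mul_exp_neg_mul_rpow (p := 1) hs one_pos hb
  have h1 := differentiableOn_integral_mul_exp_neg (μ := volume.restrict (Set.Ioi (0 : ℝ)))
    (f := fun k => ((k ^ (a - 1) : ℝ) : ℂ)) (g := fun k => k)
    ((Complex.measurable_ofReal.comp (measurable_id.pow_const _)).aestronglyMeasurable)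
    (by fun_prop) ((ae_restrict_mem measurableSet_Ioi).mono fun k hk => le_of_lt hk)
    (fun b hb => ?_) (fun b hb => ?_)
  · have h2 : DifferentiableOn ℂ (fun r : ℂ => Real.Gamma a * r ^ (-a : ℂ)) {z | 0 < z.re} := by
      intro z hz
      refine DifferentiableAt.differentiableWithinAt ?_
      exact (differentiableAt_id.cpow_const (Or.inl hz)).const_mul _
    have hopen : IsOpen {z : ℂ | 0 < z.re} := isOpen_lt continuous_const Complex.continuous_re
    refine (h1.analyticOnNhd hopen).eqOn_of_preconnected_of_frequently_eq (h2.analyticOnNhd hopen)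
      (convex_halfSpace_re_gt 0).isPreconnected (z₀ := 1) (by simp) ?_ hr
    refine frequently_one_nhdsNE_of_real fun x hx => ?_
    have h3 := Real.integral_rpow_mul_exp_neg_mul_Ioi ha hx
    have h4 : ∫ k in Set.Ioi (0 : ℝ), ((k ^ (a - 1) : ℝ) : ℂ) * Complex.exp (-(x : ℂ) * k) =
        ((∫ k in Set.Ioi (0 : ℝ), k ^ (a - 1) * Real.exp (-(x * k)) : ℝ) : ℂ) := by
      rw [← integral_complex_ofReal]
      congr 1
      funext k
      push_cast
      ring_nf
    rw [h4, h3, one_div, Real.inv_rpow hx.le, ← Real.rpow_neg hx.le, mul_comm]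
    push_cast
    rw [Complex.ofReal_cpow hx.le]
    push_cast
    rfl
  · refine (hint (a - 1) b (by linarith) hb).congr_fun (fun k hk => ?_) measurableSet_Ioi
    have hk : 0 < k := hk
    simp [abs_of_nonneg (Real.rpow_nonneg hk.le _)]
  · refine (hint a b (by linarith) hb).congr_fun (fun k hk => ?_) measurableSet_Ioi
    have hk : 0 < k := hk
    have : k ^ a = k ^ (a - 1) * k := by
      conv_lhs => rw [show a = (a - 1) + 1 by ring, Real.rpow_add hk, Real.rpow_one]
    simp [abs_of_nonneg (Real.rpow_nonneg hk.le _), this, mul_assoc]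

/-- Subordination: `e^{-2πz|ξ|}` is written as an integral over `v` of Gaussians in `ξ`. After
exchanging the integrals, the Gaussian Fourier transform leaves a Gamma-type integral in `v`. -/
theorem poisson_of_pos {z : ℝ} (hz : 0 < z) (y : Space d) :
    poisson z y = (Real.Gamma (((d : ℝ) + 1) / 2) / Real.pi ^ (((d : ℝ) + 1) / 2) *
      (z * (z ^ 2 + ‖y‖ ^ 2) ^ (-(((d : ℝ) + 1) / 2))) : ℝ) := by
  have hpi := Real.pi_pos
  set K : Space d → ℝ → ℂ := fun ξ v => Complex.exp (2 * Real.pi * Complex.I * (inner ℝ y ξ : ℝ)) *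
    (Real.exp (-(v ^ 2 + (Real.pi * z * ‖ξ‖) ^ 2 / v ^ 2)) : ℝ) with hK
  -- The Gaussian Fourier transform contributes `e^{-|y|²v²/z²}`, which combines with `e^{-v²}` into
  -- `e^{-c v²}`.
  set c : ℝ := 1 + ‖y‖ ^ 2 / z ^ 2 with hc
  have hc0 : 0 < c := by positivity
  have hKm : AEStronglyMeasurable (Function.uncurry K)
      ((volume : Measure (Space d)).prod (volume.restrict (Set.Ioi (0 : ℝ)))) := by
    refine Measurable.aestronglyMeasurable ?_
    rw [hK]
    unfold Function.uncurry
    fun_prop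
  have hform : ∀ v ∈ Set.Ioi (0 : ℝ), ∀ ξ, K ξ v = (Real.exp (-v ^ 2) : ℝ) *
      Complex.exp (-((Real.pi ^ 2 * z ^ 2 / v ^ 2 : ℝ) : ℂ) * (‖ξ‖ : ℂ) ^ 2 +
        (2 * Real.pi * Complex.I) * (inner ℝ y ξ : ℝ)) := by
    intro v hv ξ
    have hv0 : (v : ℂ) ≠ 0 := by exact_mod_cast ne_of_gt (show 0 < v from hv)
    simp only [hK]
    push_cast
    rw [← Complex.exp_add, ← Complex.exp_add]
    congr 1
    field_simp
    ring
  have hb : ∀ v ∈ Set.Ioi (0 : ℝ), 0 < Real.pi ^ 2 * z ^ 2 / v ^ 2 := fun v hv => by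
    have : 0 < v := hv
    positivity
  have hKint : ∀ v ∈ Set.Ioi (0 : ℝ), Integrable (fun ξ => K ξ v) := by
    intro v hv
    refine Integrable.congr ((GaussianFourier.integrable_cexp_neg_mul_sq_norm_add
      (b := ((Real.pi ^ 2 * z ^ 2 / v ^ 2 : ℝ) : ℂ)) (by rw [Complex.ofReal_re]; exact hb v hv)
      (2 * Real.pi * Complex.I) y).const_mul ((Real.exp (-v ^ 2) : ℝ) : ℂ))
      (ae_of_all _ fun ξ => (hform v hv ξ).symm)
  -- A multiple of `v^d e^{-v²}`, integrable on `(0, ∞)`: this is the absolute integrability behind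
  -- the exchange of integrals.
  have hKnorm : ∀ v ∈ Set.Ioi (0 : ℝ), ∫ ξ, ‖K ξ v‖ =
      (Real.pi * z ^ 2) ^ (-(d : ℝ) / 2) * (v ^ (d : ℝ) * Real.exp (-1 * v ^ (2 : ℝ))) := by
    intro v hv
    have hv0 : 0 < v := hv
    have : ∀ ξ, ‖K ξ v‖ = Real.exp (-v ^ 2) *
        Real.exp (-(Real.pi ^ 2 * z ^ 2 / v ^ 2) * ‖ξ‖ ^ 2) := by
      intro ξ
      simp only [hK, norm_mul, Complex.norm_exp, Complex.norm_real, Real.norm_of_nonneg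
        (Real.exp_pos _).le]
      simp only [Complex.mul_re, Complex.re_ofNat, Complex.ofReal_re, Complex.im_ofNat,
        Complex.ofReal_im, mul_zero, sub_zero, Complex.I_re, Complex.mul_im, zero_mul, add_zero,
        Complex.I_im, mul_one, sub_self, Real.exp_zero, one_mul]
      rw [← Real.exp_add]
      congr 1
      field_simp
      ring
    simp only [this]
    rw [integral_const_mul, GaussianFourier.integral_rexp_neg_mul_sq_norm (hb v hv)]
    have h2 : Real.pi / (Real.pi ^ 2 * z ^ 2 / v ^ 2) = (Real.pi * z ^ 2)⁻¹ * v ^ 2 := by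
      field_simp
    rw [h2, Real.mul_rpow (by positivity) (by positivity), Real.inv_rpow (by positivity),
      ← Real.rpow_neg (by positivity), ← Real.rpow_natCast v 2, ← Real.rpow_mul hv0.le]
    simp only [finrank_euclideanSpace, Fintype.card_fin, Nat.cast_ofNat]
    rw [show (2 : ℝ) * (d / 2) = d by ring, neg_div]
    simp only [Real.rpow_two]
    ring_nf
  have hKval : ∀ v ∈ Set.Ioi (0 : ℝ), ∫ ξ, K ξ v =
      (((Real.pi * z ^ 2) ^ (-(d : ℝ) / 2) * (v ^ (d : ℝ) * Real.exp (-c * v ^ (2 : ℝ))) : ℝ) : ℂ) := by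
    intro v hv
    have hv0 : 0 < v := hv
    rw [integral_congr_ae (ae_of_all _ (hform v hv)), integral_const_mul,
      GaussianFourier.integral_cexp_neg_mul_sq_norm_add (by rw [Complex.ofReal_re]; exact hb v hv)]
    have h2 : (Real.pi : ℂ) / ((Real.pi ^ 2 * z ^ 2 / v ^ 2 : ℝ) : ℂ) =
        (((Real.pi * z ^ 2)⁻¹ * v ^ 2 : ℝ) : ℂ) := by
      rw [← Complex.ofReal_div]
      congr 1
      field_simp
    have h3 : (2 * Real.pi * Complex.I) ^ 2 * (‖y‖ : ℂ) ^ 2 /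
        (4 * ((Real.pi ^ 2 * z ^ 2 / v ^ 2 : ℝ) : ℂ)) = ((-(‖y‖ ^ 2 / z ^ 2) * v ^ 2 : ℝ) : ℂ) := by
      push_cast
      have : (z : ℂ) ≠ 0 := by exact_mod_cast hz.ne'
      have : (v : ℂ) ≠ 0 := by exact_mod_cast hv0.ne'
      have : (Real.pi : ℂ) ≠ 0 := by exact_mod_cast hpi.ne'
      field_simp
      rw [Complex.I_sq]
      ring
    rw [h2, h3]
    have h4 : ((Module.finrank ℝ (Space d) : ℂ) / 2) = (((d : ℝ) / 2 : ℝ) : ℂ) := by simp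
    rw [h4, ← Complex.ofReal_cpow (by positivity), ← Complex.ofReal_exp, ← Complex.ofReal_mul,
      ← Complex.ofReal_mul]
    congr 1
    rw [Real.mul_rpow (by positivity) (by positivity), Real.inv_rpow (by positivity),
      ← Real.rpow_neg (by positivity), ← Real.rpow_natCast v 2, ← Real.rpow_mul hv0.le]
    simp only [Nat.cast_ofNat]
    rw [show (2 : ℝ) * (d / 2) = d by ring, neg_div, hc]
    have h5 : Real.exp (-(1 + ‖y‖ ^ 2 / z ^ 2) * v ^ (2 : ℝ)) =
        Real.exp (-v ^ (2 : ℝ)) * Real.exp (-(‖y‖ ^ 2 / z ^ 2) * v ^ (2 : ℝ)) := by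
      rw [← Real.exp_add]; ring_nf
    rw [h5]
    ring
  have hd0 : (-1 : ℝ) < d := by linarith [Nat.cast_nonneg (α := ℝ) d]
  have hprod : Integrable (Function.uncurry K)
      ((volume : Measure (Space d)).prod (volume.restrict (Set.Ioi (0 : ℝ)))) := by
    rw [integrable_prod_iff' hKm]
    refine ⟨(ae_restrict_iff' measurableSet_Ioi).2 (ae_of_all _ hKint), ?_⟩
    refine IntegrableOn.congr_fun ?_ (fun v hv => (hKnorm v hv).symm) measurableSet_Ioi
    exact (integrableOn_rpow_mul_exp_neg_mul_rpow hd0 two_pos one_pos).const_mul _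
  have hswap := integral_integral_swap hprod
  rw [setIntegral_congr_fun measurableSet_Ioi hKval, integral_complex_ofReal,
    integral_const_mul, integral_rpow_mul_exp_neg_mul_rpow two_pos hd0 hc0] at hswap
  have hleft : ∫ ξ, (∫ v in Set.Ioi (0 : ℝ), K ξ v) =
      ((Real.sqrt Real.pi / 2 : ℝ) : ℂ) * poisson z y := by
    unfold poisson
    rw [← integral_const_mul]
    congr 1
    funext ξ
    simp only [hK]
    rw [integral_const_mul, integral_complex_ofReal,
      integral_exp_neg_sq_add_sq_div (by positivity), sub_eq_add_neg, Complex.exp_add]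
    push_cast
    ring_nf
  rw [hleft] at hswap
  have hsq : (Real.sqrt Real.pi / 2 : ℝ) ≠ 0 := by positivity
  have hsq' : ((Real.sqrt Real.pi / 2 : ℝ) : ℂ) ≠ 0 := by exact_mod_cast hsq
  apply mul_left_cancel₀ hsq'
  rw [hswap, ← Complex.ofReal_mul]
  congr 1
  have h1 : c = (z ^ 2)⁻¹ * (z ^ 2 + ‖y‖ ^ 2) := by rw [hc]; field_simp
  have h2 : -((d : ℝ) + 1) / 2 = -(((d : ℝ) + 1) / 2) := by ring
  have hz2 : ∀ e : ℝ, (z ^ 2) ^ e = z ^ (2 * e) := fun e => by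
    rw [← Real.rpow_natCast, ← Real.rpow_mul hz.le]; simp
  rw [h1, h2, Real.mul_rpow hpi.le (by positivity),
    Real.mul_rpow (by positivity) (by positivity), Real.inv_rpow (by positivity), hz2, hz2, ← Real.rpow_neg hz.le, Real.sqrt_eq_rpow]
  have h3 : z ^ (2 * (-(d : ℝ) / 2)) * z ^ (-(2 * -(((d : ℝ) + 1) / 2))) = z := by
    rw [← Real.rpow_add hz]
    ring_nf
    exact Real.rpow_one z
  have h4 : Real.pi ^ (-(d : ℝ) / 2) = Real.pi ^ (1 / 2 : ℝ) / Real.pi ^ (((d : ℝ) + 1) / 2) := by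
    rw [← Real.rpow_sub hpi]
    ring_nf
  rw [h4]
  calc _ = Real.pi ^ (1 / 2 : ℝ) / Real.pi ^ (((d : ℝ) + 1) / 2) *
        (z ^ (2 * (-(d : ℝ) / 2)) * z ^ (-(2 * -(((d : ℝ) + 1) / 2)))) *
        (z ^ 2 + ‖y‖ ^ 2) ^ (-(((d : ℝ) + 1) / 2)) * (1 / 2) * Real.Gamma (((d : ℝ) + 1) / 2) := by
        ring
    _ = _ := by rw [h3]; ring

/-- Analytic continuation from the positive axis. The principal power is holomorphic because `z² +
|y|²` avoids the negative axis when `Re z > 0`: its imaginary part `2 Re z Im z` vanishes only for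
real `z`, and then its value is positive. -/
theorem poisson_eq (hd : 1 ≤ d) {z : ℂ} (hz : 0 < z.re) (y : Space d) :
    poisson z y = (Real.Gamma (((d : ℝ) + 1) / 2) / Real.pi ^ (((d : ℝ) + 1) / 2) : ℝ) *
      (z * (z ^ 2 + (‖y‖ : ℂ) ^ 2) ^ (-(((d : ℝ) + 1) / 2 : ℝ) : ℂ)) := by
  have hopen : IsOpen {z : ℂ | 0 < z.re} := isOpen_lt continuous_const Complex.continuous_re
  have hslit : ∀ z : ℂ, 0 < z.re → z ^ 2 + (‖y‖ : ℂ) ^ 2 ∈ Complex.slitPlane := by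
    intro z hz
    by_contra h
    rw [Complex.mem_slitPlane_iff] at h
    push Not at h
    have h2 := h.2
    have h1 := h.1
    simp only [sq, Complex.add_im, Complex.mul_im, Complex.ofReal_re, Complex.ofReal_im, mul_zero,
      zero_mul, add_zero, Complex.add_re, Complex.mul_re, sub_zero] at h1 h2
    have h3 : z.im = 0 := by
      have : z.re * z.im = 0 := by linarith
      exact (mul_eq_zero.1 this).resolve_left hz.ne'
    rw [h3] at h1
    nlinarith [mul_self_nonneg ‖y‖, mul_pos hz hz]
  have h2 : DifferentiableOn ℂ (fun z : ℂ =>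
      ((Real.Gamma (((d : ℝ) + 1) / 2) / Real.pi ^ (((d : ℝ) + 1) / 2) : ℝ) : ℂ) *
      (z * (z ^ 2 + (‖y‖ : ℂ) ^ 2) ^ (-(((d : ℝ) + 1) / 2 : ℝ) : ℂ))) {z | 0 < z.re} := by
    intro z hz
    refine DifferentiableAt.differentiableWithinAt ?_
    have hq : DifferentiableAt ℂ (fun z : ℂ => z ^ 2 + (‖y‖ : ℂ) ^ 2) z := by fun_prop
    exact (differentiableAt_id.mul (hq.cpow_const (hslit z hz))).const_mul _
  refine ((differentiableOn_poisson hd y).analyticOnNhd hopen).eqOn_of_preconnected_of_frequently_eq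
    (h2.analyticOnNhd hopen) (convex_halfSpace_re_gt 0).isPreconnected (z₀ := 1) (by simp) ?_ hz
  refine frequently_one_nhdsNE_of_real fun x hx => ?_
  rw [poisson_of_pos hx, Complex.ofReal_mul, Complex.ofReal_mul x,
    Complex.ofReal_cpow (by positivity)]
  push_cast
  rfl

/-! ### The Fourier transform on `L¹ ∩ L²` -/

section FourierL2

variable {V : Type*} [NormedAddCommGroup V] [InnerProductSpace ℝ V] [FiniteDimensional ℝ V]
  [MeasurableSpace V] [BorelSpace V]

/-- The fundamental lemma of the calculus of variations: smooth bumps supported in `U` are Schwartz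
functions. -/
theorem ae_eq_of_forall_schwartz {U : Set V} (hU : IsOpen U) {f g : V → ℂ}
    (hf : LocallyIntegrableOn f U volume) (hg : LocallyIntegrableOn g U volume)
    (h : ∀ φ : 𝓢(V, ℂ), HasCompactSupport φ → tsupport φ ⊆ U →
      ∫ x, f x * φ x = ∫ x, g x * φ x) : ∀ᵐ x, x ∈ U → f x = g x := by
  have key := hU.ae_eq_zero_of_integral_contDiff_smul_eq_zero (f := fun x => f x - g x)
    (hf.sub hg) (fun η hη hηc hηU => ?_)
  · filter_upwards [key] with x hx hxU
    exact sub_eq_zero.1 (hx hxU)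
  · have hc : HasCompactSupport (Complex.ofRealCLM ∘ η) := hηc.comp_left rfl
    have hs : ContDiff ℝ (⊤ : ℕ∞) (Complex.ofRealCLM ∘ η) := Complex.ofRealCLM.contDiff.comp hη
    have hts : tsupport (Complex.ofRealCLM ∘ η) ⊆ tsupport η := tsupport_comp_subset rfl η
    have h1 := h (hc.toSchwartzMap hs) hc (hts.trans hηU)
    have hηc' : Continuous fun x => (η x : ℂ) := Complex.continuous_ofReal.comp hη.continuous
    have hint : ∀ F : V → ℂ, LocallyIntegrableOn F U volume →
        Integrable (fun x => F x * (η x : ℂ)) := by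
      intro F hF
      have hK : IntegrableOn F (tsupport η) volume :=
        hF.integrableOn_compact_subset hηU hηc
      have h2 : IntegrableOn (fun x => F x * (η x : ℂ)) (tsupport η) volume :=
        hK.mul_continuousOn hηc'.continuousOn hηc
      refine (integrableOn_iff_integrable_of_support_subset fun x hx => ?_).1 h2
      refine subset_tsupport _ fun h0 => hx ?_
      simp only [h0, Complex.ofReal_zero, mul_zero]
    have h2 : ∀ x, η x • (f x - g x) = f x * (η x : ℂ) - g x * (η x : ℂ) := fun x => by
      rw [Complex.real_smul]; ring
    simp only [h2]
    rw [integral_sub (hint f hf) (hint g hg), sub_eq_zero]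
    simpa using h1

/-- Against Schwartz functions, both the `L²` extension and the integral move the transform onto the
test function, so they define the same distribution. -/
theorem fourierInv_toLp_ae_eq {f : V → ℂ} (h1 : Integrable f) (h2 : MemLp f 2 volume) :
    (𝓕⁻ (h2.toLp f) : Lp ℂ 2 (volume : Measure V)) =ᵐ[volume] 𝓕⁻ f := by
  have hcont : Continuous (𝓕⁻ f) := by
    have : 𝓕⁻ f = fun w => 𝓕 f (-w) := funext fun w => Real.fourierInv_eq_fourier_neg f w
    rw [this]
    exact (VectorFourier.fourierIntegral_continuous Real.continuous_fourierChar
      (innerSL ℝ).continuous₂ h1).comp continuous_neg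
  have key := ae_eq_of_forall_schwartz (V := V) isOpen_univ
    (f := (𝓕⁻ (h2.toLp f) : Lp ℂ 2 (volume : Measure V))) (g := 𝓕⁻ f)
    (((Lp.memLp _).locallyIntegrable (by norm_num)).locallyIntegrableOn _)
    (hcont.locallyIntegrable.locallyIntegrableOn _) (fun φ _ _ => ?_)
  · filter_upwards [key] with x hx
    exact hx trivial
  · have e1 := congrArg (fun u : 𝓢'(V, ℂ) => u φ)
      (Lp.fourierInv_toTemperedDistribution_eq (h2.toLp f))
    simp only [TemperedDistribution.fourierInv_apply, Lp.toTemperedDistribution_apply,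
      smul_eq_mul] at e1
    have e2 : ∫ x, (𝓕⁻ (h2.toLp f) : Lp ℂ 2 (volume : Measure V)) x * φ x =
        ∫ x, (𝓕⁻ φ) x * f x := by
      simp only [mul_comm _ (φ _)]
      rw [← e1]
      refine integral_congr_ae ?_
      filter_upwards [h2.coeFn_toLp] with x hx
      rw [hx]
    rw [e2]
    have e3 := VectorFourier.integral_fourierIntegral_smul_eq_flip (μ := volume) (ν := volume)
      (L := innerₗ V) (e := Real.fourierChar) (f := f) (g := fun x => φ (-x))
      Real.continuous_fourierChar (innerSL ℝ).continuous₂ h1 (φ.integrable.comp_neg)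
    have e4 : ∫ ξ, 𝓕 f ξ • φ (-ξ) = ∫ x, 𝓕⁻ f x * φ x := by
      rw [← integral_neg_eq_self]
      refine integral_congr_ae (ae_of_all _ fun x => ?_)
      simp [Real.fourierInv_eq_fourier_neg]
    rw [← e4]
    refine Eq.trans ?_ e3.symm
    refine integral_congr_ae (ae_of_all _ fun x => ?_)
    simp only [smul_eq_mul]
    rw [mul_comm]
    congr 1
    rw [SchwartzMap.fourierInv_coe, flip_innerₗ, Real.fourierInv_eq_fourier_comp_neg]
    rfl

end FourierL2

/-! ### A total family in `L²` -/

/-- The Fourier transform of a translated Poisson kernel. -/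
def genFun (a ξ : Space d) : ℂ :=
  Complex.exp (-(2 * Real.pi * Complex.I * (inner ℝ a ξ : ℝ)) - 2 * Real.pi * ‖ξ‖)

theorem norm_genFun (a ξ : Space d) : ‖genFun a ξ‖ = Real.exp (-(2 * Real.pi) * ‖ξ‖) := by
  rw [genFun, Complex.norm_exp]
  simp

theorem continuous_genFun (a : Space d) : Continuous (genFun a) := by
  unfold genFun; fun_prop

theorem integrable_genFun (hd : 1 ≤ d) (a : Space d) : Integrable (genFun a) := by
  refine (integrable_exp_neg_norm hd (a := 2 * Real.pi) (by positivity) 0).mono'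
    (continuous_genFun a).aestronglyMeasurable (ae_of_all _ fun ξ => ?_)
  rw [norm_genFun]; simp

theorem memLp_genFun (hd : 1 ≤ d) (a : Space d) : MemLp (genFun a) 2 volume := by
  rw [memLp_two_iff_integrable_sq_norm (continuous_genFun a).aestronglyMeasurable]
  refine (integrable_exp_neg_norm hd (a := 4 * Real.pi) (by positivity) 0).congr
    (ae_of_all _ fun ξ => ?_)
  simp only [norm_genFun, ← Real.exp_nat_mul, pow_zero, one_mul]
  congr 1
  push_cast
  ring

/-- The class of `genFun a` in `L²`. -/
def gen (hd : 1 ≤ d) (a : Space d) : L2 d := (memLp_genFun hd a).toLp _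

/-- The pairing of `h` with `gen a` is the inverse Fourier transform of `e^{-2π|ξ|} h` at `a`. If
all these vanish, then `e^{-2π|ξ|} h = 0`, and the exponential has no zeros. -/
theorem span_gen_dense (hd : 1 ≤ d) :
    (Submodule.span ℂ (Set.range (gen hd))).topologicalClosure = ⊤ := by
  rw [Submodule.topologicalClosure_eq_top_iff, Submodule.eq_bot_iff]
  intro h hh
  have hh' : ∀ a, inner ℂ (gen hd a) h = 0 := fun a =>
    (Submodule.mem_orthogonal _ _).1 hh _ (Submodule.subset_span ⟨a, rfl⟩)
  set k : Space d → ℂ := fun ξ => genFun 0 ξ * h ξ with hk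
  have hk1 : Integrable k := (memLp_genFun hd 0).integrable_mul (Lp.memLp h)
  have hk2 : MemLp k 2 volume := by
    refine (Lp.memLp h).mono ((continuous_genFun 0).aestronglyMeasurable.mul
      (Lp.aestronglyMeasurable h)) (ae_of_all _ fun ξ => ?_)
    rw [hk]
    simp only [norm_mul, norm_genFun]
    refine mul_le_of_le_one_left (norm_nonneg _) (Real.exp_le_one_iff.2 ?_)
    have := Real.pi_pos
    nlinarith [norm_nonneg ξ]
  have hF : 𝓕⁻ k = 0 := by
    funext a
    rw [Real.fourierInv_eq', Pi.zero_apply, ← hh' a, L2.inner_def]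
    refine integral_congr_ae ?_
    filter_upwards [(memLp_genFun hd a).coeFn_toLp] with ξ hξ
    rw [gen, hξ, hk]
    simp only [RCLike.inner_apply, smul_eq_mul, genFun, ← Complex.exp_conj]
    rw [mul_comm (h ξ), ← mul_assoc, ← Complex.exp_add]
    congr 2
    simp [real_inner_comm, Complex.conj_ofNat]
    ring
  have h0 : (𝓕⁻ (hk2.toLp k) : L2 d) = 0 := by
    rw [Lp.eq_zero_iff_ae_eq_zero]
    have := fourierInv_toLp_ae_eq hk1 hk2
    rwa [hF] at this
  have h1 : hk2.toLp k = 0 := by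
    have := congrArg (fun x : L2 d => 𝓕 x) h0
    simp only [FourierTransform.fourier_fourierInv_eq] at this
    rw [this]
    exact (Lp.fourierTransformₗᵢ (Space d) ℂ).map_zero
  rw [Lp.eq_zero_iff_ae_eq_zero] at h1 ⊢
  filter_upwards [h1, hk2.coeFn_toLp] with ξ h2 h3
  rw [h3] at h2
  have : genFun 0 ξ ≠ 0 := Complex.exp_ne_zero _
  simpa [hk, this] using h2

/-! ### Convergence criteria -/

theorem enorm_sq_of_coeFn {Φ : Cyl d} {φ : Sph d → ℝ → ℂ}
    (hφ : AEStronglyMeasurable (Function.uncurry φ) ((surface d).prod volume))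
    (hφ2 : ∀ᵐ ω ∂(surface d), MemLp (φ ω) 2 volume)
    (h : ∀ᵐ ω ∂(surface d), Φ ω = toL2R (φ ω)) :
    ‖Φ‖ₑ ^ 2 = ∫⁻ q, ‖φ q.1 q.2‖ₑ ^ 2 ∂(surface d).prod volume := by
  have hm : AEMeasurable (fun q : Sph d × ℝ => ‖φ q.1 q.2‖ₑ ^ 2) ((surface d).prod volume) :=
    hφ.enorm.pow_const 2
  rw [enorm_sq_eq_lintegral, lintegral_prod _ hm]
  refine lintegral_congr_ae ?_
  filter_upwards [h, hφ2] with ω h1 h2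
  rw [h1, enorm_toL2R_sq h2]

/-- Fatou gives `liminf ‖Φ t + Ψ‖² ≥ 4‖Ψ‖²`. As the norms agree, the parallelogram law reads `‖Φ t -
Ψ‖² = 4‖Ψ‖² - ‖Φ t + Ψ‖²`, which therefore tends to `0`. No dominating function is required. -/
theorem tendsto_of_tendsto_pointwise {Φ : ℝ → Cyl d} {Ψ : Cyl d} {φ : ℝ → Sph d → ℝ → ℂ}
    {ψ : Sph d → ℝ → ℂ}
    (hφ : ∀ t, AEStronglyMeasurable (Function.uncurry (φ t)) ((surface d).prod volume))
    (hψ : AEStronglyMeasurable (Function.uncurry ψ) ((surface d).prod volume))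
    (hφ2 : ∀ t, ∀ᵐ ω ∂(surface d), MemLp (φ t ω) 2 volume)
    (hψ2 : ∀ᵐ ω ∂(surface d), MemLp (ψ ω) 2 volume)
    (hΦ : ∀ t, ∀ᵐ ω ∂(surface d), Φ t ω = toL2R (φ t ω))
    (hΨ : ∀ᵐ ω ∂(surface d), Ψ ω = toL2R (ψ ω)) (hnorm : ∀ t, ‖Φ t‖ = ‖Ψ‖)
    (hlim : ∀ ω s, Tendsto (fun t => φ t ω s) atTop (𝓝 (ψ ω s))) :
    Tendsto Φ atTop (𝓝 Ψ) := by
  -- Fatou's lemma is applied along sequences of times.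
  refine tendsto_of_seq_tendsto fun x hx => ?_
  have hsum : ∀ t, ‖Φ t + Ψ‖ₑ ^ 2 =
      ∫⁻ q, ‖φ t q.1 q.2 + ψ q.1 q.2‖ₑ ^ 2 ∂(surface d).prod volume := by
    intro t
    refine enorm_sq_of_coeFn (φ := fun ω s => φ t ω s + ψ ω s) ((hφ t).add hψ) ?_ ?_
    · filter_upwards [hφ2 t, hψ2] with ω h1 h2
      exact h1.add h2
    · filter_upwards [hφ2 t, hψ2, hΦ t, hΨ, Lp.coeFn_add (Φ t) Ψ] with ω h1 h2 h3 h4 h5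
      rw [h5, Pi.add_apply, h3, h4, toL2R_add h1 h2]
  have h4 : 4 * ‖Ψ‖ₑ ^ 2 = ∫⁻ q, ‖ψ q.1 q.2 + ψ q.1 q.2‖ₑ ^ 2 ∂(surface d).prod volume := by
    rw [enorm_sq_of_coeFn hψ hψ2 hΨ, ← lintegral_const_mul'' (f := fun q : Sph d × ℝ => ‖ψ q.1 q.2‖ₑ ^ 2) _
      (hψ.enorm.pow_const 2)]
    refine lintegral_congr fun q => ?_
    rw [← two_mul, enorm_mul, mul_pow]
    congr 1
    rw [← ofReal_norm]
    norm_num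
  have hfatou : 4 * ‖Ψ‖ₑ ^ 2 ≤ liminf (fun n => ‖Φ (x n) + Ψ‖ₑ ^ 2) atTop := by
    rw [h4]
    simp only [hsum]
    refine le_trans (lintegral_mono fun q => ?_)
      (lintegral_liminf_le' fun n => ((hφ (x n)).add hψ).enorm.pow_const 2)
    have h5 : Tendsto (fun n => ‖φ (x n) q.1 q.2 + ψ q.1 q.2‖ₑ ^ 2) atTop
        (𝓝 (‖ψ q.1 q.2 + ψ q.1 q.2‖ₑ ^ 2)) :=
      ((ENNReal.continuous_pow 2).tendsto _).comp
        ((((hlim q.1 q.2).comp hx).add_const (ψ q.1 q.2)).enorm)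
    exact h5.liminf_eq.symm.le
  rw [tendsto_iff_norm_sub_tendsto_zero]
  have hsq : Tendsto (fun n => ‖Φ (x n) - Ψ‖ ^ 2) atTop (𝓝 0) := by
    rw [Metric.tendsto_atTop']
    intro ε hε
    -- `ENNReal.ofReal` truncates negative numbers to `0`, where the strict inequality can fail; in
    -- that case the lower bound is trivial.
    have hlt : ENNReal.ofReal (4 * ‖Ψ‖ ^ 2 - ε) < liminf (fun n => ‖Φ (x n) + Ψ‖ₑ ^ 2) atTop ∨
        4 * ‖Ψ‖ ^ 2 - ε < 0 := by
      rcases lt_or_ge (4 * ‖Ψ‖ ^ 2 - ε) 0 with h | h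
      · exact Or.inr h
      · refine Or.inl (lt_of_lt_of_le ?_ hfatou)
        have : (4 : ENNReal) * ‖Ψ‖ₑ ^ 2 = ENNReal.ofReal (4 * ‖Ψ‖ ^ 2) := by
          rw [ENNReal.ofReal_mul (by norm_num), ENNReal.ofReal_pow (norm_nonneg _), ofReal_norm]
          norm_num
        rw [this]
        exact (ENNReal.ofReal_lt_ofReal_iff (by linarith)).2 (by linarith)
    have hev : ∀ᶠ n in atTop, 4 * ‖Ψ‖ ^ 2 - ε < ‖Φ (x n) + Ψ‖ ^ 2 := by
      rcases hlt with h | h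
      · filter_upwards [eventually_lt_of_lt_liminf h] with n hn
        rw [← ofReal_norm, ← ENNReal.ofReal_pow (norm_nonneg _)] at hn
        exact lt_of_not_ge fun h => absurd hn (not_lt.2 (ENNReal.ofReal_le_ofReal h))
      · exact Eventually.of_forall fun n => lt_of_lt_of_le h (by positivity)
    obtain ⟨N, hN⟩ := eventually_atTop.1 hev
    refine ⟨N, fun n hn => ?_⟩
    have h6 := hN n hn.le
    have h7 := parallelogram_law_with_norm ℂ (Φ (x n)) Ψ
    rw [hnorm] at h7
    rw [Real.dist_eq, sub_zero, abs_of_nonneg (by positivity)]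
    nlinarith
  have := hsq.sqrt
  simpa using this

/-- The usual three-epsilon argument, with the uniform Lipschitz constant `1`. -/
theorem tendsto_of_span_dense {E F : Type*} [NormedAddCommGroup E] [NormedSpace ℂ E]
    [NormedAddCommGroup F] [NormedSpace ℂ F] {A : ℝ → E →L[ℂ] F} {W : E →L[ℂ] F} {S : Set E}
    (hA : ∀ t x, ‖A t x‖ ≤ ‖x‖) (hW : ∀ x, ‖W x‖ ≤ ‖x‖)
    (hS : (Submodule.span ℂ S).topologicalClosure = ⊤)
    (h : ∀ x ∈ S, Tendsto (fun t => A t x) atTop (𝓝 (W x))) (x : E) :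
    Tendsto (fun t => A t x) atTop (𝓝 (W x)) := by
  have hspan : ∀ x ∈ Submodule.span ℂ S, Tendsto (fun t => A t x) atTop (𝓝 (W x)) := by
    intro x hx
    induction hx using Submodule.span_induction with
    | mem x hx => exact h x hx
    | zero => simp
    | add x y _ _ hx hy => simpa using hx.add hy
    | smul c x _ hx => simpa using hx.const_smul c
  have hx : x ∈ closure (Submodule.span ℂ S : Set E) := by
    rw [← Submodule.topologicalClosure_coe, hS]; trivial
  rw [Metric.tendsto_atTop']
  intro ε hε
  obtain ⟨y, hy, hxy⟩ := Metric.mem_closure_iff.1 hx (ε / 3) (by positivity)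
  obtain ⟨N, hN⟩ := Metric.tendsto_atTop'.1 (hspan y hy) (ε / 3) (by positivity)
  refine ⟨N, fun t ht => ?_⟩
  have h1 : dist (A t x) (A t y) ≤ dist x y := by
    rw [dist_eq_norm, dist_eq_norm, ← map_sub]; exact hA t _
  have h2 : dist (W y) (W x) ≤ dist x y := by
    rw [dist_comm, dist_eq_norm, dist_eq_norm, ← map_sub]; exact hW _
  have h3 := hN t ht
  have h4 := dist_triangle4 (A t x) (A t y) (W y) (W x)
  linarith

/-! ### The half-wave groups and the radiation fields -/

/-- `exp (2πi t|ξ|)`. -/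
def phase (t : ℝ) (ξ : Space d) : ℂ := Complex.exp (2 * Real.pi * Complex.I * t * ‖ξ‖)

theorem norm_phase (t : ℝ) (ξ : Space d) : ‖phase t ξ‖ = 1 := by
  rw [phase, Complex.norm_exp]; simp

theorem continuous_phase (t : ℝ) : Continuous (phase t : Space d → ℂ) := by
  unfold phase; fun_prop

theorem memLp_phase_mul (t : ℝ) {F : Space d → ℂ} (hF : MemLp F 2 volume) :
    MemLp (fun ξ => phase t ξ * F ξ) 2 volume := by
  refine hF.mono ((continuous_phase t).aestronglyMeasurable.mul hF.1) (ae_of_all _ fun ξ => ?_)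
  simp [norm_phase]

/-- Multiplication by `phase t`. -/
def phaseMul (t : ℝ) : L2 d →ₗᵢ[ℂ] L2 d where
  toFun F := (memLp_phase_mul t (Lp.memLp F)).toLp _
  map_add' F G := by
    refine Lp.ext ?_
    filter_upwards [Lp.coeFn_add ((memLp_phase_mul t (Lp.memLp F)).toLp _)
      ((memLp_phase_mul t (Lp.memLp G)).toLp _), (memLp_phase_mul t (Lp.memLp F)).coeFn_toLp,
      (memLp_phase_mul t (Lp.memLp G)).coeFn_toLp,
      (memLp_phase_mul t (Lp.memLp (F + G))).coeFn_toLp, Lp.coeFn_add F G] with ω h1 h2 h3 h4 h5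
    rw [h1, h4, h5, Pi.add_apply, Pi.add_apply, h2, h3, mul_add]
  map_smul' c F := by
    refine Lp.ext ?_
    filter_upwards [Lp.coeFn_smul c ((memLp_phase_mul t (Lp.memLp F)).toLp _),
      (memLp_phase_mul t (Lp.memLp F)).coeFn_toLp,
      (memLp_phase_mul t (Lp.memLp (c • F))).coeFn_toLp, Lp.coeFn_smul c F] with ω h1 h2 h3 h4
    rw [RingHom.id_apply, h1, h3, h4, Pi.smul_apply, Pi.smul_apply, h2, smul_eq_mul, smul_eq_mul]
    ring
  norm_map' F := by
    simp only [LinearMap.coe_mk, AddHom.coe_mk]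
    rw [Lp.norm_toLp, Lp.norm_def]
    congr 1
    refine eLpNorm_congr_norm_ae (ae_of_all _ fun ξ => ?_)
    simp [norm_phase]

theorem coeFn_phaseMul (t : ℝ) (F : L2 d) :
    phaseMul t F =ᵐ[volume] fun ξ => phase t ξ * F ξ :=
  (memLp_phase_mul t (Lp.memLp F)).coeFn_toLp

/-- The inverse Fourier transform on `L²(ℝᵈ)`. -/
def invF (d : ℕ) : L2 d →ₗᵢ[ℂ] L2 d := (Lp.fourierTransformₗᵢ (Space d) ℂ).symm.toLinearIsometry

theorem invF_apply (F : L2 d) : invF d F = 𝓕⁻ F := rfl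

/-- The inverse Fourier transform on `L²(ℝ)`. -/
def invFR : L2R →ₗᵢ[ℂ] L2R := (Lp.fourierTransformₗᵢ ℝ ℂ).symm.toLinearIsometry

theorem invFR_apply (h : L2R) : invFR h = 𝓕⁻ h := rfl

/-- `F ↦ F(-·)` on `L²(ℝᵈ)`. -/
def negL2 (d : ℕ) : L2 d →ₗᵢ[ℂ] L2 d :=
  Lp.compMeasurePreservingₗᵢ ℂ (fun x => -x) (Measure.measurePreserving_neg volume)

/-- `h ↦ h(-·)` on `L²(ℝ)`. -/
def negR : L2R →ₗᵢ[ℂ] L2R :=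
  Lp.compMeasurePreservingₗᵢ ℂ (fun x => -x) (Measure.measurePreserving_neg volume)

theorem coeFn_negL2 (F : L2 d) : negL2 d F =ᵐ[volume] fun x => F (-x) :=
  Lp.coeFn_compMeasurePreserving F (Measure.measurePreserving_neg volume)

theorem negR_toL2R {h : ℝ → ℂ} (hh : MemLp h 2 volume) :
    negR (toL2R h) = toL2R (fun s => h (-s)) := by
  have hmp := Measure.measurePreserving_neg (volume : Measure ℝ)
  have hk : MemLp (fun s => h (-s)) 2 volume := hh.comp_measurePreserving hmp
  rw [toL2R_of_memLp hh, toL2R_of_memLp hk]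
  exact Lp.toLp_compMeasurePreserving hh hmp

/-- `exp (it|D|)` applied to the function with Fourier transform `G`, in polar coordinates
translated by `t`. -/
def outgoing (hd : 1 ≤ d) (ε t : ℝ) : L2 d →L[ℂ] Cyl d :=
  (shiftCyl d t).comp ((polar hd).toContinuousLinearMap.comp
    ((invF d).toContinuousLinearMap.comp (phaseMul (ε * t)).toContinuousLinearMap))

theorem norm_shiftCyl (t : ℝ) (Φ : Cyl d) : ‖shiftCyl d t Φ‖ = ‖Φ‖ :=
  norm_fiber (shift t) Φ

theorem norm_outgoing (hd : 1 ≤ d) (ε t : ℝ) (G : L2 d) : ‖outgoing hd ε t G‖ = ‖G‖ := by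
  simp [outgoing, norm_shiftCyl]

/-- The radiation field of `exp (-it|D|)`, up to a phase. -/
def radPlus (hd : 1 ≤ d) : L2 d →L[ℂ] Cyl d :=
  (fiber invFR.toContinuousLinearMap).comp (polar hd).toContinuousLinearMap

/-- The radiation field of `exp (it|D|)`, up to a phase. -/
def radMinus (hd : 1 ≤ d) : L2 d →L[ℂ] Cyl d :=
  (fiber (invFR.comp negR).toContinuousLinearMap).comp
    ((polar hd).toContinuousLinearMap.comp (negL2 d).toContinuousLinearMap)

theorem norm_radPlus (hd : 1 ≤ d) (G : L2 d) : ‖radPlus hd G‖ = ‖G‖ := by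
  exact (norm_fiber invFR (polar hd G)).trans ((polar hd).norm_map G)

theorem norm_radMinus (hd : 1 ≤ d) (G : L2 d) : ‖radMinus hd G‖ = ‖G‖ := by
  exact (norm_fiber (invFR.comp negR) (polar hd (negL2 d G))).trans
    (((polar hd).norm_map _).trans ((negL2 d).norm_map G))

theorem coeFn_radPlus (hd : 1 ≤ d) {F : Space d → ℂ} (hF : MemLp F 2 volume) :
    ∀ᵐ ω ∂(surface d), radPlus hd (hF.toLp F) ω = 𝓕⁻ (toL2R (polarFun F ω)) := by
  filter_upwards [invFR.toContinuousLinearMap.coeFn_compLpL (p := 2) (μ := surface d)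
    (polar hd (hF.toLp F)), coeFn_polar hd (hF.toLp F), toL2R_polarFun_congr hd hF.coeFn_toLp]
    with ω h1 h2 h3
  rw [← invFR_apply, ← h3, ← h2]
  exact h1

/-- Two reflections cancel in the argument of `F`: the transformed function lives on `s < 0` and
equals `|s|^((d-1)/2) F(sω)` there, which selects the negative frequencies. -/
theorem coeFn_radMinus (hd : 1 ≤ d) {F : Space d → ℂ} (hF : MemLp F 2 volume) :
    ∀ᵐ ω ∂(surface d), radMinus hd (hF.toLp F) ω =
      𝓕⁻ (toL2R (fun s => polarFun (fun ξ => F (-ξ)) ω (-s))) := by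
  have hneg : negL2 d (hF.toLp F) =ᵐ[volume] fun ξ => F (-ξ) := by
    refine (coeFn_negL2 _).trans ?_
    exact (Measure.measurePreserving_neg (volume : Measure (Space d))).quasiMeasurePreserving.ae_eq
      hF.coeFn_toLp
  have hm : MemLp (fun ξ => F (-ξ)) 2 volume :=
    hF.comp_measurePreserving (Measure.measurePreserving_neg volume)
  filter_upwards [(invFR.comp negR).toContinuousLinearMap.coeFn_compLpL (p := 2) (μ := surface d)
    (polar hd (negL2 d (hF.toLp F))), coeFn_polar hd (negL2 d (hF.toLp F)),
    toL2R_polarFun_congr hd hneg, ae_memLp_polarFun hd hm] with ω h1 h2 h3 h4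
  rw [← invFR_apply, ← negR_toL2R h4, ← h3, ← h2]
  exact h1

/-! ### Asymptotics of the Poisson kernel along the light cone -/

/-- The profile of the Poisson kernel centred at `a` along the light cone. -/
def radFun (a : Space d) (ω : Sph d) (s : ℝ) : ℂ :=
  (Real.Gamma (((d : ℝ) + 1) / 2) : ℂ) *
    (2 * Real.pi * (1 - Complex.I * (s - (inner ℝ a (ω : Space d) : ℝ)))) ^
      (-(((d : ℝ) + 1) / 2 : ℝ) : ℂ)

theorem measurable_radFun (a : Space d) : Measurable (Function.uncurry (radFun a)) := by
  unfold radFun Function.uncurry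
  fun_prop

theorem polarFun_genFun (a : Space d) (ω : Sph d) (k : ℝ) :
    polarFun (genFun a) ω k = (Set.Ioi (0 : ℝ)).indicator (fun k =>
      ((k ^ ((((d : ℝ) + 1) / 2) - 1) : ℝ) : ℂ) *
        Complex.exp (-(2 * Real.pi * (1 + Complex.I * (inner ℝ a (ω : Space d) : ℝ))) * k)) k := by
  have hω : ‖(ω : Space d)‖ = 1 := by simp
  unfold polarFun
  split_ifs with h
  · rw [Set.indicator_of_mem (Set.mem_Ioi.2 h)]
    congr 2
    · congr 1
      ring
    · simp only [genFun]
      rw [norm_smul, hω, Real.norm_of_nonneg h.le, inner_smul_right]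
      congr 1
      push_cast
      ring
  · rw [Set.indicator_of_notMem (by simpa using h)]

theorem norm_polarFun_genFun (a : Space d) (ω : Sph d) (k : ℝ) :
    ‖polarFun (genFun a) ω k‖ = (Set.Ioi (0 : ℝ)).indicator (fun k =>
      k ^ ((((d : ℝ) + 1) / 2) - 1) * Real.exp (-(2 * Real.pi) * k)) k := by
  rw [polarFun_genFun, norm_indicator_eq_indicator_norm]
  by_cases h : k ∈ Set.Ioi (0 : ℝ)
  · have hk : 0 < k := h
    rw [Set.indicator_of_mem h, Set.indicator_of_mem h, norm_mul, Complex.norm_real,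
      Real.norm_of_nonneg (Real.rpow_nonneg hk.le _), Complex.norm_exp]
    simp
  · rw [Set.indicator_of_notMem h, Set.indicator_of_notMem h]

theorem aestronglyMeasurable_polarFun_genFun (a : Space d) (ω : Sph d) :
    AEStronglyMeasurable (polarFun (genFun a) ω) volume :=
  ((measurable_polarFun (continuous_genFun a).measurable).comp
    measurable_prodMk_left).aestronglyMeasurable

theorem integrable_polarFun_genFun (a : Space d) (ω : Sph d) :
    Integrable (polarFun (genFun a) ω) := by
  refine (integrable_norm_iff (aestronglyMeasurable_polarFun_genFun a ω)).1 ?_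
  rw [funext (norm_polarFun_genFun a ω), integrable_indicator_iff measurableSet_Ioi]
  have hd0 := Nat.cast_nonneg (α := ℝ) d
  simpa using integrableOn_rpow_mul_exp_neg_mul_rpow (p := 1) (s := (((d : ℝ) + 1) / 2) - 1)
    (b := 2 * Real.pi) (by linarith) one_pos (by positivity)

theorem memLp_polarFun_genFun (hd : 1 ≤ d) (a : Space d) (ω : Sph d) :
    MemLp (polarFun (genFun a) ω) 2 volume := by
  rw [memLp_two_iff_integrable_sq_norm (aestronglyMeasurable_polarFun_genFun a ω)]
  have hd1 : (1 : ℝ) ≤ d := by exact_mod_cast hd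
  have h := integrableOn_rpow_mul_exp_neg_mul_rpow (p := 1) (s := (d : ℝ) - 1)
    (b := 4 * Real.pi) (by linarith) one_pos (by positivity)
  rw [← integrable_indicator_iff measurableSet_Ioi] at h
  refine h.congr (ae_of_all _ fun k => ?_)
  simp only [norm_polarFun_genFun]
  by_cases hk : k ∈ Set.Ioi (0 : ℝ)
  · have hk0 : 0 < k := hk
    rw [Set.indicator_of_mem hk, Set.indicator_of_mem hk, mul_pow, ← Real.exp_nat_mul,
      ← Real.rpow_natCast, ← Real.rpow_mul hk0.le, Real.rpow_one]
    congr 2 <;> push_cast <;> ring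
  · rw [Set.indicator_of_notMem hk, Set.indicator_of_notMem hk]
    simp

/-- The complex Gamma integral with exponent `(d+1)/2` and `r = 2π(1 - i(s - a·ω))`. It identifies
the limit on the cone, computed in `x`, with the radiation field, defined in frequency. -/
theorem fourierInv_polarFun_genFun (a : Space d) (ω : Sph d) :
    𝓕⁻ (polarFun (genFun a) ω) = radFun a ω := by
  funext s
  rw [Real.fourierInv_eq']
  have hd0 := Nat.cast_nonneg (α := ℝ) d
  have h := integral_rpow_mul_cexp_neg_mul_Ioi (a := ((d : ℝ) + 1) / 2) (by linarith)
    (r := 2 * Real.pi * (1 - Complex.I * (s - (inner ℝ a (ω : Space d) : ℝ))))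
    (by simp [Real.pi_pos])
  rw [radFun]
  push_cast at h ⊢
  rw [← h, ← integral_indicator measurableSet_Ioi]
  refine integral_congr_ae (ae_of_all _ fun k => ?_)
  simp only [polarFun_genFun]
  by_cases hk : k ∈ Set.Ioi (0 : ℝ)
  · rw [Set.indicator_of_mem hk, Set.indicator_of_mem hk, smul_eq_mul, mul_left_comm,
      ← Complex.exp_add]
    congr 2
    simp only [RCLike.inner_apply, conj_trivial]
    push_cast
    ring
  · rw [Set.indicator_of_notMem hk, Set.indicator_of_notMem hk, smul_zero]

/-- Change `k` to `-k` under the integral. With `poisson_conj`, this carries the result for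
`e^{-it|D|}` over to `e^{it|D|}`. -/
theorem fourierInv_conj_comp_neg (h : ℝ → ℂ) (s : ℝ) :
    𝓕⁻ (fun k => (starRingEnd ℂ) (h (-k))) s = (starRingEnd ℂ) (𝓕⁻ h s) := by
  rw [Real.fourierInv_eq', Real.fourierInv_eq', ← integral_conj, ← integral_neg_eq_self]
  refine integral_congr_ae (ae_of_all _ fun k => ?_)
  simp only [smul_eq_mul, map_mul, ← Complex.exp_conj, neg_neg]
  congr 2
  simp [Complex.conj_ofNat]

theorem fourierInv_toL2R {h : ℝ → ℂ} (h1 : Integrable h) (h2 : MemLp h 2 volume) :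
    MemLp (𝓕⁻ h) 2 volume ∧ 𝓕⁻ (toL2R h) = toL2R (𝓕⁻ h) := by
  have h3 := fourierInv_toLp_ae_eq h1 h2
  refine ⟨(memLp_congr_ae h3).1 (Lp.memLp _), ?_⟩
  rw [← toL2R_congr h3, toL2R_coe, toL2R_of_memLp h2]

theorem poisson_conj (z : ℂ) (y : Space d) :
    poisson ((starRingEnd ℂ) z) y = (starRingEnd ℂ) (poisson z y) := by
  unfold poisson
  rw [← integral_conj, ← integral_neg_eq_self]
  refine integral_congr_ae (ae_of_all _ fun ξ => ?_)
  simp [← Complex.exp_conj, Complex.conj_ofNat]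

theorem ofReal_mul_cpow {r : ℝ} (hr : 0 < r) {w : ℂ} (hw : w ≠ 0) (e : ℝ) :
    ((r : ℂ) * w) ^ (e : ℂ) = ((r ^ e : ℝ) : ℂ) * w ^ (e : ℂ) := by
  have hr' : (r : ℂ) ≠ 0 := by exact_mod_cast hr.ne'
  rw [Complex.cpow_def_of_ne_zero (mul_ne_zero hr' hw), Complex.log_ofReal_mul hr hw, add_mul,
    Complex.exp_add, ← Complex.cpow_def_of_ne_zero hw, Complex.ofReal_log hr.le,
    ← Complex.cpow_def_of_ne_zero hr', Complex.ofReal_cpow hr.le]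

/-- The argument of `w` lies in `(-π/2, π/2)`, so adding `π/2` does not cross the cut of the
logarithm. -/
theorem I_mul_cpow {w : ℂ} (hw : 0 < w.re) (e : ℂ) :
    (Complex.I * w) ^ e = Complex.exp (Real.pi / 2 * Complex.I * e) * w ^ e := by
  have hw0 : w ≠ 0 := fun h => by simp [h] at hw
  have harg := Complex.abs_arg_lt_pi_div_two_iff.2 (Or.inl hw)
  have h1 : Complex.log (Complex.I * w) = Real.pi / 2 * Complex.I + Complex.log w := by
    rw [Complex.log_mul Complex.I_ne_zero hw0, Complex.log_I]
    rw [Complex.arg_I]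
    rw [abs_lt] at harg
    exact ⟨by linarith [Real.pi_pos, harg.1], by linarith [harg.2]⟩
  rw [Complex.cpow_def_of_ne_zero (mul_ne_zero Complex.I_ne_zero hw0), h1, add_mul,
    Complex.exp_add, ← Complex.cpow_def_of_ne_zero hw0]

/-- With `z = 1 + it` and `x = (s+t)ω`, the terms in `t²` cancel and `z² + |x-a|² = 2t q(t)` with
`q(t) → i + s - a·ω`. The powers of `t` balance: `(d-1)/2` from the polar weight, `1` from the
factor `z` and `-(d+1)/2` from the kernel. -/
theorem tendsto_poisson_cone (hd : 1 ≤ d) (a : Space d) (ω : Sph d) (s : ℝ) :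
    Tendsto (fun t : ℝ => polarFun (fun x => poisson (1 + Complex.I * t) (x - a)) ω (s + t)) atTop
      (𝓝 (Complex.exp (-(Complex.I * tau d)) * radFun a ω s)) := by
  have hω : ‖(ω : Space d)‖ = 1 := by simp
  set b : ℝ := inner ℝ a (ω : Space d) with hb
  set p : ℝ := ((d : ℝ) + 1) / 2 with hp
  set q : ℝ → ℂ := fun t => Complex.I + (s - b : ℝ) +
    (((1 + s ^ 2 - 2 * s * b + ‖a‖ ^ 2) / 2 * t⁻¹ : ℝ) : ℂ) with hq
  have hqlim : Tendsto q atTop (𝓝 (Complex.I + (s - b : ℝ))) := by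
    have h1 : Tendsto (fun t : ℝ => (1 + s ^ 2 - 2 * s * b + ‖a‖ ^ 2) / 2 * t⁻¹) atTop (𝓝 0) := by
      have h := tendsto_inv_atTop_zero.const_mul ((1 + s ^ 2 - 2 * s * b + ‖a‖ ^ 2) / 2)
      rwa [mul_zero] at h
    have h2 := (Complex.continuous_ofReal.tendsto 0).comp h1
    simpa [hq] using h2.const_add (Complex.I + (s - b : ℝ))
  -- Imaginary part `1` keeps `q` away from zero.
  have hqim : ∀ t, (q t).im = 1 := fun t => by simp only [hq, Complex.add_im, Complex.I_im,
    Complex.ofReal_im, add_zero]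
  have hform : ∀ᶠ t : ℝ in atTop,
      (Real.Gamma p / Real.pi ^ p * 2 ^ (-p) : ℝ) * (((1 + s * t⁻¹) ^ (p - 1) : ℝ) : ℂ) *
        (((t⁻¹ : ℝ) : ℂ) + Complex.I) * q t ^ (-p : ℂ) =
      polarFun (fun x => poisson (1 + Complex.I * t) (x - a)) ω (s + t) := by
    filter_upwards [eventually_gt_atTop 0, eventually_gt_atTop (-s)] with t ht hts
    have hst : 0 < s + t := by linarith
    have htc : (t : ℂ) ≠ 0 := by exact_mod_cast ht.ne'
    have hq0 : q t ≠ 0 := fun h => by simpa [h] using hqim t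
    have hnorm : ‖(s + t) • (ω : Space d) - a‖ ^ 2 = (s + t) ^ 2 - 2 * (s + t) * b + ‖a‖ ^ 2 := by
      rw [norm_sub_sq_real, norm_smul, hω, inner_smul_left, real_inner_comm,
        Real.norm_of_nonneg hst.le, ← hb]
      simp only [conj_trivial]
      ring
    rw [polarFun, if_pos hst, poisson_eq hd (by simp)]
    have hbase : (1 + Complex.I * t) ^ 2 + (‖(s + t) • (ω : Space d) - a‖ : ℂ) ^ 2 =
        ((2 * t : ℝ) : ℂ) * q t := by
      rw [← Complex.ofReal_pow, hnorm, hq]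
      push_cast
      field_simp
      ring_nf
      rw [Complex.I_sq]
      ring
    have hcp := ofReal_mul_cpow (show 0 < 2 * t by positivity) hq0 (-p)
    rw [Complex.ofReal_neg] at hcp
    rw [hbase, hcp]
    have h1 : s + t = t * (1 + s * t⁻¹) := by field_simp; ring
    have h2 : 0 ≤ 1 + s * t⁻¹ := by
      have := (div_pos hst ht).le
      rw [h1, mul_div_cancel_left₀ _ ht.ne'] at this
      exact this
    have h3 : (s + t) ^ (((d : ℝ) - 1) / 2) = t ^ (p - 1) * (1 + s * t⁻¹) ^ (p - 1) := by
      rw [← Real.mul_rpow ht.le h2, ← h1]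
      congr 1
      rw [hp]; ring
    have h4 : (2 * t) ^ (-p) = 2 ^ (-p) * t ^ (-p) := Real.mul_rpow (by norm_num) ht.le
    have h5 : t ^ (p - 1) * t ^ (-p) * t = 1 := by
      rw [← Real.rpow_add ht]
      have : p - 1 + -p = -1 := by ring
      rw [this, Real.rpow_neg_one]
      field_simp
    have h6 : (1 : ℂ) + Complex.I * t = t * (((t⁻¹ : ℝ) : ℂ) + Complex.I) := by
      push_cast
      field_simp
    rw [h3, h4, h6]
    have h5' : ((t ^ (p - 1) : ℝ) : ℂ) * ((t ^ (-p) : ℝ) : ℂ) * (t : ℂ) = 1 := by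
      exact_mod_cast h5
    push_cast at h5' ⊢
    linear_combination (-(Real.Gamma p : ℂ) / ((Real.pi ^ p : ℝ) : ℂ) * ((2 ^ (-p) : ℝ) : ℂ) *
      (((1 + s * t⁻¹) ^ (p - 1) : ℝ) : ℂ) * ((t : ℂ)⁻¹ + Complex.I) * q t ^ (-p : ℂ)) * h5'
  refine Tendsto.congr' hform ?_
  have hlim1 : Tendsto (fun t : ℝ => (((1 + s * t⁻¹) ^ (p - 1) : ℝ) : ℂ)) atTop (𝓝 1) := by
    have h1 : Tendsto (fun t : ℝ => 1 + s * t⁻¹) atTop (𝓝 1) := by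
      simpa using (tendsto_inv_atTop_zero.const_mul s).const_add 1
    have h2 := h1.rpow_const (p := p - 1) (Or.inl one_ne_zero)
    rw [Real.one_rpow] at h2
    simpa [Function.comp_def] using (Complex.continuous_ofReal.tendsto 1).comp h2
  have hlim2 : Tendsto (fun t : ℝ => (((t⁻¹ : ℝ) : ℂ) + Complex.I)) atTop (𝓝 Complex.I) := by
    have h2 := (Complex.continuous_ofReal.tendsto 0).comp tendsto_inv_atTop_zero
    simpa using h2.add_const Complex.I
  have hlim3 : Tendsto (fun t => q t ^ (-p : ℂ)) atTop
      (𝓝 ((Complex.I + (s - b : ℝ)) ^ (-p : ℂ))) := by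
    exact Filter.Tendsto.cpow hqlim tendsto_const_nhds (Or.inr (by simp))
  have hall := ((hlim1.const_mul
    ((Real.Gamma p / Real.pi ^ p * 2 ^ (-p) : ℝ) : ℂ)).mul hlim2).mul hlim3
  convert hall using 2
  have hI : Complex.I + ((s - b : ℝ) : ℂ) = Complex.I * (1 - Complex.I * (s - b : ℝ)) := by
    ring_nf
    rw [Complex.I_sq]
    ring
  have hre : 0 < (1 - Complex.I * ((s - b : ℝ) : ℂ)).re := by simp
  have hne : 1 - Complex.I * ((s - b : ℝ) : ℂ) ≠ 0 := fun h => by rw [h] at hre; simp at hre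
  rw [hI, I_mul_cpow hre, radFun]
  have h2pi : (2 * Real.pi * (1 - Complex.I * (s - b)) : ℂ) =
      ((2 * Real.pi : ℝ) : ℂ) * (1 - Complex.I * (s - b : ℝ)) := by push_cast; ring
  have hcp := ofReal_mul_cpow (show 0 < 2 * Real.pi by positivity) hne (-p)
  rw [Complex.ofReal_neg] at hcp
  rw [← hb, ← hp, h2pi, hcp]
  -- The origin of the phase: the factor `z ~ it` gives `i` and the kernel gives `i^{-(d+1)/2}`, and
  -- `π/2 - (d+1)π/4 = -τ`.
  have hexp : Complex.I * Complex.exp (Real.pi / 2 * Complex.I * (-p : ℂ)) =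
      Complex.exp (-(Complex.I * tau d)) := by
    have : Complex.I = Complex.exp (Real.pi / 2 * Complex.I) := Complex.exp_pi_div_two_mul_I.symm
    conv_lhs => enter [1]; rw [this]
    rw [← Complex.exp_add]
    congr 1
    rw [tau, hp]
    push_cast
    ring
  rw [← hexp, Real.mul_rpow (by norm_num) Real.pi_pos.le, Real.rpow_neg Real.pi_pos.le]
  push_cast
  ring

/-! ### Asymptotics of the half-wave groups -/

/-- The phase `e^{-2πit|ξ|}` times `e^{-2π|ξ|}` is `e^{-2π(1+it)|ξ|}`: the half wave acts by
changing the height of the kernel. -/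
theorem invF_phaseMul_gen (hd : 1 ≤ d) (t : ℝ) (a : Space d) :
    invF d (phaseMul (-t) (gen hd a)) =ᵐ[volume]
      fun x => poisson (1 + Complex.I * t) (x - a) := by
  set k : Space d → ℂ := fun ξ => phase (-t) ξ * genFun a ξ with hk
  have hk2 : MemLp k 2 volume := memLp_phase_mul (-t) (memLp_genFun hd a)
  have hk1 : Integrable k := by
    refine (integrable_genFun hd a).mono hk2.1 (ae_of_all _ fun ξ => ?_)
    simp [hk, norm_phase]
  have h1 : phaseMul (-t) (gen hd a) = hk2.toLp k := by
    refine Lp.ext ?_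
    filter_upwards [coeFn_phaseMul (-t) (gen hd a), hk2.coeFn_toLp,
      (memLp_genFun hd a).coeFn_toLp] with ξ h1 h2 h3
    rw [h1, h2, gen, h3]
  rw [invF_apply, h1]
  refine (fourierInv_toLp_ae_eq hk1 hk2).trans (ae_of_all _ fun x => ?_)
  change 𝓕⁻ k x = poisson _ _
  rw [Real.fourierInv_eq', poisson]
  refine integral_congr_ae (ae_of_all _ fun ξ => ?_)
  simp only [hk, phase, genFun, smul_eq_mul]
  rw [← Complex.exp_add, ← Complex.exp_add, inner_sub_left, real_inner_comm]
  congr 1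
  push_cast
  ring

theorem measurable_poisson (hd : 1 ≤ d) (t : ℝ) (a : Space d) :
    Measurable fun x => poisson (1 + Complex.I * t) (x - a) := by
  have : (fun x => poisson (1 + Complex.I * t) (x - a)) = _ :=
    funext fun x => poisson_eq hd (by simp) (x - a)
  rw [this]
  fun_prop

theorem measurable_polarFun_add {F : Space d → ℂ} (hF : Measurable F) (t : ℝ) :
    Measurable (Function.uncurry fun (ω : Sph d) s => polarFun F ω (s + t)) :=
  (measurable_polarFun hF).comp (by fun_prop : Measurable fun q : Sph d × ℝ => (q.1, q.2 + t))

theorem coeFn_outgoing (hd : 1 ≤ d) {ε t : ℝ} {G : L2 d} {F : Space d → ℂ}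
    (h : invF d (phaseMul (ε * t) G) =ᵐ[volume] F) : ∀ᵐ ω ∂(surface d),
      MemLp (fun s => polarFun F ω (s + t)) 2 volume ∧
        outgoing hd ε t G ω = toL2R (fun s => polarFun F ω (s + t)) := by
  have hF : MemLp F 2 volume := (memLp_congr_ae h).1 (Lp.memLp _)
  filter_upwards [coeFn_shiftCyl_polar hd t (invF d (phaseMul (ε * t) G)),
    ae_memLp_polarFun hd hF, Measure.ae_ae_of_ae_prod (polarFun_congr hd h)] with ω h1 h2 h3
  have hmp := measurePreserving_add_right (volume : Measure ℝ) t
  refine ⟨h2.comp_measurePreserving hmp, ?_⟩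
  refine Eq.trans h1 (toL2R_congr ?_)
  exact hmp.quasiMeasurePreserving.ae_eq h3

/-- By isometry and density only the generators matter; for them the pointwise limit on the cone and
conservation of the norm suffice. -/
theorem tendsto_outgoing_neg (hd : 1 ≤ d) (G : L2 d) :
    Tendsto (fun t => outgoing hd (-1) t G) atTop
      (𝓝 (Complex.exp (-(Complex.I * tau d)) • radPlus hd G)) := by
  have hu : ‖Complex.exp (-(Complex.I * tau d))‖ = 1 := by rw [Complex.norm_exp]; simp
  refine tendsto_of_span_dense (W := Complex.exp (-(Complex.I * tau d)) • radPlus hd)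
    (fun t x => (norm_outgoing hd _ t x).le) (fun x => ?_) (span_gen_dense hd) ?_ G
  · rw [smul_apply, norm_smul, hu, one_mul, norm_radPlus]
  rintro _ ⟨a, rfl⟩
  have hrad : ∀ ω, MemLp (radFun a ω) 2 volume ∧
      𝓕⁻ (toL2R (polarFun (genFun a) ω)) = toL2R (radFun a ω) := fun ω => by
    have := fourierInv_toL2R (integrable_polarFun_genFun a ω) (memLp_polarFun_genFun hd a ω)
    rwa [fourierInv_polarFun_genFun] at this
  have hout : ∀ t, ∀ᵐ ω ∂(surface d), _ := fun t => coeFn_outgoing hd (ε := -1) (t := t)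
    (G := gen hd a) (F := fun x => poisson (1 + Complex.I * t) (x - a)) (by rw [neg_one_mul]; exact invF_phaseMul_gen hd t a)
  refine tendsto_of_tendsto_pointwise
    (φ := fun t ω s => polarFun (fun x => poisson (1 + Complex.I * t) (x - a)) ω (s + t))
    (ψ := fun ω s => Complex.exp (-(Complex.I * tau d)) * radFun a ω s)
    (fun t => (measurable_polarFun_add (measurable_poisson hd t a) t).aestronglyMeasurable)
    ((measurable_radFun a).const_mul _).aestronglyMeasurable
    (fun t => (hout t).mono fun ω h => h.1)
    (ae_of_all _ fun ω => (hrad ω).1.const_mul _)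
    (fun t => (hout t).mono fun ω h => h.2) ?_ (fun t => ?_)
    (fun ω s => tendsto_poisson_cone hd a ω s)
  · filter_upwards [Lp.coeFn_smul (Complex.exp (-(Complex.I * tau d))) (radPlus hd (gen hd a)),
      coeFn_radPlus hd (memLp_genFun hd a)] with ω h1 h2
    rw [smul_apply, h1, Pi.smul_apply, gen, h2, (hrad ω).2,
      toL2R_const_mul _ (hrad ω).1]
  · rw [smul_apply, norm_smul, hu, one_mul, norm_radPlus, norm_outgoing]

/-- The complex conjugate of the opposite sign: `e^{it|D|}` puts the kernel at height `1 - it`, the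
conjugate of `1 + it`. -/
theorem tendsto_outgoing_one (hd : 1 ≤ d) (G : L2 d) :
    Tendsto (fun t => outgoing hd 1 t G) atTop
      (𝓝 (Complex.exp (Complex.I * tau d) • radMinus hd G)) := by
  have hu : ‖Complex.exp (Complex.I * tau d)‖ = 1 := by rw [Complex.norm_exp]; simp
  refine tendsto_of_span_dense (W := Complex.exp (Complex.I * tau d) • radMinus hd)
    (fun t x => (norm_outgoing hd _ t x).le) (fun x => ?_) (span_gen_dense hd) ?_ G
  · rw [smul_apply, norm_smul, hu, one_mul, norm_radMinus]
  rintro _ ⟨a, rfl⟩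
  have hflip : ∀ ω : Sph d, (fun s => polarFun (fun ξ => genFun a (-ξ)) ω (-s)) =
      fun s => (starRingEnd ℂ) (polarFun (genFun a) ω (-s)) := fun ω => by
    funext s
    unfold polarFun
    split_ifs
    · simp only [map_mul, Complex.conj_ofReal, genFun, ← Complex.exp_conj]
      congr 2
      simp [Complex.conj_ofNat]
    · simp
  have hrad : ∀ ω, MemLp (fun s => (starRingEnd ℂ) (radFun a ω s)) 2 volume ∧
      𝓕⁻ (toL2R (fun s => polarFun (fun ξ => genFun a (-ξ)) ω (-s))) =
        toL2R (fun s => (starRingEnd ℂ) (radFun a ω s)) := fun ω => by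
    rw [hflip]
    have hm := (memLp_polarFun_genFun hd a ω).comp_measurePreserving
      (Measure.measurePreserving_neg volume)
    have h := fourierInv_toL2R (h := fun s => (starRingEnd ℂ) (polarFun (genFun a) ω (-s)))
      (Complex.conjLIE.toContinuousLinearEquiv.toContinuousLinearMap.integrable_comp
        (integrable_polarFun_genFun a ω).comp_neg)
      (hm.continuousLinearMap_comp Complex.conjLIE.toContinuousLinearEquiv.toContinuousLinearMap)
    rwa [funext (fourierInv_conj_comp_neg _), fourierInv_polarFun_genFun] at h
  have hout : ∀ t, ∀ᵐ ω ∂(surface d), _ := fun t => coeFn_outgoing hd (ε := 1) (t := t)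
    (G := gen hd a) (F := fun x => (starRingEnd ℂ) (poisson (1 + Complex.I * t) (x - a))) (by
      have h := invF_phaseMul_gen hd (-t) a
      rw [neg_neg] at h
      rw [one_mul]
      refine h.trans (ae_of_all _ fun x => ?_)
      simp only
      rw [← poisson_conj]
      congr 1
      simp)
  have hconj : ∀ (t : ℝ) (ω : Sph d) (s : ℝ),
      polarFun (fun x => (starRingEnd ℂ) (poisson (1 + Complex.I * t) (x - a))) ω (s + t) =
      (starRingEnd ℂ) (polarFun (fun x => poisson (1 + Complex.I * t) (x - a)) ω (s + t)) := by
    intro t ω s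
    unfold polarFun
    split_ifs <;> simp
  have hexp : (starRingEnd ℂ) (Complex.exp (-(Complex.I * tau d))) =
      Complex.exp (Complex.I * tau d) := by
    rw [← Complex.exp_conj]; simp
  refine tendsto_of_tendsto_pointwise
    (φ := fun t ω s => polarFun (fun x => (starRingEnd ℂ)
      (poisson (1 + Complex.I * t) (x - a))) ω (s + t))
    (ψ := fun ω s => Complex.exp (Complex.I * tau d) * (starRingEnd ℂ) (radFun a ω s))
    (fun t => (measurable_polarFun_add
      (Complex.continuous_conj.measurable.comp (measurable_poisson hd t a)) t).aestronglyMeasurable)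
    ((Complex.continuous_conj.measurable.comp
      (measurable_radFun a)).const_mul _).aestronglyMeasurable
    (fun t => (hout t).mono fun ω h => h.1)
    (ae_of_all _ fun ω => (hrad ω).1.const_mul _)
    (fun t => (hout t).mono fun ω h => h.2) ?_ (fun t => ?_)
    (fun ω s => ?_)
  · filter_upwards [Lp.coeFn_smul (Complex.exp (Complex.I * tau d)) (radMinus hd (gen hd a)),
      coeFn_radMinus hd (memLp_genFun hd a)] with ω h1 h2
    rw [smul_apply, h1, Pi.smul_apply, gen, h2, (hrad ω).2,
      toL2R_const_mul _ (hrad ω).1]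
  · rw [smul_apply, norm_smul, hu, one_mul, norm_radMinus, norm_outgoing]
  · have h := (Complex.continuous_conj.tendsto _).comp (tendsto_poisson_cone hd a ω s)
    rw [map_mul, hexp] at h
    refine h.congr fun t => ?_
    rw [hconj]
    rfl

/-! ### Uniqueness for the wave equation on the Fourier side -/

theorem memLp_comp_smul {V : Type*} [NormedAddCommGroup V] [NormedSpace ℝ V] [MeasurableSpace V]
    [BorelSpace V] [FiniteDimensional ℝ V] {μ : Measure V} [μ.IsAddHaarMeasure] {f : V → ℂ}
    (hf : MemLp f 2 μ) {r : ℝ} (hr : r ≠ 0) : MemLp (fun x => f (r • x)) 2 μ := by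
  have hm : AEStronglyMeasurable (fun x => f (r • x)) μ :=
    hf.1.comp_quasiMeasurePreserving (Measure.quasiMeasurePreserving_smul μ hr)
  rw [memLp_two_iff_integrable_sq_norm hm]
  exact ((memLp_two_iff_integrable_sq_norm hf.1).1 hf).comp_smul hr

theorem norm_integral_mul_le {α : Type*} [MeasurableSpace α] {μ : Measure α} {f g : α → ℂ}
    (hf : MemLp f 2 μ) (hg : MemLp g 2 μ) :
    ‖∫ x, f x * g x ∂μ‖ ≤ (eLpNorm f 2 μ).toReal * (eLpNorm g 2 μ).toReal := by
  have h1 : ‖∫ x, f x * g x ∂μ‖ₑ ≤ eLpNorm (f • g) 1 μ := by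
    rw [eLpNorm_one_eq_lintegral_enorm]
    exact enorm_integral_le_lintegral_enorm _
  have h2 : eLpNorm (f • g) 1 μ ≤ eLpNorm f 2 μ * eLpNorm g 2 μ :=
    eLpNorm_smul_le_mul_eLpNorm (p := 2) (q := 2) (r := 1) hg.1 hf.1
  have h3 := ENNReal.toReal_mono (ENNReal.mul_ne_top hf.2.ne hg.2.ne) (h1.trans h2)
  rwa [ENNReal.toReal_mul, toReal_enorm] at h3

/-- Here `k n'' = k (n+1)` with zero initial data. Two applications of the mean value inequality
trade one index for two powers of `t`, giving `‖k n t‖ ≤ C A^(n+m) t^(2m) / (2m)!` for every `m`. -/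
theorem eq_zero_of_hasDerivAt_chain {k l : ℕ → ℝ → ℂ} {C A T : ℝ} (hA : 0 ≤ A)
    (hk : ∀ n t, HasDerivAt (k n) (l n t) t) (hl : ∀ n t, HasDerivAt (l n) (k (n + 1) t) t)
    (hk0 : ∀ n, k n 0 = 0) (hl0 : ∀ n, l n 0 = 0)
    (hb : ∀ n, ∀ t ∈ Set.Icc 0 T, ‖k n t‖ ≤ C * A ^ n) {t : ℝ} (ht : t ∈ Set.Icc 0 T) :
    k 0 t = 0 := by
  have key : ∀ m n, ∀ t ∈ Set.Icc 0 T,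
      ‖k n t‖ ≤ C * A ^ (n + m) * (t ^ (2 * m) / (Nat.factorial (2 * m))) := by
    intro m
    induction m with
    | zero => intro n t ht; simpa using hb n t ht
    | succ m ih =>
      intro n
      have hder : ∀ (j : ℕ) (c t : ℝ), HasDerivAt (fun t : ℝ => c * (t ^ (j + 1) /
          (Nat.factorial (j + 1)))) (c * (t ^ j / (Nat.factorial j))) t := by
        intro j c t
        have h := ((hasDerivAt_pow (j + 1) t).div_const
          (Nat.factorial (j + 1) : ℝ)).const_mul c
        refine h.congr_deriv ?_
        rw [Nat.factorial_succ]
        have : (Nat.factorial j : ℝ) ≠ 0 := by positivity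
        push_cast
        field_simp
      have hL : ∀ t ∈ Set.Icc 0 T, ‖l n t‖ ≤
          C * A ^ (n + (m + 1)) * (t ^ (2 * m + 1) / (Nat.factorial (2 * m + 1))) := by
        intro t ht
        refine image_norm_le_of_norm_deriv_right_le_deriv_boundary (a := 0) (b := T)
          (f := l n) (f' := fun t => k (n + 1) t)
          (fun t _ => (hl n t).continuousAt.continuousWithinAt)
          (fun t _ => (hl n t).hasDerivWithinAt) ?_ (hder (2 * m) (C * A ^ (n + (m + 1))))
          (fun t ht => ?_) ht
        · simp [hl0]
        · have := ih (n + 1) t ⟨ht.1, ht.2.le⟩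
          rwa [show n + 1 + m = n + (m + 1) by ring] at this
      intro t ht
      refine image_norm_le_of_norm_deriv_right_le_deriv_boundary (a := 0) (b := T)
        (f := k n) (f' := fun t => l n t)
        (fun t _ => (hk n t).continuousAt.continuousWithinAt)
        (fun t _ => (hk n t).hasDerivWithinAt) ?_ (hder (2 * m + 1) (C * A ^ (n + (m + 1))))
        (fun t ht => hL t ⟨ht.1, ht.2.le⟩) ht
      simp [hk0]
  -- `A^m t^(2m)` is written as `(√A t)^(2m)` so as to compare it with an exponential series.
  have hlim : Tendsto (fun m : ℕ => C * ((Real.sqrt A * t) ^ (2 * m) / (Nat.factorial (2 * m))))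
      atTop (𝓝 (C * 0)) := by
    refine Tendsto.const_mul C ?_
    exact (FloorSemiring.tendsto_pow_div_factorial_atTop (Real.sqrt A * t)).comp
      (tendsto_id.const_mul_atTop' two_pos)
  have hle : ‖k 0 t‖ ≤ C * 0 := by
    refine ge_of_tendsto' hlim fun m => (key m 0 t ht).trans (le_of_eq ?_)
    rw [zero_add, mul_pow, pow_mul (Real.sqrt A), Real.sq_sqrt hA]
    ring
  rw [mul_zero] at hle
  exact norm_le_zero_iff.1 hle

theorem integrable_mul_of_compact (G : L2 d) {ψ : Space d → ℂ} (hψ : Continuous ψ)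
    (hψc : HasCompactSupport ψ) : Integrable fun ξ => G ξ * ψ ξ :=
  have h : MemLp ψ 2 volume := hψ.memLp_of_hasCompactSupport hψc
  (Lp.memLp G).integrable_mul h

theorem hasDerivAt_integral_phase (G : L2 d) {ψ : Space d → ℂ} (hψ : Continuous ψ)
    (hψc : HasCompactSupport ψ) (t : ℝ) :
    HasDerivAt (fun t => ∫ ξ, phase t ξ * G ξ * ψ ξ)
      (∫ ξ, phase t ξ * G ξ * (2 * Real.pi * Complex.I * ‖ξ‖ * ψ ξ)) t := by
  have hm : ∀ (t : ℝ) {χ : Space d → ℂ}, Continuous χ →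
      AEStronglyMeasurable (fun ξ => phase t ξ * G ξ * χ ξ) volume := fun t χ hχ =>
    ((continuous_phase t).aestronglyMeasurable.mul (Lp.aestronglyMeasurable G)).mul
      hχ.aestronglyMeasurable
  have hχ : Continuous fun ξ : Space d => 2 * Real.pi * Complex.I * (‖ξ‖ : ℂ) * ψ ξ := by fun_prop
  have hχc : HasCompactSupport fun ξ : Space d => 2 * Real.pi * Complex.I * (‖ξ‖ : ℂ) * ψ ξ :=
    hψc.mul_left
  refine (hasDerivAt_integral_of_dominated_loc_of_deriv_le (𝕜 := ℝ) (μ := volume)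
    (F := fun t ξ => phase t ξ * G ξ * ψ ξ)
    (F' := fun t ξ => phase t ξ * G ξ * (2 * Real.pi * Complex.I * ‖ξ‖ * ψ ξ))
    (bound := fun ξ => ‖G ξ * (2 * Real.pi * Complex.I * ‖ξ‖ * ψ ξ)‖) univ_mem
    (Eventually.of_forall fun t => hm t hψ) ?_ (hm t hχ) (ae_of_all _ fun ξ t _ => ?_)
    (integrable_mul_of_compact G hχ hχc).norm (ae_of_all _ fun ξ t _ => ?_)).2
  · refine (integrable_mul_of_compact G hψ hψc).mono (hm t hψ) (ae_of_all _ fun ξ => ?_)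
    simp [norm_phase]
  · rw [mul_assoc, norm_mul, norm_phase, one_mul]
  · have h := ((((Complex.ofRealCLM.hasDerivAt (x := t)).const_mul
      (2 * Real.pi * Complex.I)).mul_const (‖ξ‖ : ℂ)).cexp.mul_const (G ξ)).mul_const (ψ ξ)
    refine h.congr_deriv ?_
    simp [phase]
    ring

/-! ### The Laplacian and directional derivatives on the Fourier side, and uniqueness. -/

/-- Multiplication by `-(2π|ξ|)²`. -/
def mulSq (φ : 𝓢(Space d, ℂ)) : 𝓢(Space d, ℂ) :=
  -(2 * Real.pi : ℂ) ^ 2 • SchwartzMap.smulLeftCLM ℂ (fun ξ : Space d => ((‖ξ‖ ^ 2 : ℝ) : ℂ)) φ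

theorem mulSq_apply (φ : 𝓢(Space d, ℂ)) (ξ : Space d) :
    mulSq φ ξ = -(2 * Real.pi * ‖ξ‖) ^ 2 * φ ξ := by
  have h : (fun ξ : Space d => ((‖ξ‖ ^ 2 : ℝ) : ℂ)).HasTemperateGrowth := by fun_prop
  have h2 : mulSq φ ξ = -(2 * Real.pi : ℂ) ^ 2 *
      SchwartzMap.smulLeftCLM ℂ (fun ξ : Space d => ((‖ξ‖ ^ 2 : ℝ) : ℂ)) φ ξ := rfl
  rw [h2, SchwartzMap.smulLeftCLM_apply_apply h, smul_eq_mul]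
  push_cast
  ring

theorem fourier_laplacian_apply (u : 𝓢'(Space d, ℂ)) (φ : 𝓢(Space d, ℂ)) :
    𝓕 (Δ u) φ = 𝓕 u (mulSq φ) := by
  have h : 𝓕 (Δ u) φ = (-(2 * Real.pi) ^ 2 : ℝ) • u (𝓕 (SchwartzMap.smulLeftCLM ℂ
      (fun ξ : Space d => ((‖ξ‖ ^ 2 : ℝ) : ℂ)) (𝓕⁻ (𝓕 φ)))) := by
    rw [TemperedDistribution.laplacian_eq_fourierMultiplierCLM,
      TemperedDistribution.fourierMultiplierCLM_apply]
    rfl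
  have h2 : 𝓕 u (mulSq φ) = (-(2 * Real.pi : ℂ) ^ 2) • u (𝓕 (SchwartzMap.smulLeftCLM ℂ
      (fun ξ : Space d => ((‖ξ‖ ^ 2 : ℝ) : ℂ)) φ)) := by
    rw [mulSq, map_smul]
    rfl
  rw [h, h2, FourierTransform.fourierInv_fourier_eq, Complex.real_smul, smul_eq_mul]
  push_cast
  rfl

/-- Multiplication by `2πi⟪m, ξ⟫`. -/
def mulCoord (m : Space d) (φ : 𝓢(Space d, ℂ)) : 𝓢(Space d, ℂ) :=
  (2 * Real.pi * Complex.I : ℂ) •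
    SchwartzMap.smulLeftCLM ℂ (fun ξ : Space d => ((inner ℝ ξ m : ℝ) : ℂ)) φ

theorem mulCoord_apply (m : Space d) (φ : 𝓢(Space d, ℂ)) (ξ : Space d) :
    mulCoord m φ ξ = 2 * Real.pi * Complex.I * (inner ℝ ξ m : ℝ) * φ ξ := by
  have h : (fun ξ : Space d => ((inner ℝ ξ m : ℝ) : ℂ)).HasTemperateGrowth := by fun_prop
  have h2 : mulCoord m φ ξ = (2 * Real.pi * Complex.I : ℂ) *
      SchwartzMap.smulLeftCLM ℂ (fun ξ : Space d => ((inner ℝ ξ m : ℝ) : ℂ)) φ ξ := rfl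
  rw [h2, SchwartzMap.smulLeftCLM_apply_apply h, smul_eq_mul, ← mul_assoc]

theorem fourier_lineDeriv_apply (u : 𝓢'(Space d, ℂ)) (m : Space d) (φ : 𝓢(Space d, ℂ)) :
    𝓕 (∂_{m} u) φ = 𝓕 u (mulCoord m φ) := by
  have h : 𝓕 (∂_{m} u) φ = (2 * Real.pi * Complex.I : ℂ) • u (𝓕 (SchwartzMap.smulLeftCLM ℂ
      (fun ξ : Space d => ((inner ℝ ξ m : ℝ) : ℂ)) φ)) := by
    rw [TemperedDistribution.fourier_lineDerivOp_eq]
    rfl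
  rw [h, mulCoord, map_smul]
  rfl

theorem fourier_toTemperedDistribution_apply (F : L2 d) (φ : 𝓢(Space d, ℂ)) :
    𝓕 (F : 𝓢'(Space d, ℂ)) φ = ∫ ξ, (𝓕 F : L2 d) ξ * φ ξ := by
  rw [Lp.fourier_toTemperedDistribution_eq, Lp.toTemperedDistribution_apply]
  simp only [smul_eq_mul, mul_comm]

theorem phase_zero (ξ : Space d) : phase 0 ξ = 1 := by simp [phase]

theorem integral_phase_mul (t : ℝ) (G : L2 d) (ψ : Space d → ℂ) :
    ∫ ξ, phase t ξ * G ξ * ψ ξ = ∫ ξ, phaseMul t G ξ * ψ ξ := by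
  refine integral_congr_ae ?_
  filter_upwards [coeFn_phaseMul t G] with ξ h
  rw [h]

theorem norm_integral_phase_le (t : ℝ) (G : L2 d) (ψ : 𝓢(Space d, ℂ)) :
    ‖∫ ξ, phase t ξ * G ξ * ψ ξ‖ ≤ ‖G‖ * (eLpNorm ψ 2 volume).toReal := by
  rw [integral_phase_mul]
  refine (norm_integral_mul_le (Lp.memLp _) (ψ.memLp 2)).trans_eq ?_
  rw [← Lp.norm_def, LinearIsometry.norm_map]

/-- Pairing of `exp (2πit|ξ|) Gf + exp (-2πit|ξ|) Gg` with `ψ`. -/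
def wavePairing (Gf Gg : L2 d) (t : ℝ) (ψ : Space d → ℂ) : ℂ :=
  (∫ ξ, phase t ξ * Gf ξ * ψ ξ) + ∫ ξ, phase (-t) ξ * Gg ξ * ψ ξ

theorem hasDerivAt_wavePairing (Gf Gg : L2 d) {ψ : Space d → ℂ} (hψ : Continuous ψ)
    (hψc : HasCompactSupport ψ) (t : ℝ) :
    HasDerivAt (fun t => wavePairing Gf Gg t ψ)
      (wavePairing Gf (-Gg) t (fun ξ => 2 * Real.pi * Complex.I * ‖ξ‖ * ψ ξ)) t := by
  have h2 := (hasDerivAt_integral_phase Gg hψ hψc (-t)).scomp t (hasDerivAt_neg t)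
  refine ((hasDerivAt_integral_phase Gf hψ hψc t).add h2).congr_deriv ?_
  rw [wavePairing]
  congr 1
  rw [neg_one_smul, ← integral_neg]
  refine integral_congr_ae ?_
  filter_upwards [Lp.coeFn_neg Gg] with ξ h
  rw [h, Pi.neg_apply]
  ring

theorem wavePairing_zero (Gf Gg : L2 d) {ψ : Space d → ℂ} (hψ : Continuous ψ)
    (hψc : HasCompactSupport ψ) :
    wavePairing Gf Gg 0 ψ = ∫ ξ, (Gf + Gg : L2 d) ξ * ψ ξ := by
  rw [wavePairing, neg_zero]
  simp only [phase_zero, one_mul]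
  rw [← integral_add (integrable_mul_of_compact Gf hψ hψc) (integrable_mul_of_compact Gg hψ hψc)]
  refine integral_congr_ae ?_
  filter_upwards [Lp.coeFn_add Gf Gg] with ξ h
  rw [h, Pi.add_apply, add_mul]

theorem mulSq_iterate_apply (φ : 𝓢(Space d, ℂ)) (n : ℕ) (ξ : Space d) :
    mulSq^[n] φ ξ = (-(2 * Real.pi * ‖ξ‖) ^ 2) ^ n * φ ξ := by
  induction n with
  | zero => simp
  | succ n ih => rw [Function.iterate_succ_apply', mulSq_apply, ih, pow_succ]; ring

theorem hasCompactSupport_mulSq_iterate {φ : 𝓢(Space d, ℂ)} (hφ : HasCompactSupport φ) (n : ℕ) :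
    HasCompactSupport (mulSq^[n] φ) := by
  have : ⇑(mulSq^[n] φ) = fun ξ => (-(2 * Real.pi * (‖ξ‖ : ℂ)) ^ 2) ^ n * φ ξ :=
    funext fun ξ => mulSq_iterate_apply φ n ξ
  rw [this]
  exact hφ.mul_left

theorem norm_mulSq_iterate_le {φ : 𝓢(Space d, ℂ)} {M : ℝ} (hM : ∀ ξ ∈ tsupport φ, ‖ξ‖ ≤ M)
    (n : ℕ) (ξ : Space d) : ‖mulSq^[n] φ ξ‖ ≤ ((2 * Real.pi * M) ^ 2) ^ n * ‖φ ξ‖ := by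
  rw [mulSq_iterate_apply, norm_mul, norm_pow, norm_neg, norm_pow]
  by_cases hξ : ξ ∈ tsupport φ
  · have := hM ξ hξ
    have h0 : ‖(2 * Real.pi * ‖ξ‖ : ℂ)‖ = 2 * Real.pi * ‖ξ‖ := by
      simp [abs_of_pos Real.pi_pos]
    rw [h0]
    gcongr
  · simp [image_eq_zero_of_notMem_tsupport hξ]

theorem toReal_eLpNorm_le_mul {α : Type*} [MeasurableSpace α] {μ : Measure α} {f g : α → ℂ}
    {c : ℝ} (hc : 0 ≤ c) (hg : MemLp g 2 μ) (h : ∀ ξ, ‖f ξ‖ ≤ c * ‖g ξ‖) :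
    (eLpNorm f 2 μ).toReal ≤ c * (eLpNorm g 2 μ).toReal := by
  have h1 : eLpNorm f 2 μ ≤ ENNReal.ofReal c * eLpNorm g 2 μ :=
    eLpNorm_le_mul_eLpNorm_of_ae_le_mul (ae_of_all _ h) 2
  have h2 := ENNReal.toReal_mono (ENNReal.mul_ne_top ENNReal.ofReal_ne_top hg.2.ne) h1
  rwa [ENNReal.toReal_mul, ENNReal.toReal_ofReal hc] at h2

theorem exists_eLpNorm_mulSq_iterate_le {φ : 𝓢(Space d, ℂ)} (hφ : HasCompactSupport φ) :
    ∃ A : ℝ, 0 ≤ A ∧ ∀ n, (eLpNorm (mulSq^[n] φ) 2 volume).toReal ≤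
      A ^ n * (eLpNorm φ 2 volume).toReal := by
  obtain ⟨M, hM⟩ := hφ.isCompact.isBounded.exists_norm_le
  generalize hA : (2 * Real.pi * M) ^ 2 = A
  have hA0 : 0 ≤ A := hA ▸ sq_nonneg _
  refine ⟨A, hA0, fun n => toReal_eLpNorm_le_mul (pow_nonneg hA0 n) (φ.memLp 2) fun ξ => ?_⟩
  rw [← hA]
  exact norm_mulSq_iterate_le hM n ξ

/-- The equation turns two time derivatives of the pairing with `φ` into the pairing with `mulSq φ`,
and the half waves obey the same rule. The differences tested on `mulSq^[n] φ` thus form the chain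
of `eq_zero_of_hasDerivAt_chain`. Compact support of `φ` makes them grow only geometrically in `n`.
-/
theorem fourier_wave_apply {u v : ℝ → 𝓢'(Space d, ℂ)} {u₀ u₁ : 𝓢'(Space d, ℂ)} {F : ℝ → L2 d}
    (hw : IsWaveSolution u v u₀ u₁) (hF : IsContL2 u F) {Gf Gg : L2 d}
    (h0 : ∀ φ : 𝓢(Space d, ℂ), 𝓕 u₀ φ = ∫ ξ, (Gf + Gg : L2 d) ξ * φ ξ)
    (h1 : ∀ φ : 𝓢(Space d, ℂ), HasCompactSupport φ →
      𝓕 u₁ φ = ∫ ξ, (Gf - Gg : L2 d) ξ * (2 * Real.pi * Complex.I * ‖ξ‖ * φ ξ))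
    {t : ℝ} (ht : 0 ≤ t) {φ : 𝓢(Space d, ℂ)} (hφ : HasCompactSupport φ) :
    𝓕 (u t) φ = wavePairing Gf Gg t φ := by
  have hψc := hasCompactSupport_mulSq_iterate hφ
  have hcont : ∀ n, Continuous fun ξ : Space d =>
      2 * Real.pi * Complex.I * (‖ξ‖ : ℂ) * mulSq^[n] φ ξ := fun n => by fun_prop
  have hcompact : ∀ n, HasCompactSupport fun ξ : Space d =>
      2 * Real.pi * Complex.I * (‖ξ‖ : ℂ) * mulSq^[n] φ ξ := fun n => (hψc n).mul_left
  obtain ⟨A, hA, hAn⟩ := exists_eLpNorm_mulSq_iterate_le hφ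
  -- Continuity in `L²` on the compact interval, with Plancherel, bounds the pairings uniformly in
  -- time.
  obtain ⟨B, hB⟩ := (isCompact_Icc (a := 0) (b := t)).exists_bound_of_continuousOn
    hF.1.continuousOn
  have hB0 : 0 ≤ B := (norm_nonneg _).trans (hB 0 ⟨le_rfl, ht⟩)
  have key := eq_zero_of_hasDerivAt_chain
    (k := fun n t => 𝓕 (u t) (mulSq^[n] φ) - wavePairing Gf Gg t (mulSq^[n] φ))
    (l := fun n t => 𝓕 (v t) (mulSq^[n] φ) - wavePairing Gf (-Gg) t
      (fun ξ => 2 * Real.pi * Complex.I * ‖ξ‖ * mulSq^[n] φ ξ))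
    (C := (B + ‖Gf‖ + ‖Gg‖) * (eLpNorm φ 2 volume).toReal) hA
    (fun n t => (hw.hasDerivAt _ t).sub
      (hasDerivAt_wavePairing Gf Gg (mulSq^[n] φ).continuous (hψc n) t)) ?_ ?_ ?_ ?_ ⟨ht, le_rfl⟩
  · simpa [sub_eq_zero] using key
  · intro n t
    refine ((hw.hasDerivAt_deriv (𝓕 (mulSq^[n] φ)) t).sub
      (hasDerivAt_wavePairing Gf (-Gg) (hcont n) (hcompact n) t)).congr_deriv ?_
    rw [← TemperedDistribution.fourier_apply, fourier_laplacian_apply, neg_neg,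
      ← Function.iterate_succ_apply' mulSq n φ]
    congr 2
    ext ξ
    rw [Function.iterate_succ_apply', mulSq_apply]
    linear_combination (2 * Real.pi * (‖ξ‖ : ℂ)) ^ 2 * mulSq^[n] φ ξ * Complex.I_sq
  · intro n
    simp only [hw.init, h0]
    rw [wavePairing_zero _ _ (mulSq^[n] φ).continuous (hψc n), sub_self]
  · intro n
    simp only [hw.init_deriv]
    rw [h1 _ (hψc n), wavePairing_zero _ _ (hcont n) (hcompact n), ← sub_eq_add_neg, sub_self]
  · intro n s hs
    simp only [hF.2 s, fourier_toTemperedDistribution_apply]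
    have e1 := norm_integral_mul_le (Lp.memLp (𝓕 (F s) : L2 d)) ((mulSq^[n] φ).memLp 2)
    rw [← Lp.norm_def, Lp.norm_fourier_eq] at e1
    have e2 := norm_integral_phase_le s Gf (mulSq^[n] φ)
    have e3 := norm_integral_phase_le (-s) Gg (mulSq^[n] φ)
    have hN := hAn n
    have hN0 : 0 ≤ (eLpNorm (mulSq^[n] φ) 2 volume).toReal := ENNReal.toReal_nonneg
    calc _ ≤ _ := norm_sub_le _ _
      _ ≤ ‖F s‖ * _ + (‖Gf‖ * _ + ‖Gg‖ * _) :=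
        add_le_add e1 ((norm_add_le _ _).trans (add_le_add e2 e3))
      _ ≤ (B + ‖Gf‖ + ‖Gg‖) * (eLpNorm (mulSq^[n] φ) 2 volume).toReal := by
        rw [← add_mul, ← add_mul, ← add_assoc]
        gcongr
        exact hB s hs
      _ ≤ (B + ‖Gf‖ + ‖Gg‖) * (A ^ n * (eLpNorm φ 2 volume).toReal) := by gcongr
      _ = _ := by ring

theorem fourier_wave_eq {u v : ℝ → 𝓢'(Space d, ℂ)} {u₀ u₁ : 𝓢'(Space d, ℂ)} {F : ℝ → L2 d}
    (hw : IsWaveSolution u v u₀ u₁) (hF : IsContL2 u F) {Gf Gg : L2 d}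
    (h0 : ∀ φ : 𝓢(Space d, ℂ), 𝓕 u₀ φ = ∫ ξ, (Gf + Gg : L2 d) ξ * φ ξ)
    (h1 : ∀ φ : 𝓢(Space d, ℂ), HasCompactSupport φ →
      𝓕 u₁ φ = ∫ ξ, (Gf - Gg : L2 d) ξ * (2 * Real.pi * Complex.I * ‖ξ‖ * φ ξ))
    {t : ℝ} (ht : 0 ≤ t) : 𝓕 (F t) = phaseMul t Gf + phaseMul (-t) Gg := by
  have hloc : ∀ G : L2 d, LocallyIntegrableOn G Set.univ volume := fun G =>
    ((Lp.memLp G).locallyIntegrable one_le_two).locallyIntegrableOn _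
  refine Lp.ext ?_
  have := ae_eq_of_forall_schwartz isOpen_univ (hloc (𝓕 (F t)))
    (hloc (phaseMul t Gf + phaseMul (-t) Gg)) fun φ hφ _ => ?_
  · filter_upwards [this] with ξ h using h trivial
  · rw [← fourier_toTemperedDistribution_apply, ← hF.2, fourier_wave_apply hw hF h0 h1 ht hφ,
      wavePairing, integral_phase_mul, integral_phase_mul,
      ← integral_add (integrable_mul_of_compact _ φ.continuous hφ)
        (integrable_mul_of_compact _ φ.continuous hφ)]
    refine integral_congr_ae ?_
    filter_upwards [Lp.coeFn_add (phaseMul t Gf) (phaseMul (-t) Gg)] with ξ h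
    rw [h, Pi.add_apply, add_mul]

/-! ### The Fourier transform as a function -/

theorem two_pi_ne_zero : 2 * Real.pi ≠ 0 := Real.two_pi_pos.ne'

theorem ae_smul {p : Space d → Prop} (hp : ∀ᵐ ξ, p ξ) {r : ℝ} (hr : r ≠ 0) :
    ∀ᵐ ξ : Space d, p (r • ξ) :=
  (Measure.quasiMeasurePreserving_smul volume hr).ae hp

theorem ae_ne_zero (hd : 1 ≤ d) : ∀ᵐ ξ : Space d, ξ ≠ 0 := by
  have : Nonempty (Fin d) := ⟨⟨0, hd⟩⟩
  exact Measure.ae_ne volume 0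

/-- The dilation `ξ ↦ U (2πξ)`. -/
def dil (U : Space d → ℂ) (ξ : Space d) : ℂ := U ((2 * Real.pi) • ξ)

theorem dil_congr {U V : Space d → ℂ} (h : U =ᵐ[volume] V) : dil U =ᵐ[volume] dil V :=
  ae_smul h two_pi_ne_zero

theorem eq_of_dil_ae {U V : Space d → ℂ} (h : dil U =ᵐ[volume] dil V) : U =ᵐ[volume] V := by
  filter_upwards [ae_smul h (inv_ne_zero two_pi_ne_zero)] with ξ hξ
  simpa only [dil, smul_inv_smul₀ two_pi_ne_zero] using hξ

theorem memLp_dil {U : Space d → ℂ} (hU : MemLp U 2 volume) : MemLp (dil U) 2 volume :=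
  memLp_comp_smul hU two_pi_ne_zero

theorem locallyIntegrableOn_comp_smul {U : Space d → ℂ} (hU : LocallyIntegrableOn U {0}ᶜ volume)
    {r : ℝ} (hr : r ≠ 0) : LocallyIntegrableOn (fun ξ => U (r • ξ)) {0}ᶜ volume := by
  have hlc : IsLocallyClosed ({0}ᶜ : Set (Space d)) := isOpen_compl_singleton.isLocallyClosed
  rw [locallyIntegrableOn_iff hlc] at hU ⊢
  intro k hk hkc
  have hk' : (fun ξ : Space d => r • ξ) '' k ⊆ {0}ᶜ := by
    rintro _ ⟨ξ, hξ, rfl⟩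
    exact smul_ne_zero hr (hk hξ)
  have hkc' := hkc.image (continuous_const_smul r : Continuous fun ξ : Space d => r • ξ)
  have h1 := ((integrable_indicator_iff hkc'.measurableSet).2 (hU _ hk' hkc')).comp_smul hr
  refine (integrable_indicator_iff hkc.measurableSet).1 (h1.congr (ae_of_all _ fun ξ => ?_))
  by_cases hξ : ξ ∈ k
  · exact (Set.indicator_of_mem (Set.mem_image_of_mem _ hξ) U).trans
      (Set.indicator_of_mem hξ fun ξ => U (r • ξ)).symm
  · refine (Set.indicator_of_notMem ?_ U).trans
      (Set.indicator_of_notMem hξ fun ξ => U (r • ξ)).symm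
    rintro ⟨η, hη, h⟩
    exact hξ (smul_right_injective _ hr h ▸ hη)

theorem IsFourierFun.locallyIntegrableOn_dil {u : 𝓢'(Space d, ℂ)} {U : Space d → ℂ}
    (h : IsFourierFun u U) : LocallyIntegrableOn (dil U) {0}ᶜ volume :=
  locallyIntegrableOn_comp_smul h.1 two_pi_ne_zero

/-- Test functions supported away from the origin determine a locally integrable function on the
complement of a null point. Hence `hat`, although a choice, agrees almost everywhere with any
explicit representative. -/
theorem IsFourierFun.ae_eq (hd : 1 ≤ d) {u : 𝓢'(Space d, ℂ)} {U V : Space d → ℂ}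
    (hU : IsFourierFun u U) (hV : IsFourierFun u V) : U =ᵐ[volume] V := by
  refine eq_of_dil_ae ?_
  have := ae_eq_of_forall_schwartz isOpen_compl_singleton hU.locallyIntegrableOn_dil
    hV.locallyIntegrableOn_dil fun φ hφ h0 => ?_
  · filter_upwards [this, ae_ne_zero hd] with ξ h1 h2 using h1 h2
  · have h0' : (0 : Space d) ∉ tsupport φ := fun h => h0 h rfl
    exact (hU.2 φ hφ h0').symm.trans (hV.2 φ hφ h0')

theorem isFourierFun_hat {u : 𝓢'(Space d, ℂ)} {U : Space d → ℂ} (h : IsFourierFun u U) :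
    IsFourierFun u (hat u) := by
  have h' : ∃ U, IsFourierFun u U := ⟨U, h⟩
  rw [hat, dif_pos h']
  exact h'.choose_spec

theorem IsFourierFun.hat_ae_eq (hd : 1 ≤ d) {u : 𝓢'(Space d, ℂ)} {U : Space d → ℂ}
    (h : IsFourierFun u U) : hat u =ᵐ[volume] U :=
  (isFourierFun_hat h).ae_eq hd h

theorem fourier_apply_of_dil_ae {F : L2 d} {U : Space d → ℂ}
    (hU : dil U =ᵐ[volume] (𝓕 F : L2 d)) (φ : 𝓢(Space d, ℂ)) :
    𝓕 (F : 𝓢'(Space d, ℂ)) φ = ∫ ξ, dil U ξ * φ ξ := by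
  rw [fourier_toTemperedDistribution_apply]
  refine integral_congr_ae ?_
  filter_upwards [hU] with ξ h
  rw [h]

theorem locallyIntegrableOn_of_memLp {U : Space d → ℂ} (hU : MemLp U 2 volume) (s : Set (Space d)) :
    LocallyIntegrableOn U s volume :=
  (hU.locallyIntegrable one_le_two).locallyIntegrableOn s

/-- The data of the Fourier transform of an element of `L²`. -/
theorem MemL2.exists_fourier {u : 𝓢'(Space d, ℂ)} (hu : MemL2 u) :
    ∃ U : Space d → ℂ, MemLp U 2 volume ∧ IsFourierFun u U ∧
      ∀ φ : 𝓢(Space d, ℂ), 𝓕 u φ = ∫ ξ, dil U ξ * φ ξ := by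
  obtain ⟨F, rfl⟩ := hu
  have hU : MemLp (fun ξ => (𝓕 F : L2 d) ((2 * Real.pi)⁻¹ • ξ)) 2 volume :=
    memLp_comp_smul (Lp.memLp _) (inv_ne_zero two_pi_ne_zero)
  have hdil : dil (fun ξ => (𝓕 F : L2 d) ((2 * Real.pi)⁻¹ • ξ)) =ᵐ[volume] (𝓕 F : L2 d) :=
    ae_of_all _ fun ξ => by simp only [dil, inv_smul_smul₀ two_pi_ne_zero]
  exact ⟨_, hU, ⟨locallyIntegrableOn_of_memLp hU _, fun φ _ _ => fourier_apply_of_dil_ae hdil φ⟩,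
    fourier_apply_of_dil_ae hdil⟩

theorem MemL2.isFourierFun_hat {u : 𝓢'(Space d, ℂ)} (hu : MemL2 u) : IsFourierFun u (hat u) := by
  obtain ⟨U, -, h, -⟩ := hu.exists_fourier
  exact WaveCone.isFourierFun_hat h

theorem MemL2.memLp_hat (hd : 1 ≤ d) {u : 𝓢'(Space d, ℂ)} (hu : MemL2 u) :
    MemLp (hat u) 2 volume := by
  obtain ⟨U, hU, h, -⟩ := hu.exists_fourier
  exact (memLp_congr_ae (h.hat_ae_eq hd)).2 hU

theorem integral_dil_congr {U V : Space d → ℂ} (h : U =ᵐ[volume] V) (φ : 𝓢(Space d, ℂ)) :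
    ∫ ξ, dil U ξ * φ ξ = ∫ ξ, dil V ξ * φ ξ := by
  refine integral_congr_ae ?_
  filter_upwards [dil_congr h] with ξ h
  rw [h]

theorem MemL2.fourier_apply (hd : 1 ≤ d) {u : 𝓢'(Space d, ℂ)} (hu : MemL2 u)
    (φ : 𝓢(Space d, ℂ)) : 𝓕 u φ = ∫ ξ, dil (hat u) ξ * φ ξ := by
  obtain ⟨U, hU, h, hφ⟩ := hu.exists_fourier
  rw [hφ, integral_dil_congr (h.hat_ae_eq hd)]

theorem locallyIntegrableOn_of_div_norm {U : Space d → ℂ}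
    (hU : MemLp (fun ξ => U ξ / (‖ξ‖ : ℂ)) 2 volume) : LocallyIntegrableOn U {0}ᶜ volume := by
  have hlc : IsLocallyClosed ({0}ᶜ : Set (Space d)) := isOpen_compl_singleton.isLocallyClosed
  have h := (locallyIntegrableOn_of_memLp hU {0}ᶜ).continuousOn_mul
    (g := fun ξ : Space d => (‖ξ‖ : ℂ)) (by fun_prop) hlc
  rw [locallyIntegrableOn_iff hlc] at h ⊢
  intro k hk hkc
  refine (h k hk hkc).congr_fun (fun ξ hξ => ?_) hkc.measurableSet
  have : (‖ξ‖ : ℂ) ≠ 0 := by simpa using hk hξ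
  simp only []
  field_simp

theorem MemHneg1dot.exists_isFourierFun {u : 𝓢'(Space d, ℂ)} (hu : MemHneg1dot u) :
    ∃ U : Space d → ℂ, MemLp (fun ξ => U ξ / (‖ξ‖ : ℂ)) 2 volume ∧ IsFourierFun u U ∧
      ∀ φ : 𝓢(Space d, ℂ), 𝓕 u φ = ∫ ξ, dil U ξ * φ ξ := by
  obtain ⟨U, hU, -, h⟩ := hu
  exact ⟨U, hU, ⟨locallyIntegrableOn_of_div_norm hU, fun φ _ _ => h φ⟩, h⟩

theorem MemHneg1dot.isFourierFun_hat {u : 𝓢'(Space d, ℂ)} (hu : MemHneg1dot u) :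
    IsFourierFun u (hat u) := by
  obtain ⟨U, -, h, -⟩ := hu.exists_isFourierFun
  exact WaveCone.isFourierFun_hat h

theorem MemHneg1dot.memLp_hat_div (hd : 1 ≤ d) {u : 𝓢'(Space d, ℂ)} (hu : MemHneg1dot u) :
    MemLp (fun ξ => hat u ξ / (Complex.I * ‖ξ‖)) 2 volume := by
  obtain ⟨U, hU, h, -⟩ := hu.exists_isFourierFun
  refine (memLp_congr_ae ?_).2 (hU.const_mul (Complex.I)⁻¹)
  filter_upwards [h.hat_ae_eq hd] with ξ h
  rw [h, div_mul_eq_div_div, div_div, mul_comm Complex.I, ← div_div, div_eq_inv_mul _ Complex.I]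

theorem MemHneg1dot.fourier_apply (hd : 1 ≤ d) {u : 𝓢'(Space d, ℂ)} (hu : MemHneg1dot u)
    (φ : 𝓢(Space d, ℂ)) : 𝓕 u φ = ∫ ξ, dil (hat u) ξ * φ ξ := by
  obtain ⟨U, hU, h, hφ⟩ := hu.exists_isFourierFun
  rw [hφ, integral_dil_congr (h.hat_ae_eq hd)]

/-! ### The solution expressed through the two half waves. -/

theorem memLp_fHat (hd : 1 ≤ d) {u₀ u₁ : 𝓢'(Space d, ℂ)} (h0 : MemL2 u₀) (h1 : MemHneg1dot u₁) :
    MemLp (fHat u₀ u₁) 2 volume :=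
  ((h0.memLp_hat hd).add (h1.memLp_hat_div hd)).const_mul (1 / 2)

theorem memLp_gHat (hd : 1 ≤ d) {u₀ u₁ : 𝓢'(Space d, ℂ)} (h0 : MemL2 u₀) (h1 : MemHneg1dot u₁) :
    MemLp (gHat u₀ u₁) 2 volume :=
  ((h0.memLp_hat hd).sub (h1.memLp_hat_div hd)).const_mul (1 / 2)

/-- The dilated symbol as an element of `L²`. -/
def dilLp {U : Space d → ℂ} (hU : MemLp U 2 volume) : L2 d := (memLp_dil hU).toLp _

/-- The definitions of `f` and `g` solve `f̂ + ĝ = û₀` and `i|ξ|(f̂ - ĝ) = û₁`; the dilation by `2π`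
accounts for the factor `2πi|ξ|`. -/
theorem fourier_wave_eq_dilLp (hd : 1 ≤ d) {u v : ℝ → 𝓢'(Space d, ℂ)} {u₀ u₁ : 𝓢'(Space d, ℂ)}
    {F : ℝ → L2 d} (h0 : MemL2 u₀) (h1 : MemHneg1dot u₁) (hw : IsWaveSolution u v u₀ u₁)
    (hF : IsContL2 u F) {t : ℝ} (ht : 0 ≤ t) :
    𝓕 (F t) = phaseMul t (dilLp (memLp_fHat hd h0 h1)) +
      phaseMul (-t) (dilLp (memLp_gHat hd h0 h1)) := by
  set Gf := dilLp (memLp_fHat hd h0 h1)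
  set Gg := dilLp (memLp_gHat hd h0 h1)
  have hf : Gf =ᵐ[volume] dil (fHat u₀ u₁) := (memLp_dil (memLp_fHat hd h0 h1)).coeFn_toLp
  have hg : Gg =ᵐ[volume] dil (gHat u₀ u₁) := (memLp_dil (memLp_gHat hd h0 h1)).coeFn_toLp
  refine fourier_wave_eq hw hF (fun φ => ?_) (fun φ _ => ?_) ht
  · rw [h0.fourier_apply hd]
    refine integral_congr_ae ?_
    filter_upwards [hf, hg, Lp.coeFn_add Gf Gg] with ξ e1 e2 e3
    rw [e3, Pi.add_apply, e1, e2]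
    simp only [dil, fHat, gHat]
    ring
  · rw [h1.fourier_apply hd]
    refine integral_congr_ae ?_
    filter_upwards [hf, hg, Lp.coeFn_sub Gf Gg, ae_ne_zero hd] with ξ e1 e2 e3 hξ
    rw [e3, Pi.sub_apply, e1, e2]
    simp only [dil, fHat, gHat, norm_smul, Real.norm_of_nonneg Real.two_pi_pos.le]
    have : (‖ξ‖ : ℂ) ≠ 0 := by simpa using hξ
    have : (Real.pi : ℂ) ≠ 0 := by simp [Real.pi_ne_zero]
    push_cast
    field_simp
    ring

theorem shiftCyl_polar_wave (hd : 1 ≤ d) {u v : ℝ → 𝓢'(Space d, ℂ)} {u₀ u₁ : 𝓢'(Space d, ℂ)}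
    {F : ℝ → L2 d} (h0 : MemL2 u₀) (h1 : MemHneg1dot u₁) (hw : IsWaveSolution u v u₀ u₁)
    (hF : IsContL2 u F) {t : ℝ} (ht : 0 ≤ t) :
    shiftCyl d t (polar hd (F t)) = outgoing hd 1 t (dilLp (memLp_fHat hd h0 h1)) +
      outgoing hd (-1) t (dilLp (memLp_gHat hd h0 h1)) := by
  have h : F t = invF d (phaseMul t (dilLp (memLp_fHat hd h0 h1))) +
      invF d (phaseMul (-t) (dilLp (memLp_gHat hd h0 h1))) := by
    rw [← map_add, ← fourier_wave_eq_dilLp hd h0 h1 hw hF ht, invF_apply,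
      FourierTransform.fourierInv_fourier_eq]
  rw [h, map_add, map_add]
  simp [outgoing]

theorem tendsto_sqNormOutside (hd : 1 ≤ d) (R : ℝ) {u v : ℝ → 𝓢'(Space d, ℂ)}
    {u₀ u₁ : 𝓢'(Space d, ℂ)} {F : ℝ → L2 d} (h0 : MemL2 u₀) (h1 : MemHneg1dot u₁)
    (hw : IsWaveSolution u v u₀ u₁) (hF : IsContL2 u F) :
    Tendsto (fun t => sqNormOutside (t + R) (F t)) atTop (𝓝 (‖halfCyl d R
      (Complex.exp (Complex.I * tau d) • radMinus hd (dilLp (memLp_fHat hd h0 h1)) +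
      Complex.exp (-(Complex.I * tau d)) • radPlus hd (dilLp (memLp_gHat hd h0 h1)))‖ ^ 2)) := by
  have h := ((((halfCyl d R).continuous.tendsto _).comp
    ((tendsto_outgoing_one hd (dilLp (memLp_fHat hd h0 h1))).add
    (tendsto_outgoing_neg hd (dilLp (memLp_gHat hd h0 h1))))).norm.pow 2)
  refine h.congr' ?_
  filter_upwards [eventually_ge_atTop 0] with t ht
  rw [sqNormOutside_eq hd, shiftCyl_polar_wave hd h0 h1 hw hF ht]
  rfl

/-! ### Symbols -/

theorem invFourier_eq (H : ℝ → ℂ) :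
    invFourier H = invFR (toL2R fun k => H (2 * Real.pi * k)) := by
  rw [invFourier, toL2R]
  split_ifs
  · rfl
  · rw [map_zero]

theorem memLp_dil_real {H : ℝ → ℂ} (hH : MemLp H 2 volume) :
    MemLp (fun k => H (2 * Real.pi * k)) 2 volume :=
  memLp_comp_smul hH two_pi_ne_zero

theorem invFourier_congr {H K : ℝ → ℂ} (h : H =ᵐ[volume] K) : invFourier H = invFourier K := by
  rw [invFourier_eq, invFourier_eq]
  congr 1
  exact toL2R_congr ((Measure.quasiMeasurePreserving_smul volume two_pi_ne_zero).ae h)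

theorem invFourier_linear {H K : ℝ → ℂ} (a b : ℂ) (hH : MemLp H 2 volume) (hK : MemLp K 2 volume) :
    invFourier (fun ν => a * H ν + b * K ν) = a • invFourier H + b • invFourier K := by
  rw [invFourier_eq, toL2R_add ((memLp_dil_real hH).const_mul a) ((memLp_dil_real hK).const_mul b),
    toL2R_const_mul a (memLp_dil_real hH), toL2R_const_mul b (memLp_dil_real hK), map_add,
    map_smul, map_smul, ← invFourier_eq, ← invFourier_eq]

theorem ofSymbol_linear {H K L : Sph d → ℝ → ℂ} (hH : IsL2Symbol H) (hK : IsL2Symbol K) (a b : ℂ)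
    (h : ∀ᵐ ω ∂(surface d), L ω =ᵐ[volume] fun ν => a * H ω ν + b * K ω ν) :
    ofSymbol L =ᵐ[surface d] fun ω => a • ofSymbol H ω + b • ofSymbol K ω := by
  filter_upwards [h, hH.1, hK.1] with ω h h1 h2
  rw [ofSymbol, invFourier_congr h, invFourier_linear a b h1 h2]
  rfl

theorem IsL2Symbol.linear {H K L : Sph d → ℝ → ℂ} (hH : IsL2Symbol H) (hK : IsL2Symbol K) (a b : ℂ)
    (h : ∀ᵐ ω ∂(surface d), L ω =ᵐ[volume] fun ν => a * H ω ν + b * K ω ν) : IsL2Symbol L := by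
  refine ⟨?_, (memLp_congr_ae (ofSymbol_linear hH hK a b h)).2
    ((hH.2.const_smul a).add (hK.2.const_smul b))⟩
  filter_upwards [h, hH.1, hK.1] with ω h h1 h2
  exact (memLp_congr_ae h).2 ((h1.const_mul a).add (h2.const_mul b))

theorem plusSymbol_ae_eq (U : Space d → ℂ) (ω : Sph d) : plusSymbol U ω =ᵐ[volume] polarFun U ω := by
  filter_upwards [Measure.ae_ne volume (0 : ℝ)] with ν hν
  simp only [plusSymbol, polarFun]
  rcases hν.lt_or_gt with h | h
  · rw [if_neg h.not_ge, if_neg h.not_gt]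
  · rw [if_pos h.le, if_pos h, abs_of_pos h]

theorem minusSymbol_ae_eq (U : Space d → ℂ) (ω : Sph d) :
    minusSymbol U ω =ᵐ[volume] fun ν => polarFun (fun ξ => U (-ξ)) ω (-ν) := by
  filter_upwards [Measure.ae_ne volume (0 : ℝ)] with ν hν
  simp only [minusSymbol, polarFun]
  rcases hν.lt_or_gt with h | h
  · rw [if_pos h.le, if_pos (neg_pos.2 h), abs_of_neg h, neg_smul, neg_neg]
  · rw [if_neg h.not_ge, if_neg (by simpa using h.le)]

theorem memLp_comp_neg {U : Space d → ℂ} (hU : MemLp U 2 volume) :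
    MemLp (fun ξ => U (-ξ)) 2 volume :=
  hU.comp_measurePreserving (Measure.measurePreserving_neg volume)

theorem ae_memLp_plusSymbol (hd : 1 ≤ d) {U : Space d → ℂ} (hU : MemLp U 2 volume) :
    ∀ᵐ ω ∂(surface d), MemLp (plusSymbol U ω) 2 volume := by
  filter_upwards [ae_memLp_polarFun hd hU] with ω h
  exact (memLp_congr_ae (plusSymbol_ae_eq U ω)).2 h

theorem ae_memLp_minusSymbol (hd : 1 ≤ d) {U : Space d → ℂ} (hU : MemLp U 2 volume) :
    ∀ᵐ ω ∂(surface d), MemLp (minusSymbol U ω) 2 volume := by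
  filter_upwards [ae_memLp_polarFun hd (memLp_comp_neg hU)] with ω h
  exact (memLp_congr_ae (minusSymbol_ae_eq U ω)).2
    (h.comp_measurePreserving (Measure.measurePreserving_neg volume))

/-- `(2π) ^ ((d - 1) / 2)`. -/
def dilWeight (d : ℕ) : ℝ := (2 * Real.pi) ^ (((d : ℝ) - 1) / 2)

theorem dilWeight_sq : dilWeight d ^ 2 = (2 * Real.pi) ^ ((d : ℝ) - 1) := by
  rw [dilWeight, ← Real.rpow_natCast, ← Real.rpow_mul Real.two_pi_pos.le]
  congr 1
  push_cast
  ring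

theorem abs_two_pi_mul_rpow (ν : ℝ) :
    |2 * Real.pi * ν| ^ (((d : ℝ) - 1) / 2) = dilWeight d * |ν| ^ (((d : ℝ) - 1) / 2) := by
  rw [abs_mul, abs_of_pos Real.two_pi_pos, Real.mul_rpow Real.two_pi_pos.le (abs_nonneg _),
    dilWeight]

theorem plusSymbol_two_pi_mul (U : Space d → ℂ) (ω : Sph d) (k : ℝ) :
    plusSymbol U ω (2 * Real.pi * k) = dilWeight d * plusSymbol (dil U) ω k := by
  simp only [plusSymbol, dil, abs_two_pi_mul_rpow, mul_smul,
    mul_nonneg_iff_of_pos_left Real.two_pi_pos]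
  split_ifs
  · push_cast; ring
  · simp

theorem minusSymbol_two_pi_mul (U : Space d → ℂ) (ω : Sph d) (k : ℝ) :
    minusSymbol U ω (2 * Real.pi * k) = dilWeight d * minusSymbol (dil U) ω k := by
  have h : 2 * Real.pi * k ≤ 0 ↔ k ≤ 0 := by
    rw [← not_lt, mul_pos_iff_of_pos_left Real.two_pi_pos, not_lt]
  simp only [minusSymbol, dil, abs_two_pi_mul_rpow, mul_smul, h]
  split_ifs
  · push_cast; ring
  · simp

/-- Passing from `ν` to `2πk` scales the weight `|ν|^((d-1)/2)` by `(2π)^((d-1)/2)`. The square of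
this factor is what the prefactor `(2π)^{-(d-1)}` of the theorem compensates. -/
theorem ofSymbol_plusSymbol (hd : 1 ≤ d) {U : Space d → ℂ} (hU : MemLp U 2 volume) :
    ofSymbol (plusSymbol U) =ᵐ[surface d]
      fun ω => (dilWeight d : ℂ) • radPlus hd (dilLp hU) ω := by
  filter_upwards [coeFn_radPlus hd (memLp_dil hU), ae_memLp_plusSymbol hd (memLp_dil hU)]
    with ω h1 h2
  rw [dilLp, h1, ofSymbol, invFourier_eq]
  simp only [plusSymbol_two_pi_mul]
  rw [toL2R_const_mul _ h2, map_smul, toL2R_congr (plusSymbol_ae_eq _ ω), invFR_apply]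

theorem ofSymbol_minusSymbol (hd : 1 ≤ d) {U : Space d → ℂ} (hU : MemLp U 2 volume) :
    ofSymbol (minusSymbol U) =ᵐ[surface d]
      fun ω => (dilWeight d : ℂ) • radMinus hd (dilLp hU) ω := by
  filter_upwards [coeFn_radMinus hd (memLp_dil hU), ae_memLp_minusSymbol hd (memLp_dil hU)]
    with ω h1 h2
  rw [dilLp, h1, ofSymbol, invFourier_eq]
  simp only [minusSymbol_two_pi_mul]
  rw [toL2R_const_mul _ h2, map_smul, toL2R_congr (minusSymbol_ae_eq _ ω), invFR_apply]

theorem isL2Symbol_plusSymbol (hd : 1 ≤ d) {U : Space d → ℂ} (hU : MemLp U 2 volume) :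
    IsL2Symbol (plusSymbol U) :=
  ⟨ae_memLp_plusSymbol hd hU,
    (memLp_congr_ae (ofSymbol_plusSymbol hd hU)).2
      ((Lp.memLp (radPlus hd (dilLp hU))).const_smul (dilWeight d : ℂ))⟩

theorem isL2Symbol_minusSymbol (hd : 1 ≤ d) {U : Space d → ℂ} (hU : MemLp U 2 volume) :
    IsL2Symbol (minusSymbol U) :=
  ⟨ae_memLp_minusSymbol hd hU,
    (memLp_congr_ae (ofSymbol_minusSymbol hd hU)).2
      ((Lp.memLp (radMinus hd (dilLp hU))).const_smul (dilWeight d : ℂ))⟩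

theorem plusSymbol_congr (hd : 1 ≤ d) {U V : Space d → ℂ} (h : U =ᵐ[volume] V) :
    ∀ᵐ ω ∂(surface d), plusSymbol U ω =ᵐ[volume] plusSymbol V ω := by
  filter_upwards [Measure.ae_ae_of_ae_prod (polarFun_congr hd h)] with ω hω
  exact (plusSymbol_ae_eq U ω).trans (EventuallyEq.trans hω (plusSymbol_ae_eq V ω).symm)

theorem minusSymbol_congr (hd : 1 ≤ d) {U V : Space d → ℂ} (h : U =ᵐ[volume] V) :
    ∀ᵐ ω ∂(surface d), minusSymbol U ω =ᵐ[volume] minusSymbol V ω := by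
  have h' : (fun ξ => U (-ξ)) =ᵐ[volume] fun ξ => V (-ξ) :=
    (Measure.measurePreserving_neg volume).quasiMeasurePreserving.ae h
  filter_upwards [Measure.ae_ae_of_ae_prod (polarFun_congr hd h')] with ω hω
  have hω' : (fun ν : ℝ => polarFun (fun ξ => U (-ξ)) ω (-ν)) =ᵐ[volume]
      fun ν => polarFun (fun ξ => V (-ξ)) ω (-ν) :=
    (Measure.measurePreserving_neg volume).quasiMeasurePreserving.ae hω
  exact (minusSymbol_ae_eq U ω).trans (hω'.trans (minusSymbol_ae_eq V ω).symm)

/-! ### The radiation field of a solution with data in `L² × Ḣ⁻¹`. -/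

/-- The sum of the incoming part with symbol `U` and of the outgoing part with symbol `V`. -/
def radiation (U V : Space d → ℂ) (ω : Sph d) : L2R :=
  Complex.exp (Complex.I * tau d) • ofSymbol (minusSymbol U) ω +
    Complex.exp (-(Complex.I * tau d)) • ofSymbol (plusSymbol V) ω

theorem sqNormHalfLine_smul (R : ℝ) (c : ℂ) (h : L2R) :
    sqNormHalfLine R (c • h) = ‖c‖ ^ 2 * sqNormHalfLine R h := by
  rw [sqNormHalfLine_eq, sqNormHalfLine_eq, map_smul, norm_smul, mul_pow]

theorem sqNormCylinder_congr (R : ℝ) {h k : Sph d → L2R} (hk : h =ᵐ[surface d] k) :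
    sqNormCylinder R h = sqNormCylinder R k := by
  refine integral_congr_ae ?_
  filter_upwards [hk] with ω h
  rw [h]

theorem sqNormCylinder_smul (R : ℝ) (c : ℂ) (h : Sph d → L2R) :
    sqNormCylinder R (fun ω => c • h ω) = ‖c‖ ^ 2 * sqNormCylinder R h := by
  simp only [sqNormCylinder, sqNormHalfLine_smul, integral_const_mul]

theorem sqNormCylinder_coe (R : ℝ) (Φ : Cyl d) : sqNormCylinder R Φ = ‖halfCyl d R Φ‖ ^ 2 :=
  (norm_halfCyl_sq R Φ).symm

theorem tendsto_sqNormOutside_radiation (hd : 1 ≤ d) (R : ℝ) {u v : ℝ → 𝓢'(Space d, ℂ)}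
    {u₀ u₁ : 𝓢'(Space d, ℂ)} {F : ℝ → L2 d} (h0 : MemL2 u₀) (h1 : MemHneg1dot u₁)
    (hw : IsWaveSolution u v u₀ u₁) (hF : IsContL2 u F) :
    Tendsto (fun t => sqNormOutside (t + R) (F t)) atTop (𝓝 (1 / (2 * Real.pi) ^ ((d : ℝ) - 1) *
      sqNormCylinder R (radiation (fHat u₀ u₁) (gHat u₀ u₁)))) := by
  convert tendsto_sqNormOutside hd R h0 h1 hw hF using 2
  rw [← sqNormCylinder_coe]
  have h : radiation (fHat u₀ u₁) (gHat u₀ u₁) =ᵐ[surface d] fun ω => (dilWeight d : ℂ) •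
      (Complex.exp (Complex.I * tau d) • radMinus hd (dilLp (memLp_fHat hd h0 h1)) +
      Complex.exp (-(Complex.I * tau d)) • radPlus hd (dilLp (memLp_gHat hd h0 h1)) : Cyl d) ω := by
    filter_upwards [ofSymbol_minusSymbol hd (memLp_fHat hd h0 h1),
      ofSymbol_plusSymbol hd (memLp_gHat hd h0 h1),
      Lp.coeFn_add (Complex.exp (Complex.I * tau d) • radMinus hd (dilLp (memLp_fHat hd h0 h1)))
        (Complex.exp (-(Complex.I * tau d)) • radPlus hd (dilLp (memLp_gHat hd h0 h1))),
      Lp.coeFn_smul (Complex.exp (Complex.I * tau d)) (radMinus hd (dilLp (memLp_fHat hd h0 h1))),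
      Lp.coeFn_smul (Complex.exp (-(Complex.I * tau d)))
        (radPlus hd (dilLp (memLp_gHat hd h0 h1)))] with ω e1 e2 e3 e4 e5
    rw [radiation, e1, e2, e3, Pi.add_apply, e4, e5, Pi.smul_apply, Pi.smul_apply, smul_add,
      smul_comm (dilWeight d : ℂ) (Complex.exp (Complex.I * tau d)),
      smul_comm (dilWeight d : ℂ) (Complex.exp (-(Complex.I * tau d)))]
  rw [sqNormCylinder_congr R h, sqNormCylinder_smul, ← mul_assoc, Complex.norm_real,
    Real.norm_eq_abs, sq_abs, dilWeight_sq, one_div, inv_mul_cancel₀, one_mul]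
  exact (Real.rpow_pos_of_pos Real.two_pi_pos _).ne'

/-! ### Derivatives of the data and of the solution -/

theorem hasCompactSupport_mulCoord (m : Space d) {φ : 𝓢(Space d, ℂ)} (hφ : HasCompactSupport φ) :
    HasCompactSupport (mulCoord m φ) := by
  have : ⇑(mulCoord m φ) = fun ξ => 2 * Real.pi * Complex.I * (inner ℝ ξ m : ℝ) * φ ξ :=
    funext fun ξ => mulCoord_apply m φ ξ
  rw [this]
  exact hφ.mul_left

theorem tsupport_mulCoord_subset (m : Space d) (φ : 𝓢(Space d, ℂ)) :
    tsupport (mulCoord m φ) ⊆ tsupport φ := by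
  have : ⇑(mulCoord m φ) = fun ξ => 2 * Real.pi * Complex.I * (inner ℝ ξ m : ℝ) * φ ξ :=
    funext fun ξ => mulCoord_apply m φ ξ
  rw [this]
  exact tsupport_mul_subset_right

theorem partialDeriv_apply (j : Fin d) (u : 𝓢'(Space d, ℂ)) (φ : 𝓢(Space d, ℂ)) :
    𝓕 (partialDeriv j u) φ = 𝓕 u (mulCoord (EuclideanSpace.single j 1) φ) :=
  fourier_lineDeriv_apply u _ φ

theorem inner_single (ξ : Space d) (j : Fin d) :
    inner ℝ ξ (EuclideanSpace.single j (1 : ℝ)) = ξ j := by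
  simp [EuclideanSpace.inner_single_right]

theorem dil_mul_mulCoord (U : Space d → ℂ) (j : Fin d) (φ : 𝓢(Space d, ℂ)) (ξ : Space d) :
    dil U ξ * mulCoord (EuclideanSpace.single j 1) φ ξ =
      dil (fun ξ => Complex.I * ξ j * U ξ) ξ * φ ξ := by
  rw [mulCoord_apply, inner_single]
  simp only [dil, PiLp.smul_apply, smul_eq_mul]
  push_cast
  ring

theorem IsFourierFun.partialDeriv {u : 𝓢'(Space d, ℂ)} {U : Space d → ℂ} (h : IsFourierFun u U)
    (j : Fin d) : IsFourierFun (partialDeriv j u) (fun ξ => Complex.I * ξ j * U ξ) := by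
  refine ⟨h.1.continuousOn_mul (by fun_prop) isOpen_compl_singleton.isLocallyClosed,
    fun φ hφ h0 => ?_⟩
  rw [partialDeriv_apply, h.2 _ (hasCompactSupport_mulCoord _ hφ)
    fun h' => h0 (tsupport_mulCoord_subset _ φ h')]
  exact integral_congr_ae (ae_of_all _ fun ξ => dil_mul_mulCoord U j φ ξ)

theorem norm_coord_div_le (ξ : Space d) (j : Fin d) : ‖(ξ j : ℂ) / (‖ξ‖ : ℂ)‖ ≤ 1 := by
  rw [norm_div, Complex.norm_real, Complex.norm_real, norm_norm]
  exact div_le_one_of_le₀ (PiLp.norm_apply_le ξ j) (norm_nonneg _)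

theorem memLp_coord_div {H : Space d → ℂ} (hH : MemLp H 2 volume) (j : Fin d) :
    MemLp (fun ξ => (ξ j : ℂ) / (‖ξ‖ : ℂ) * H ξ) 2 volume := by
  have hm : Measurable fun ξ : Space d => (ξ j : ℂ) / (‖ξ‖ : ℂ) := by fun_prop
  refine hH.mono (hm.aestronglyMeasurable.mul hH.1) (ae_of_all _ fun ξ => ?_)
  rw [norm_mul]
  exact mul_le_of_le_one_left (norm_nonneg _) (norm_coord_div_le ξ j)

theorem memLp_coord_mul_div {H : Space d → ℂ} (hH : MemLp H 2 volume) (j : Fin d) :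
    MemLp (fun ξ => Complex.I * ξ j * H ξ / (‖ξ‖ : ℂ)) 2 volume := by
  refine (memLp_congr_ae (ae_of_all _ fun ξ => ?_)).2 ((memLp_coord_div hH j).const_mul Complex.I)
  simp only []
  ring

/-- `|ξ_j| ≤ |ξ|`. This makes `∂_j u₁` admissible initial velocity for the equation solved by `∂_j
u`. -/
theorem memHneg1dot_partialDeriv (hd : 1 ≤ d) {u : 𝓢'(Space d, ℂ)} (hu : MemL2 u) (j : Fin d) :
    MemHneg1dot (partialDeriv j u) := by
  have hH := hu.memLp_hat hd
  refine ⟨fun ξ => Complex.I * ξ j * hat u ξ, memLp_coord_mul_div hH j, ?_, fun φ => ?_⟩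
  · have hm : Continuous fun ξ : Space d => Complex.I * (ξ j : ℂ) := by fun_prop
    exact hm.aestronglyMeasurable.mul hH.1
  · rw [partialDeriv_apply, hu.fourier_apply hd]
    exact integral_congr_ae (ae_of_all _ fun ξ => dil_mul_mulCoord _ j φ ξ)

theorem integrable_dil_mul {U : Space d → ℂ} (hU : MemLp U 2 volume) (φ : 𝓢(Space d, ℂ)) :
    Integrable fun ξ => dil U ξ * φ ξ := by
  have h : MemLp φ 2 volume := φ.memLp 2
  exact (memLp_dil hU).integrable_mul h

theorem laplacian_eq_sum_partialDeriv (u : 𝓢'(Space d, ℂ)) :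
    Δ u = ∑ j, partialDeriv j (partialDeriv j u) := by
  rw [TemperedDistribution.laplacian_eq_sum (EuclideanSpace.basisFun (Fin d) ℝ)]
  simp [partialDeriv]

/-- `Δu` is a sum of derivatives of the square integrable functions `∂_j u`. This makes `Δu₀`
admissible initial velocity for `∂_t u`. -/
theorem memHneg1dot_laplacian (hd : 1 ≤ d) {u : 𝓢'(Space d, ℂ)} (hu : MemH1dot u) :
    MemHneg1dot (Δ u) := by
  have hH := fun j => (hu j).memLp_hat hd
  refine ⟨fun ξ => ∑ j, Complex.I * ξ j * hat (partialDeriv j u) ξ, ?_, ?_, fun φ => ?_⟩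
  · simp only [Finset.sum_div]
    exact memLp_finsetSum _ fun j _ => memLp_coord_mul_div (hH j) j
  · refine Finset.aestronglyMeasurable_fun_sum _ fun j _ => ?_
    have hm : Continuous fun ξ : Space d => Complex.I * (ξ j : ℂ) := by fun_prop
    exact hm.aestronglyMeasurable.mul (hH j).1
  · have h : 𝓕 (Δ u) φ = ∑ j, 𝓕 (partialDeriv j (partialDeriv j u)) φ := by
      rw [laplacian_eq_sum_partialDeriv, FourierTransform.fourier_sum]
      simp
    rw [h]
    simp only [partialDeriv_apply _ (partialDeriv _ u), (hu _).fourier_apply hd]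
    rw [← integral_finsetSum _ fun j _ => integrable_dil_mul (hH j) _]
    refine integral_congr_ae (ae_of_all _ fun ξ => ?_)
    simp only [dil_mul_mulCoord]
    simp only [dil, Finset.sum_mul]

/-- Division by `|ξ|²` is smooth on a neighbourhood of the support of `φ`, and elsewhere, in
particular near the origin, the quotient is locally zero. -/
theorem exists_mulSq_eq {φ : 𝓢(Space d, ℂ)} (hφ : HasCompactSupport φ)
    (h0 : (0 : Space d) ∉ tsupport φ) :
    ∃ χ : 𝓢(Space d, ℂ), mulSq χ = φ := by
  have hs : ContDiff ℝ ((⊤ : ℕ∞) : WithTop ℕ∞) fun ξ : Space d =>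
      ((-((2 * Real.pi) ^ 2 * ‖ξ‖ ^ 2)⁻¹ : ℝ) : ℂ) * φ ξ := by
    refine contDiff_iff_contDiffAt.2 fun ξ => ?_
    by_cases hξ : ξ ∈ tsupport φ
    · have hξ0 : ξ ≠ 0 := fun h => h0 (h ▸ hξ)
      have h1 : ContDiffAt ℝ ((⊤ : ℕ∞) : WithTop ℕ∞) (fun ξ : Space d => -((2 * Real.pi) ^ 2 * ‖ξ‖ ^ 2)⁻¹) ξ := by
        refine (ContDiffAt.inv ?_ ?_).neg
        · exact contDiffAt_const.mul (contDiff_norm_sq ℝ).contDiffAt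
        · have := norm_pos_iff.2 hξ0
          positivity
      exact (Complex.ofRealCLM.contDiff.contDiffAt.comp ξ h1).mul (φ.smooth ⊤).contDiffAt
    · refine (contDiffAt_const (c := (0 : ℂ))).congr_of_eventuallyEq ?_
      filter_upwards [(notMem_tsupport_iff_eventuallyEq.1 hξ)] with η hη
      rw [hη]
      simp
  have hc : HasCompactSupport fun ξ : Space d =>
      ((-((2 * Real.pi) ^ 2 * ‖ξ‖ ^ 2)⁻¹ : ℝ) : ℂ) * φ ξ := hφ.mul_left
  refine ⟨hc.toSchwartzMap hs, ?_⟩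
  ext ξ
  rw [mulSq_apply]
  change -(2 * Real.pi * (‖ξ‖ : ℂ)) ^ 2 *
    (((-((2 * Real.pi) ^ 2 * ‖ξ‖ ^ 2)⁻¹ : ℝ) : ℂ) * φ ξ) = φ ξ
  rcases eq_or_ne ξ 0 with rfl | hξ
  · rw [image_eq_zero_of_notMem_tsupport h0]
    simp
  · have : (‖ξ‖ : ℂ) ≠ 0 := by simpa using hξ
    have : (Real.pi : ℂ) ≠ 0 := by simp [Real.pi_ne_zero]
    push_cast
    field_simp

/-- An element of `Ḣ¹` has the Fourier transform `-|ξ|⁻²` times that of its Laplacian. -/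
theorem MemH1dot.isFourierFun (hd : 1 ≤ d) {u : 𝓢'(Space d, ℂ)} (hu : MemH1dot u) :
    IsFourierFun u (fun ξ => (-(‖ξ‖ ^ 2)⁻¹ : ℝ) * hat (Δ u) ξ) := by
  have hΔ := memHneg1dot_laplacian hd hu
  have hcont : ContinuousOn (fun ξ : Space d => ((-(‖ξ‖ ^ 2)⁻¹ : ℝ) : ℂ)) {0}ᶜ := by
    refine Complex.continuous_ofReal.comp_continuousOn (ContinuousOn.neg
      (ContinuousOn.inv₀ (by fun_prop) fun ξ hξ => ?_))
    exact pow_ne_zero 2 (norm_ne_zero_iff.2 hξ)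
  refine ⟨hΔ.isFourierFun_hat.1.continuousOn_mul hcont
    isOpen_compl_singleton.isLocallyClosed, fun φ hφ h0 => ?_⟩
  -- Writing the test function as `mulSq χ` moves the division by `|ξ|²` onto it, so only the
  -- pairing of `𝓕 (Δ u)` with `χ` remains.
  obtain ⟨χ, rfl⟩ := exists_mulSq_eq hφ h0
  rw [← fourier_laplacian_apply, hΔ.fourier_apply hd]
  refine integral_congr_ae ?_
  filter_upwards [ae_ne_zero hd] with ξ hξ
  rw [mulSq_apply, norm_smul, Real.norm_of_nonneg Real.two_pi_pos.le]
  have : (‖ξ‖ : ℂ) ≠ 0 := by simpa using hξ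
  have : (Real.pi : ℂ) ≠ 0 := by simp [Real.pi_ne_zero]
  rw [dil]
  push_cast
  field_simp

theorem MemH1dot.hat_laplacian (hd : 1 ≤ d) {u : 𝓢'(Space d, ℂ)} (hu : MemH1dot u) :
    hat (Δ u) =ᵐ[volume] fun ξ => -(‖ξ‖ : ℂ) ^ 2 * hat u ξ := by
  filter_upwards [(hu.isFourierFun hd).hat_ae_eq hd, ae_ne_zero hd] with ξ h hξ
  have : (‖ξ‖ : ℂ) ≠ 0 := by simpa using hξ
  rw [h]
  push_cast
  field_simp

theorem MemH1dot.memLp_norm_mul_hat (hd : 1 ≤ d) {u : 𝓢'(Space d, ℂ)} (hu : MemH1dot u) :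
    MemLp (fun ξ => Complex.I * (‖ξ‖ : ℂ) * hat u ξ) 2 volume := by
  refine (memLp_congr_ae ?_).2 ((memHneg1dot_laplacian hd hu).memLp_hat_div hd)
  filter_upwards [hu.hat_laplacian hd, ae_ne_zero hd] with ξ h hξ
  have : (‖ξ‖ : ℂ) ≠ 0 := by simpa using hξ
  rw [h]
  field_simp
  simp

theorem MemH1dot.hat_partialDeriv (hd : 1 ≤ d) {u : 𝓢'(Space d, ℂ)} (hu : MemH1dot u)
    (j : Fin d) : hat (partialDeriv j u) =ᵐ[volume] fun ξ => Complex.I * ξ j * hat u ξ :=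
  ((isFourierFun_hat (hu.isFourierFun hd)).partialDeriv j).hat_ae_eq hd

theorem MemL2.hat_partialDeriv (hd : 1 ≤ d) {u : 𝓢'(Space d, ℂ)} (hu : MemL2 u)
    (j : Fin d) : hat (partialDeriv j u) =ᵐ[volume] fun ξ => Complex.I * ξ j * hat u ξ :=
  (hu.isFourierFun_hat.partialDeriv j).hat_ae_eq hd

theorem MemL2.neg {u : 𝓢'(Space d, ℂ)} (hu : MemL2 u) : MemL2 (-u) := by
  obtain ⟨F, rfl⟩ := hu
  exact ⟨-F, (map_neg (Lp.toTemperedDistributionCLM ℂ volume 2) F).symm⟩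

theorem IsFourierFun.neg {u : 𝓢'(Space d, ℂ)} {U : Space d → ℂ} (h : IsFourierFun u U) :
    IsFourierFun (-u) (fun ξ => -U ξ) := by
  refine ⟨h.1.neg, fun φ hφ h0 => ?_⟩
  have : 𝓕 (-u) φ = -(𝓕 u φ) := rfl
  rw [this, h.2 φ hφ h0, ← integral_neg]
  simp only [neg_mul]

theorem MemL2.hat_neg (hd : 1 ≤ d) {u : 𝓢'(Space d, ℂ)} (hu : MemL2 u) :
    hat (-u) =ᵐ[volume] fun ξ => -hat u ξ :=
  hu.isFourierFun_hat.neg.hat_ae_eq hd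

/-- The time derivative solves the same equation with data `(u₁, Δu₀)`; the Laplacian is passed to
the test function. -/
theorem IsWaveSolution.deriv {u v : ℝ → 𝓢'(Space d, ℂ)} {u₀ u₁ : 𝓢'(Space d, ℂ)}
    (hw : IsWaveSolution u v u₀ u₁) : IsWaveSolution v (fun t => Δ (u t)) u₁ (Δ u₀) where
  init := hw.init_deriv
  init_deriv := by rw [hw.init]
  hasDerivAt := hw.hasDerivAt_deriv
  hasDerivAt_deriv φ t := by
    simp only [TemperedDistribution.laplacian_apply_apply]
    exact hw.hasDerivAt (Δ φ) t

theorem laplacian_partialDeriv_comm (j : Fin d) (u : 𝓢'(Space d, ℂ)) :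
    Δ (partialDeriv j u) = partialDeriv j (Δ u) := by
  have h : 𝓕 (Δ (partialDeriv j u)) = 𝓕 (partialDeriv j (Δ u)) := by
    ext φ
    rw [fourier_laplacian_apply, partialDeriv_apply, partialDeriv_apply, fourier_laplacian_apply]
    congr 1
    ext ξ
    simp only [mulSq_apply, mulCoord_apply]
    ring
  have h' := congrArg (fun w : 𝓢'(Space d, ℂ) => 𝓕⁻ w) h
  simpa only [FourierTransform.fourierInv_fourier_eq] using h'

theorem IsWaveSolution.partialDeriv {u v : ℝ → 𝓢'(Space d, ℂ)} {u₀ u₁ : 𝓢'(Space d, ℂ)}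
    (hw : IsWaveSolution u v u₀ u₁) (j : Fin d) :
    IsWaveSolution (fun t => partialDeriv j (u t)) (fun t => WaveCone.partialDeriv j (v t))
      (WaveCone.partialDeriv j u₀) (WaveCone.partialDeriv j u₁) where
  init := by rw [hw.init]
  init_deriv := by rw [hw.init_deriv]
  hasDerivAt φ t := by
    simp only [WaveCone.partialDeriv, TemperedDistribution.lineDerivOp_apply_apply]
    exact hw.hasDerivAt _ t
  hasDerivAt_deriv φ t := by
    rw [laplacian_partialDeriv_comm]
    simp only [WaveCone.partialDeriv, TemperedDistribution.lineDerivOp_apply_apply]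
    exact hw.hasDerivAt_deriv _ t

theorem IsWaveSolution.reverse {u v : ℝ → 𝓢'(Space d, ℂ)} {u₀ u₁ : 𝓢'(Space d, ℂ)}
    (hw : IsWaveSolution u v u₀ u₁) :
    IsWaveSolution (fun t => u (-t)) (fun t => -v (-t)) u₀ (-u₁) where
  init := by rw [neg_zero, hw.init]
  init_deriv := by rw [neg_zero, hw.init_deriv]
  hasDerivAt φ t := by
    refine ((hw.hasDerivAt φ (-t)).scomp t (hasDerivAt_neg t)).congr_deriv ?_
    rw [neg_one_smul]
    rfl
  hasDerivAt_deriv φ t := by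
    refine ((hw.hasDerivAt_deriv φ (-t)).scomp t (hasDerivAt_neg t)).neg.congr_deriv ?_
    rw [neg_one_smul, neg_neg]

theorem IsContL2.reverse {u : ℝ → 𝓢'(Space d, ℂ)} {F : ℝ → L2 d} (h : IsContL2 u F) :
    IsContL2 (fun t => u (-t)) (fun t => F (-t)) :=
  ⟨h.1.comp continuous_neg, fun t => h.2 (-t)⟩

theorem IsContL2.neg {u : ℝ → 𝓢'(Space d, ℂ)} {F : ℝ → L2 d} (h : IsContL2 u F) :
    IsContL2 (fun t => -u t) (fun t => -F t) :=
  ⟨h.1.neg, fun t => by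
    exact (congrArg _ (h.2 t)).trans
      (map_neg (Lp.toTemperedDistributionCLM ℂ volume 2) (F t)).symm⟩

theorem sqNormOutside_neg (ρ : ℝ) (F : L2 d) : sqNormOutside ρ (-F) = sqNormOutside ρ F := by
  refine integral_congr_ae (ae_restrict_of_ae ?_)
  filter_upwards [Lp.coeFn_neg F] with x hx
  rw [hx, Pi.neg_apply, norm_neg]

/-! ### The exterior energy -/

/-- A factor depending only on `ω` is a constant for the transform in `s`. -/
theorem ofSymbol_mul {H K : Sph d → ℝ → ℂ} (hH : IsL2Symbol H) (c : Sph d → ℂ)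
    (h : ∀ᵐ ω ∂(surface d), K ω =ᵐ[volume] fun ν => c ω * H ω ν) :
    ofSymbol K =ᵐ[surface d] fun ω => c ω • ofSymbol H ω := by
  filter_upwards [h, hH.1] with ω h h1
  have h' : K ω =ᵐ[volume] fun ν => c ω * H ω ν + 0 * H ω ν := by
    filter_upwards [h] with ν h
    rw [h, zero_mul, add_zero]
  rw [ofSymbol, invFourier_congr h', invFourier_linear _ _ h1 h1, zero_smul, add_zero]
  rfl

theorem radiation_mul (hd : 1 ≤ d) {U V U' V' : Space d → ℂ} (hU : MemLp U 2 volume)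
    (hV : MemLp V 2 volume) (c : Sph d → ℂ)
    (h1 : ∀ᵐ ω ∂(surface d), minusSymbol U' ω =ᵐ[volume] fun ν => c ω * minusSymbol U ω ν)
    (h2 : ∀ᵐ ω ∂(surface d), plusSymbol V' ω =ᵐ[volume] fun ν => c ω * plusSymbol V ω ν) :
    radiation U' V' =ᵐ[surface d] fun ω => c ω • radiation U V ω := by
  filter_upwards [ofSymbol_mul (isL2Symbol_minusSymbol hd hU) c h1,
    ofSymbol_mul (isL2Symbol_plusSymbol hd hV) c h2] with ω e1 e2
  rw [radiation, radiation, e1, e2, smul_add, smul_comm (c ω) (Complex.exp (Complex.I * tau d)),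
    smul_comm (c ω) (Complex.exp (-(Complex.I * tau d)))]

theorem memLp_radiation (hd : 1 ≤ d) {U V : Space d → ℂ} (hU : MemLp U 2 volume)
    (hV : MemLp V 2 volume) : MemLp (radiation U V) 2 (surface d) :=
  ((isL2Symbol_minusSymbol hd hU).2.const_smul (Complex.exp (Complex.I * tau d))).add
    ((isL2Symbol_plusSymbol hd hV).2.const_smul (Complex.exp (-(Complex.I * tau d))))

theorem norm_smul_sph (ω : Sph d) (ν : ℝ) : ‖ν • (ω : Space d)‖ = |ν| := by
  rw [norm_smul, norm_eq_of_mem_sphere, mul_one, Real.norm_eq_abs]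

/-- On the ray `ξ = νω` with `ν ≤ 0` one has `iν = -i|ξ|`; on `ν ≥ 0` the sign is opposite. -/
theorem dsSymbol_minusSymbol (U : Space d → ℂ) :
    dsSymbol (minusSymbol U) = minusSymbol (fun ξ => -(Complex.I * ‖ξ‖) * U ξ) := by
  ext ω ν
  simp only [dsSymbol, minusSymbol, norm_smul_sph]
  split_ifs with h
  · rw [abs_of_nonpos h]; push_cast; ring
  · rw [mul_zero]

theorem dsSymbol_plusSymbol (U : Space d → ℂ) :
    dsSymbol (plusSymbol U) = plusSymbol (fun ξ => Complex.I * ‖ξ‖ * U ξ) := by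
  ext ω ν
  simp only [dsSymbol, plusSymbol, norm_smul_sph]
  split_ifs with h
  · rw [abs_of_nonneg h]; ring
  · rw [mul_zero]

/-- On the ray `ξ = νω`, `iξ_j = ω_j · iν`: the angular factor splits off from `∂_s`. -/
theorem minusSymbol_coord (U : Space d → ℂ) (j : Fin d) (ω : Sph d) (ν : ℝ) :
    minusSymbol (fun ξ => Complex.I * ξ j * U ξ) ω ν =
      ((ω : Space d) j : ℂ) * minusSymbol (fun ξ => -(Complex.I * ‖ξ‖) * U ξ) ω ν := by
  simp only [minusSymbol, norm_smul_sph]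
  split_ifs with h
  · rw [abs_of_nonpos h, PiLp.smul_apply, smul_eq_mul]; push_cast; ring
  · rw [mul_zero]

theorem plusSymbol_coord (U : Space d → ℂ) (j : Fin d) (ω : Sph d) (ν : ℝ) :
    plusSymbol (fun ξ => Complex.I * ξ j * U ξ) ω ν =
      ((ω : Space d) j : ℂ) * plusSymbol (fun ξ => Complex.I * ‖ξ‖ * U ξ) ω ν := by
  simp only [plusSymbol, norm_smul_sph]
  split_ifs with h
  · rw [abs_of_nonneg h, PiLp.smul_apply, smul_eq_mul]; push_cast; ring
  · rw [mul_zero]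

theorem minusSymbol_linear (a b : ℂ) (U V : Space d → ℂ) (ω : Sph d) (ν : ℝ) :
    minusSymbol (fun ξ => a * U ξ + b * V ξ) ω ν =
      a * minusSymbol U ω ν + b * minusSymbol V ω ν := by
  simp only [minusSymbol]
  split_ifs <;> ring

theorem plusSymbol_linear (a b : ℂ) (U V : Space d → ℂ) (ω : Sph d) (ν : ℝ) :
    plusSymbol (fun ξ => a * U ξ + b * V ξ) ω ν =
      a * plusSymbol U ω ν + b * plusSymbol V ω ν := by
  simp only [plusSymbol]
  split_ifs <;> ring

/-- The value `ν = 0` is excluded because both half-line symbols include it. -/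
theorem tSymbol_eq (U : Space d → ℂ) (ω : Sph d) {ν : ℝ} (hν : ν ≠ 0) :
    tSymbol U ω ν = c0 d * Complex.exp (Complex.I * tau d) * minusSymbol U ω ν +
      c0 d * Complex.exp (-(Complex.I * tau d)) * plusSymbol U ω ν := by
  simp only [tSymbol, minusSymbol, plusSymbol]
  rcases hν.lt_or_gt with h | h
  · rw [if_pos h, if_pos h.le, if_neg h.not_ge]; ring
  · rw [if_neg h.not_gt, if_neg h.not_ge, if_pos h.le]; ring

theorem tSymbol_ae_eq (U : Space d → ℂ) (ω : Sph d) :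
    tSymbol U ω =ᵐ[volume] fun ν =>
      c0 d * Complex.exp (Complex.I * tau d) * minusSymbol U ω ν +
      c0 d * Complex.exp (-(Complex.I * tau d)) * plusSymbol U ω ν := by
  filter_upwards [Measure.ae_ne volume (0 : ℝ)] with ν hν using tSymbol_eq U ω hν

theorem dsSymbol_tSymbol_ae_eq (U : Space d → ℂ) (ω : Sph d) :
    dsSymbol (tSymbol U) ω =ᵐ[volume] fun ν =>
      c0 d * Complex.exp (Complex.I * tau d) * dsSymbol (minusSymbol U) ω ν +
      c0 d * Complex.exp (-(Complex.I * tau d)) * dsSymbol (plusSymbol U) ω ν := by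
  filter_upwards [tSymbol_ae_eq U ω] with ν h
  simp only [dsSymbol, h]
  ring

theorem tSymbol_congr (hd : 1 ≤ d) {U V : Space d → ℂ} (h : U =ᵐ[volume] V) :
    ∀ᵐ ω ∂(surface d), tSymbol U ω =ᵐ[volume] tSymbol V ω := by
  filter_upwards [minusSymbol_congr hd h, plusSymbol_congr hd h] with ω h1 h2
  filter_upwards [tSymbol_ae_eq U ω, tSymbol_ae_eq V ω, h1, h2] with ν e1 e2 e3 e4
  rw [e1, e2, e3, e4]

theorem c0_sq : c0 d ^ 2 = 1 / 2 * (1 / (2 * Real.pi) ^ ((d : ℝ) - 1)) := by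
  have h : 0 < (2 * Real.pi) ^ ((d : ℝ) - 1) := Real.rpow_pos_of_pos Real.two_pi_pos _
  rw [c0, div_pow, Real.sq_sqrt (by positivity)]
  field_simp

/-! ### Radiation of the gradient and of the time derivative. -/

section Energy

variable {u₀ u₁ : 𝓢'(Space d, ℂ)}

theorem norm_mul_fHat_ae_eq (hd : 1 ≤ d) :
    (fun ξ => -(Complex.I * ‖ξ‖) * fHat u₀ u₁ ξ) =ᵐ[volume] fun ξ =>
      1 / 2 * (-(Complex.I * ‖ξ‖) * hat u₀ ξ) + (-(1 / 2)) * hat u₁ ξ := by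
  filter_upwards [ae_ne_zero hd] with ξ hξ
  have : (‖ξ‖ : ℂ) ≠ 0 := by simpa using hξ
  have := Complex.I_ne_zero
  rw [fHat]
  field_simp
  ring

theorem norm_mul_gHat_ae_eq (hd : 1 ≤ d) :
    (fun ξ => Complex.I * ‖ξ‖ * gHat u₀ u₁ ξ) =ᵐ[volume] fun ξ =>
      1 / 2 * (Complex.I * ‖ξ‖ * hat u₀ ξ) + (-(1 / 2)) * hat u₁ ξ := by
  filter_upwards [ae_ne_zero hd] with ξ hξ
  have : (‖ξ‖ : ℂ) ≠ 0 := by simpa using hξ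
  have := Complex.I_ne_zero
  rw [gHat]
  field_simp
  ring

theorem memLp_neg_norm_mul_hat (hd : 1 ≤ d) (h0 : MemH1dot u₀) :
    MemLp (fun ξ => -(Complex.I * (‖ξ‖ : ℂ)) * hat u₀ ξ) 2 volume := by
  simp only [neg_mul]
  exact (h0.memLp_norm_mul_hat hd).neg

theorem memLp_norm_mul_fHat (hd : 1 ≤ d) (h0 : MemH1dot u₀) (h1 : MemL2 u₁) :
    MemLp (fun ξ => -(Complex.I * ‖ξ‖) * fHat u₀ u₁ ξ) 2 volume :=
  (memLp_congr_ae (norm_mul_fHat_ae_eq hd)).2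
    (((memLp_neg_norm_mul_hat hd h0).const_mul _).add ((h1.memLp_hat hd).const_mul _))

theorem memLp_norm_mul_gHat (hd : 1 ≤ d) (h0 : MemH1dot u₀) (h1 : MemL2 u₁) :
    MemLp (fun ξ => Complex.I * ‖ξ‖ * gHat u₀ u₁ ξ) 2 volume :=
  (memLp_congr_ae (norm_mul_gHat_ae_eq hd)).2
    (((h0.memLp_norm_mul_hat hd).const_mul _).add ((h1.memLp_hat hd).const_mul _))

theorem isL2Symbol_tSymbol (hd : 1 ≤ d) (h1 : MemL2 u₁) : IsL2Symbol (tSymbol (hat u₁)) :=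
  (isL2Symbol_minusSymbol hd (h1.memLp_hat hd)).linear (isL2Symbol_plusSymbol hd (h1.memLp_hat hd))
    _ _ (ae_of_all _ fun ω => tSymbol_ae_eq _ ω)

theorem isL2Symbol_dsSymbol_minusSymbol (hd : 1 ≤ d) (h0 : MemH1dot u₀) :
    IsL2Symbol (dsSymbol (minusSymbol (hat u₀))) := by
  rw [dsSymbol_minusSymbol]
  exact isL2Symbol_minusSymbol hd (memLp_neg_norm_mul_hat hd h0)

theorem isL2Symbol_dsSymbol_plusSymbol (hd : 1 ≤ d) (h0 : MemH1dot u₀) :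
    IsL2Symbol (dsSymbol (plusSymbol (hat u₀))) := by
  rw [dsSymbol_plusSymbol]
  exact isL2Symbol_plusSymbol hd (h0.memLp_norm_mul_hat hd)

theorem isL2Symbol_dsSymbol_tSymbol (hd : 1 ≤ d) (h0 : MemH1dot u₀) :
    IsL2Symbol (dsSymbol (tSymbol (hat u₀))) :=
  (isL2Symbol_dsSymbol_minusSymbol hd h0).linear (isL2Symbol_dsSymbol_plusSymbol hd h0)
    _ _ (ae_of_all _ fun ω => dsSymbol_tSymbol_ae_eq _ ω)

/-- The radiation field of the gradient and, up to sign, of the time derivative. -/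
def energyRadiation (u₀ u₁ : 𝓢'(Space d, ℂ)) : Sph d → L2R :=
  radiation (fun ξ => -(Complex.I * ‖ξ‖) * fHat u₀ u₁ ξ) (fun ξ => Complex.I * ‖ξ‖ * gHat u₀ u₁ ξ)

/-- Since `-i|ξ|f̂ = ½(-i|ξ|û₀ - û₁)` and `i|ξ|ĝ = ½(i|ξ|û₀ - û₁)`, the velocity enters with the
same minus sign at both signs of `ν`. The phases `e^{±iτ}` are those in the definition of `𝒯`. -/
theorem dsT_sub_T (hd : 1 ≤ d) (h0 : MemH1dot u₀) (h1 : MemL2 u₁) :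
    (fun ω => dsT u₀ ω - T u₁ ω) =ᵐ[surface d]
      fun ω => (2 * c0 d : ℂ) • energyRadiation u₀ u₁ ω := by
  have m1 := isL2Symbol_minusSymbol hd (memLp_neg_norm_mul_hat hd h0)
  have p1 := isL2Symbol_plusSymbol hd (h0.memLp_norm_mul_hat hd)
  have m2 := isL2Symbol_minusSymbol hd (h1.memLp_hat hd)
  have p2 := isL2Symbol_plusSymbol hd (h1.memLp_hat hd)
  have hm : ∀ᵐ ω ∂(surface d),
      minusSymbol (fun ξ => -(Complex.I * ‖ξ‖) * fHat u₀ u₁ ξ) ω =ᵐ[volume] fun ν =>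
        1 / 2 * minusSymbol (fun ξ => -(Complex.I * (‖ξ‖ : ℂ)) * hat u₀ ξ) ω ν +
          (-(1 / 2)) * minusSymbol (hat u₁) ω ν := by
    filter_upwards [minusSymbol_congr hd (norm_mul_fHat_ae_eq (u₀ := u₀) (u₁ := u₁) hd)] with ω h
    filter_upwards [h] with ν h
    rw [h, minusSymbol_linear]
  have hp : ∀ᵐ ω ∂(surface d),
      plusSymbol (fun ξ => Complex.I * ‖ξ‖ * gHat u₀ u₁ ξ) ω =ᵐ[volume] fun ν =>
        1 / 2 * plusSymbol (fun ξ => Complex.I * (‖ξ‖ : ℂ) * hat u₀ ξ) ω ν +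
          (-(1 / 2)) * plusSymbol (hat u₁) ω ν := by
    filter_upwards [plusSymbol_congr hd (norm_mul_gHat_ae_eq (u₀ := u₀) (u₁ := u₁) hd)] with ω h
    filter_upwards [h] with ν h
    rw [h, plusSymbol_linear]
  have hT := ofSymbol_linear m2 p2 _ _ (ae_of_all _ fun ω => tSymbol_ae_eq (hat u₁) ω)
  have hds := ofSymbol_linear (isL2Symbol_dsSymbol_minusSymbol hd h0)
    (isL2Symbol_dsSymbol_plusSymbol hd h0) _ _
    (ae_of_all _ fun ω => dsSymbol_tSymbol_ae_eq (hat u₀) ω)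
  rw [dsSymbol_minusSymbol, dsSymbol_plusSymbol] at hds
  filter_upwards [hT, hds, ofSymbol_linear m1 m2 _ _ hm, ofSymbol_linear p1 p2 _ _ hp]
    with ω e1 e2 e3 e4
  rw [T, dsT, e1, e2, energyRadiation, radiation, e3, e4]
  module

/-- The normalisation of `c₀` is made for `½ (2c₀)² = (2π)^{-(d-1)}`. -/
theorem energy_value (hd : 1 ≤ d) (R : ℝ) (h0 : MemH1dot u₀) (h1 : MemL2 u₁) :
    1 / (2 * Real.pi) ^ ((d : ℝ) - 1) * sqNormCylinder R (energyRadiation u₀ u₁) =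
      1 / 2 * sqNormCylinder R (fun ω => dsT u₀ ω - T u₁ ω) := by
  rw [sqNormCylinder_congr R (dsT_sub_T hd h0 h1), sqNormCylinder_smul, norm_mul,
    Complex.norm_real, Real.norm_eq_abs, mul_pow, sq_abs, c0_sq, Complex.norm_ofNat]
  ring

/-- `∑ ω_j² = 1` on the sphere; this is the source of equipartition. -/
theorem sum_sqNormCylinder_coord (R : ℝ) {Φ : Sph d → L2R} (hΦ : MemLp Φ 2 (surface d)) :
    ∑ j, sqNormCylinder R (fun ω => ((ω : Space d) j : ℂ) • Φ ω) = sqNormCylinder R Φ := by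
  have hint : Integrable (fun ω => sqNormHalfLine R (Φ ω)) (surface d) := by
    simp only [sqNormHalfLine_eq]
    have h := (halfLine R).comp_memLp' hΦ
    exact (memLp_two_iff_integrable_sq_norm h.1).1 h
  simp only [sqNormCylinder, sqNormHalfLine_smul, Complex.norm_real]
  rw [← integral_finsetSum]
  · refine integral_congr_ae (ae_of_all _ fun ω => ?_)
    simp only []
    rw [← Finset.sum_mul, ← EuclideanSpace.norm_sq_eq, norm_eq_of_mem_sphere, one_pow, one_mul]
  · intro j _
    have hm : Continuous fun ω : Sph d => ‖(ω : Space d) j‖ ^ 2 := by fun_prop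
    refine hint.mono (hm.aestronglyMeasurable.mul hint.1) (ae_of_all _ fun ω => ?_)
    rw [norm_mul]
    refine mul_le_of_le_one_left (norm_nonneg _) ?_
    have h := PiLp.norm_apply_le (ω : Space d) j
    rw [norm_eq_of_mem_sphere] at h
    rw [norm_pow, norm_norm]
    exact pow_le_one₀ (norm_nonneg _) h

variable {u v : ℝ → 𝓢'(Space d, ℂ)} {G : ℝ → Fin d → L2 d} {V : ℝ → L2 d}

/-- For the data `(u₁, Δu₀)` the two half waves have transforms `i|ξ|f̂` and `-i|ξ|ĝ`, so the
radiation field is minus `energyRadiation`. -/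
theorem tendsto_sqNormOutside_deriv (hd : 1 ≤ d) (R : ℝ) (h0 : MemH1dot u₀) (h1 : MemL2 u₁)
    (hw : IsWaveSolution u v u₀ u₁) (hV : IsContL2 v V) :
    Tendsto (fun t => sqNormOutside (t + R) (V t)) atTop
      (𝓝 (1 / 2 * sqNormCylinder R (fun ω => dsT u₀ ω - T u₁ ω))) := by
  rw [← energy_value hd R h0 h1]
  convert tendsto_sqNormOutside_radiation hd R h1 (memHneg1dot_laplacian hd h0) hw.deriv hV using 3
  -- The vanishing second term only brings the formula into the shape of `minusSymbol_linear`.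
  have hf : fHat u₁ (Δ u₀) =ᵐ[volume] fun ξ =>
      (-1) * (-(Complex.I * ‖ξ‖) * fHat u₀ u₁ ξ) + 0 * fHat u₀ u₁ ξ := by
    filter_upwards [h0.hat_laplacian hd, ae_ne_zero hd] with ξ h hξ
    have : (‖ξ‖ : ℂ) ≠ 0 := by simpa using hξ
    have := Complex.I_ne_zero
    rw [fHat, fHat, h]
    field_simp
    linear_combination (-(‖ξ‖ : ℂ) ^ 2 * hat u₀ ξ) * Complex.I_sq
  have hg : gHat u₁ (Δ u₀) =ᵐ[volume] fun ξ =>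
      (-1) * (Complex.I * ‖ξ‖ * gHat u₀ u₁ ξ) + 0 * gHat u₀ u₁ ξ := by
    filter_upwards [h0.hat_laplacian hd, ae_ne_zero hd] with ξ h hξ
    have : (‖ξ‖ : ℂ) ≠ 0 := by simpa using hξ
    have := Complex.I_ne_zero
    rw [gHat, gHat, h]
    field_simp
    linear_combination ((‖ξ‖ : ℂ) ^ 2 * hat u₀ ξ) * Complex.I_sq
  have hr := radiation_mul hd (U' := fHat u₁ (Δ u₀)) (V' := gHat u₁ (Δ u₀))
    (memLp_norm_mul_fHat hd h0 h1) (memLp_norm_mul_gHat hd h0 h1)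
    (fun _ => -1) (by
      filter_upwards [minusSymbol_congr hd hf] with ω h
      filter_upwards [h] with ν h
      rw [h, minusSymbol_linear, zero_mul, add_zero]) (by
      filter_upwards [plusSymbol_congr hd hg] with ω h
      filter_upwards [h] with ν h
      rw [h, plusSymbol_linear, zero_mul, add_zero])
  rw [sqNormCylinder_congr R hr, sqNormCylinder_smul, norm_neg, norm_one, one_pow, one_mul]
  rfl

/-- Each `∂_j u` radiates `ω_j` times the common field, so the sum over `j` gives the same limit as
the time derivative. -/
theorem tendsto_sqNormOutsideVec (hd : 1 ≤ d) (R : ℝ) (h0 : MemH1dot u₀) (h1 : MemL2 u₁)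
    (hw : IsWaveSolution u v u₀ u₁)
    (hG : ∀ j, IsContL2 (fun t => partialDeriv j (u t)) (fun t => G t j)) :
    Tendsto (fun t => sqNormOutsideVec (t + R) (G t)) atTop
      (𝓝 (1 / 2 * sqNormCylinder R (fun ω => dsT u₀ ω - T u₁ ω))) := by
  have hr : ∀ j, radiation (fHat (partialDeriv j u₀) (partialDeriv j u₁))
      (gHat (partialDeriv j u₀) (partialDeriv j u₁)) =ᵐ[surface d]
      fun ω => ((ω : Space d) j : ℂ) • energyRadiation u₀ u₁ ω := by
    intro j
    have hf : fHat (partialDeriv j u₀) (partialDeriv j u₁) =ᵐ[volume]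
        fun ξ => Complex.I * ξ j * fHat u₀ u₁ ξ := by
      filter_upwards [h0.hat_partialDeriv hd j, h1.hat_partialDeriv hd j] with ξ e1 e2
      rw [fHat, fHat, e1, e2]
      ring
    have hg : gHat (partialDeriv j u₀) (partialDeriv j u₁) =ᵐ[volume]
        fun ξ => Complex.I * ξ j * gHat u₀ u₁ ξ := by
      filter_upwards [h0.hat_partialDeriv hd j, h1.hat_partialDeriv hd j] with ξ e1 e2
      rw [gHat, gHat, e1, e2]
      ring
    refine radiation_mul hd (memLp_norm_mul_fHat hd h0 h1) (memLp_norm_mul_gHat hd h0 h1) _ ?_ ?_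
    · filter_upwards [minusSymbol_congr hd hf] with ω h
      filter_upwards [h] with ν h
      rw [h, minusSymbol_coord]
    · filter_upwards [plusSymbol_congr hd hg] with ω h
      filter_upwards [h] with ν h
      rw [h, plusSymbol_coord]
  have h := tendsto_finsetSum Finset.univ fun j _ => tendsto_sqNormOutside_radiation hd R
    (h0 j) (memHneg1dot_partialDeriv hd h1 j) (hw.partialDeriv j) (hG j)
  refine (h.congr fun t => rfl : Tendsto (fun t => sqNormOutsideVec (t + R) (G t)) atTop _).trans
    (le_of_eq (congrArg 𝓝 ?_))
  rw [← Finset.mul_sum, ← energy_value hd R h0 h1]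
  simp only [sqNormCylinder_congr R (hr _)]
  rw [sum_sqNormCylinder_coord R (Φ := energyRadiation u₀ u₁)
    (memLp_radiation hd (memLp_norm_mul_fHat hd h0 h1) (memLp_norm_mul_gHat hd h0 h1))]

theorem T_neg (hd : 1 ≤ d) (h1 : MemL2 u₁) : T (-u₁) =ᵐ[surface d] fun ω => (-1 : ℂ) • T u₁ ω := by
  refine ofSymbol_mul (isL2Symbol_tSymbol hd h1) (fun _ => -1) ?_
  filter_upwards [tSymbol_congr hd (h1.hat_neg hd)] with ω h
  filter_upwards [h] with ν h
  rw [h]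
  simp only [tSymbol]
  ring

theorem sqNormCylinder_parallelogram (R : ℝ) {Φ Ψ : Sph d → L2R} (hΦ : MemLp Φ 2 (surface d))
    (hΨ : MemLp Ψ 2 (surface d)) :
    1 / 2 * (sqNormCylinder R (fun ω => Φ ω - Ψ ω) + sqNormCylinder R (fun ω => Φ ω + Ψ ω)) =
      sqNormCylinder R Φ + sqNormCylinder R Ψ := by
  have h1 : sqNormCylinder R (fun ω => Φ ω - Ψ ω) =
      ‖halfCyl d R (hΦ.toLp Φ) - halfCyl d R (hΨ.toLp Ψ)‖ ^ 2 := by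
    rw [← map_sub, ← sqNormCylinder_coe]
    refine sqNormCylinder_congr R ?_
    filter_upwards [Lp.coeFn_sub (hΦ.toLp Φ) (hΨ.toLp Ψ), hΦ.coeFn_toLp, hΨ.coeFn_toLp]
      with ω e1 e2 e3
    rw [e1, Pi.sub_apply, e2, e3]
  have h2 : sqNormCylinder R (fun ω => Φ ω + Ψ ω) =
      ‖halfCyl d R (hΦ.toLp Φ) + halfCyl d R (hΨ.toLp Ψ)‖ ^ 2 := by
    rw [← map_add, ← sqNormCylinder_coe]
    refine sqNormCylinder_congr R ?_
    filter_upwards [Lp.coeFn_add (hΦ.toLp Φ) (hΨ.toLp Ψ), hΦ.coeFn_toLp, hΨ.coeFn_toLp]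
      with ω e1 e2 e3
    rw [e1, Pi.add_apply, e2, e3]
  rw [h1, h2, ← sqNormCylinder_congr R hΦ.coeFn_toLp, ← sqNormCylinder_congr R hΨ.coeFn_toLp,
    sqNormCylinder_coe, sqNormCylinder_coe]
  have := parallelogram_law_with_norm ℂ (halfCyl d R (hΦ.toLp Φ)) (halfCyl d R (hΨ.toLp Ψ))
  linarith

/-- Negative times are positive times of `u(-t)`, whose initial velocity is `-u₁`. With
equipartition the two limits are `‖∂_s 𝒯u₀ - 𝒯u₁‖²` and `‖∂_s 𝒯u₀ + 𝒯u₁‖²`, and the parallelogram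
law concludes. -/
theorem hasExteriorEnergy (hd : 1 ≤ d) (R : ℝ) (h0 : MemH1dot u₀) (h1 : MemL2 u₁)
    (hw : IsWaveSolution u v u₀ u₁)
    (hG : ∀ j, IsContL2 (fun t => partialDeriv j (u t)) (fun t => G t j)) (hV : IsContL2 v V) :
    HasExteriorEnergy R G V (sqNormCylinder R (dsT u₀) + sqNormCylinder R (T u₁)) := by
  have hplus : (fun ω => dsT u₀ ω - T (-u₁) ω) =ᵐ[surface d] fun ω => dsT u₀ ω + T u₁ ω := by
    filter_upwards [T_neg hd h1] with ω h
    rw [h, neg_one_smul, sub_neg_eq_add]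
  refine ⟨_, 1 / 2 * sqNormCylinder R (fun ω => dsT u₀ ω + T u₁ ω) +
    1 / 2 * sqNormCylinder R (fun ω => dsT u₀ ω + T u₁ ω), (tendsto_sqNormOutsideVec hd R h0 h1 hw hG).add
    (tendsto_sqNormOutside_deriv hd R h0 h1 hw hV), ?_, ?_⟩
  · have h := (tendsto_sqNormOutsideVec (G := fun t => G (-t)) hd R h0 h1.neg hw.reverse
      fun j => (hG j).reverse).add
      (tendsto_sqNormOutside_deriv hd R h0 h1.neg hw.reverse hV.reverse.neg)
    rw [sqNormCylinder_congr R hplus] at h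
    refine (h.comp tendsto_neg_atBot_atTop).congr' ?_
    filter_upwards [eventually_le_atBot 0] with t ht
    simp only [Function.comp, neg_neg, sqNormOutside_neg, abs_of_nonpos ht]
  · rw [← sqNormCylinder_parallelogram R (Φ := dsT u₀) (Ψ := T u₁)
      (isL2Symbol_dsSymbol_tSymbol hd h0).2 (isL2Symbol_tSymbol hd h1).2]
    ring

end Energy

/-! ### The relative phase of the two half waves. -/

theorem exp_neg_two_tau : Complex.exp (-(Complex.I * tau d)) =
    Complex.exp (Complex.I * tau d) *
      Complex.exp (-(Complex.I * (Real.pi / 2) * ((d : ℂ) - 1))) := by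
  rw [← Complex.exp_add]
  congr 1
  simp only [tau]
  push_cast
  ring

/-- The common unimodular factor `e^{iτ}` drops out of the norm and leaves the relative phase
`e^{-2iτ}`. -/
theorem sqNormHalfLine_radiation (R : ℝ) (U V : Space d → ℂ) (ω : Sph d) :
    sqNormHalfLine R (radiation U V ω) = sqNormHalfLine R (ofSymbol (minusSymbol U) ω +
      Complex.exp (-(Complex.I * (Real.pi / 2) * ((d : ℂ) - 1))) • ofSymbol (plusSymbol V) ω) := by
  rw [radiation, exp_neg_two_tau, mul_smul, ← smul_add, sqNormHalfLine_smul, mul_comm Complex.I,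
    Complex.norm_exp_ofReal_mul_I, one_pow, one_mul]

end WaveCone

end

open WaveCone in
theorem corollary2 (d : ℕ) (hd : 1 ≤ d) (R : ℝ) :
    (∀ (u v : ℝ → 𝓢'(Space d, ℂ)) (u₀ u₁ : 𝓢'(Space d, ℂ)) (F : ℝ → L2 d),
      MemL2 u₀ → MemHneg1dot u₁ → IsWaveSolution u v u₀ u₁ → IsContL2 u F →
        IsL2Symbol (minusSymbol (fHat u₀ u₁)) ∧ IsL2Symbol (plusSymbol (gHat u₀ u₁)) ∧
        Tendsto (fun t => sqNormOutside (t + R) (F t)) atTop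
          (𝓝 (1 / (2 * Real.pi) ^ ((d : ℝ) - 1) *
            ∫ ω, sqNormHalfLine R (ofSymbol (minusSymbol (fHat u₀ u₁)) ω +
              Complex.exp (-(Complex.I * (Real.pi / 2) * ((d : ℂ) - 1))) •
                ofSymbol (plusSymbol (gHat u₀ u₁)) ω) ∂(surface d)))) ∧
    (∀ (u v : ℝ → 𝓢'(Space d, ℂ)) (u₀ u₁ : 𝓢'(Space d, ℂ))
      (G : ℝ → Fin d → L2 d) (V : ℝ → L2 d),
      MemH1dot u₀ → MemL2 u₁ → IsWaveSolution u v u₀ u₁ →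
      (∀ j, IsContL2 (fun t => partialDeriv j (u t)) (fun t => G t j)) → IsContL2 v V →
        IsL2Symbol (dsSymbol (minusSymbol (fHat u₀ u₁))) ∧
        IsL2Symbol (dsSymbol (plusSymbol (gHat u₀ u₁))) ∧
        IsL2Symbol (dsSymbol (tSymbol (hat u₀))) ∧ IsL2Symbol (tSymbol (hat u₁)) ∧
        (∃ m : ℝ,
          Tendsto (fun t => sqNormOutsideVec (t + R) (G t)) atTop (𝓝 m) ∧
          Tendsto (fun t => sqNormOutside (t + R) (V t)) atTop (𝓝 m) ∧
          m = 1 / (2 * Real.pi) ^ ((d : ℝ) - 1) *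
            ∫ ω, sqNormHalfLine R
              (Complex.exp (Complex.I * tau d) •
                  ofSymbol (dsSymbol (minusSymbol (fHat u₀ u₁))) ω +
                Complex.exp (-(Complex.I * tau d)) •
                  ofSymbol (dsSymbol (plusSymbol (gHat u₀ u₁))) ω) ∂(surface d) ∧
          m = 1 / 2 * sqNormCylinder R (fun ω => dsT u₀ ω - T u₁ ω)) ∧
        HasExteriorEnergy R G V (sqNormCylinder R (dsT u₀) + sqNormCylinder R (T u₁))) := by
  refine ⟨fun u v u₀ u₁ F h0 h1 hw hF => ?_, fun u v u₀ u₁ G V h0 h1 hw hG hV => ?_⟩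
  · refine ⟨isL2Symbol_minusSymbol hd (memLp_fHat hd h0 h1),
      isL2Symbol_plusSymbol hd (memLp_gHat hd h0 h1), ?_⟩
    simp only [← sqNormHalfLine_radiation]
    exact tendsto_sqNormOutside_radiation hd R h0 h1 hw hF
  · refine ⟨?_, ?_, isL2Symbol_dsSymbol_tSymbol hd h0, isL2Symbol_tSymbol hd h1,
      ⟨_, tendsto_sqNormOutsideVec hd R h0 h1 hw hG,
        tendsto_sqNormOutside_deriv hd R h0 h1 hw hV, ?_, rfl⟩,
      hasExteriorEnergy hd R h0 h1 hw hG hV⟩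
    · rw [dsSymbol_minusSymbol]
      exact isL2Symbol_minusSymbol hd (memLp_norm_mul_fHat hd h0 h1)
    · rw [dsSymbol_plusSymbol]
      exact isL2Symbol_plusSymbol hd (memLp_norm_mul_gHat hd h0 h1)
    · rw [← energy_value hd R h0 h1, dsSymbol_minusSymbol, dsSymbol_plusSymbol]
      rfl
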